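/- Let $\Gamma=\bigoplus_{a=1}^m\mathbb Z\gamma^a$ be a lattice with a skew-symmetric integer pairing $\langle\cdot,\cdot\rangle$, $\omega^{ab}=\langle\gamma^a,\gamma^b\rangle$, a quadratic refinement $\sigma:\Gamma\to\mathbb C^\times$, $\sigma_\gamma\sigma_{\gamma'}=(-1)^{\langle\gamma,\gamma'\rangle}\sigma_{\gamma+\gamma'}$, and indices $\Omega:\Gamma\to\mathbb Z$ with $\Omega(0)=0$; put $\bar\Omega(\gamma)=\sum_{d|\gamma}d^{-2}\,\Omega(\gamma/d)$. For $\gamma=\sum_a q_a\gamma^a$ and $(z,\theta)\in\mathbb C^m\times\mathbb C^m$ let $Z_\gamma=\sum_aq_az^a$, $\theta_\gamma=\sum_aq_a\theta^a$, and $\ell_\gamma=\{t: Z_\gamma/t\in \mathrm i\mathbb R^-\}$, oriented from $0$ to $\infty$. We treat two presentations simultaneously: the *integer* one, $c=\Omega$, $L_2=\mathrm{Li}_2$, $L_1(x)=-\log(1-x)$, $L_0(x)=x/(1-x)$ (principal branches), and the *rational* one, $c=\bar\Omega$, $L_2(x)=L_1(x)=L_0(x)=x$. A charge is *active* if $c(\gamma)\neq0$.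 Write $$\sum\!\!\!\!\!\!\int_{1}=\sum_{\gamma_1\in\Gamma}c(\gamma_1)\int_{\ell_{\gamma_1}}\frac{dt_1}{t_1^2},\qquad K_{12}=\frac{\langle\gamma_1,\gamma_2\rangle}{2\pi \mathrm i}\,\frac{t_1t_2}{t_2-t_1},$$ and let a subscript $1$ on a function denote its value at $(\gamma_1,t_1)$. Let $U\subset\mathbb C^m\times\mathbb C^m$ be open, and let $\mathcal D_\gamma$ be the interior of the set of $(t,z,\theta)$ with $t\ne0$, $(z,\theta)\in U$ and $t\notin\ell_{\gamma'}$ for every active $\gamma'$ with $\langle\gamma,\gamma'\rangle\neq0$. Assume that over $U$, for every active $\gamma$, $Z_\gamma\neq0$ and $(t,z,\theta)\in\mathcal D_\gamma$ for all $t\in\ell_\gamma$ (no walls of marginal stability meet $U$). Let $\mathcal X_\gamma(t)=\mathcal X_\gamma(t;z,\theta)$ be holomorphic on $\mathcal D_\gamma$ and solve there the conformal TBA system $$\mathcal X_\gamma(t)=\sigma_\gamma e^{2\pi \mathrm i(\theta_\gamma-Z_\gamma/t)}\exp\Big[\frac1{2\pi \mathrm i}\sum_{\gamma'\in\Gamma}c(\gamma')\langle\gamma,\gamma'\rangle\int_{\ell_{\gamma'}}\frac{dt'}{t'}\,\frac{t}{t'-t}\,L_1(\mathcal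 X_{\gamma'}(t'))\Big];$$ in the integer presentation assume also $\mathcal X_\gamma(t)\notin[1,\infty)$ for $t\in\ell_\gamma$, $\gamma$ active. Define $$W=\frac1{2\pi \mathrm i}\sum_{\gamma}c(\gamma)\int_{\ell_\gamma}\frac{dt}{t^2}L_2(\mathcal X_\gamma(t))+\frac1{2(2\pi \mathrm i)^2}\sum_{\gamma,\gamma'}c(\gamma)c(\gamma')\int_{\ell_\gamma}\frac{dt}{t}\int_{\ell_{\gamma'}}\frac{dt'}{t'}\,\frac{\langle\gamma,\gamma'\rangle}{t-t'}\,L_1(\mathcal X_\gamma(t))L_1(\mathcal X_{\gamma'}(t')).$$ For a tangent vector $v=(v^z,v^\theta)$ let $D_v=\partial_v\log\mathcal X$ (at fixed $t$), $S_v(\gamma,t)=2\pi \mathrm i\,(v^\theta_\gamma-v^z_\gamma/t)$ with $v_\gamma=\sum_aq_av^a$, and let $(Th)_0=\sum\!\!\!\!\int_1K_{01}L_0(\mathcal X_1)h_1$, so that differentiating the TBA system gives $D_v=S_v+TD_v$. Convergence is assumed in the following sense, for all $v$ and all $(z,\theta)\in U$: 1. the sum-integrals of $\|\gamma\|(1+|t|^{-1})L_1(\mathcal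 X_\gamma)$ and of $L_2(\mathcal X_\gamma)$, and the double sum-integral of $K_{12}L_1(\mathcal X_1)L_1(\mathcal X_2)$, converge absolutely, with absolute values locally bounded on $U$; 2. the sum-integral of $\|\gamma\|L_0(\mathcal X_\gamma)D_v$ and the double sum-integral of $L_1(\mathcal X_1)K_{12}L_0(\mathcal X_2)D_{v,2}$ converge absolutely; 3. the series $\sum_{n\ge0}T^nS_v$ converges pointwise to $D_v$ on the domains $\mathcal D_\gamma$, each sum-integral of $\|\gamma\|L_0(\mathcal X_\gamma)T^nS_v$ converges absolutely, and $\sum_{n\ge0}\sum\!\!\!\!\int_1q_{1,b}L_0(\mathcal X_1)(T^nS_v)_1=\sum\!\!\!\!\int_1q_{1,b}L_0(\mathcal X_1)D_{v,1}$ for all $b$. Then, in either presentation, $W$ is twice continuously (complex) differentiable on $U$, and: (i) (section condition) for all $\gamma\in\Gamma$, all $a$, and all $(t,z,\theta)\in\mathcal D_\gamma$, $$u_a\mathcal X_\gamma=\Big[\frac{\partial}{\partial z^a}+\frac1t\frac{\partial}{\partial\theta^a}-\frac1{(2\pi)^2}\sum_{b,c}\omega^{bc}\frac{\partial^2W}{\partial\theta^a\partial\theta^b}\frac{\partial}{\partial\theta^c}\Big]\mathcal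 X_\gamma=0;$$ (ii) (heavenly equation) on $U$, for all $a,b$, $$\frac{\partial^2W}{\partial z^a\partial\theta^b}-\frac{\partial^2W}{\partial z^b\partial\theta^a}=\frac1{(2\pi)^2}\sum_{c,d}\omega^{cd}\frac{\partial^2W}{\partial\theta^a\partial\theta^c}\frac{\partial^2W}{\partial\theta^b\partial\theta^d};$$ (iii) (Joyce potential) on $U$, $F:=\sum_az^a\partial_{\theta^a}W=\sum_\gamma c(\gamma)Z_\gamma\int_{\ell_\gamma}\frac{dt}{t^2}L_1(\mathcal X_\gamma(t))$; that is, $F=-\sum_\gamma\Omega(\gamma)Z_\gamma\int_{\ell_\gamma}\frac{dt}{t^2}\log(1-\mathcal X_\gamma(t))$ in the integer presentation and $F=\sum_\gamma\bar\Omega(\gamma)Z_\gamma\int_{\ell_\gamma}\frac{dt}{t^2}\mathcal X_\gamma(t)$ in the rational one. -/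

import Mathlib

open Filter Topology
open scoped ENNReal

noncomputable section

namespace ConformalTBA

/-- The charge lattice `Γ = ℤ γ^1 + … + ℤ γ^m`; a charge `γ = ∑ q_a γ^a` is given by its
coefficients `q_a = γ a`. -/
abbrev Charge (m : ℕ) : Type := Fin m → ℤ

/-- The coordinates `(z, θ)` on the total space of the tangent bundle of the space of central
charges (and also tangent vectors `v = (v^z, v^θ)` at such a point). -/
abbrev Point (m : ℕ) : Type := (Fin m → ℂ) × (Fin m → ℂ)

/-- The coordinate tangent vector `∂/∂z^a`. -/
def dz {m : ℕ} (a : Fin m) : Point m := (Pi.single a 1, 0)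

/-- The coordinate tangent vector `∂/∂θ^a`. -/
def dθ {m : ℕ} (a : Fin m) : Point m := (0, Pi.single a 1)

/-- The partial derivative of `f` along the tangent vector `v`. -/
def pd {m : ℕ} (v : Point m) (f : Point m → ℂ) (p : Point m) : ℂ := fderiv ℂ f p v

/-- The linear extension of `γ^a ↦ v a`. Thus `Z_γ = lin γ z` with `z^a = Z_{γ^a}`, and
`θ_γ = lin γ θ`. -/
def lin {m : ℕ} (γ : Charge m) (v : Fin m → ℂ) : ℂ := ∑ a, (γ a : ℂ) * v a

/-- The discrete data: the matrix `ω^{ab} = ⟨γ^a, γ^b⟩` of the skew-symmetric integer pairing, a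
quadratic refinement `σ`, and the BPS indices `Ω` (at a fixed chamber, so independent of `z`). -/
structure BPSData (m : ℕ) where
  omega : Matrix (Fin m) (Fin m) ℤ
  skew : omega.transpose = -omega
  sigma : Charge m → ℂˣ
  sigma_mul : ∀ γ γ' : Charge m,
    sigma γ * sigma γ' = (-1) ^ (∑ a, ∑ b, γ a * omega a b * γ' b) * sigma (γ + γ')
  Omega : Charge m → ℤ
  Omega_zero : Omega 0 = 0

variable {m : ℕ}

/-- The pairing `⟨γ, γ'⟩`. -/
def BPSData.pair (B : BPSData m) (γ γ' : Charge m) : ℤ :=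
  ∑ a, ∑ b, γ a * B.omega a b * γ' b

/-- The rational invariants `Ωbar(γ) = ∑_{d ∣ γ} Ω(γ / d) / d²`; `d ∣ γ` means that `d` divides the
greatest common divisor of the coefficients of `γ`. The value at `γ = 0` is `0`. -/
def BPSData.OmegaBar (B : BPSData m) (γ : Charge m) : ℂ :=
  ∑ d ∈ (Finset.univ.gcd fun a => (γ a).natAbs).divisors,
    (B.Omega (fun a => γ a / (d : ℤ)) : ℂ) / (d : ℂ) ^ 2

/-- The principal branch of the dilogarithm, `Li₂(x) = -∫₀¹ log(1 - s x) ds / s`. -/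
def dilog (x : ℂ) : ℂ := -∫ s in (0 : ℝ)..1, Complex.log (1 - s * x) / s

/-- The two presentations of the TBA system and of the potentials: with the integer indices `Ω`,
and functions `-log(1 - X)`, `Li₂(X)` of the Fourier modes; or with the rational invariants
`Ωbar`, and functions linear in the Fourier modes. -/
inductive Presentation
  | integer
  | rational

/-- The index with which a charge is weighted: `Ω(γ)` or `Ωbar(γ)`. -/
def BPSData.index (B : BPSData m) : Presentation → Charge m → ℂ
  | .integer, γ => (B.Omega γ : ℂ)
  | .rational, γ => B.OmegaBar γ

/-- `Li₂(x)`, respectively `x`. -/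
def Presentation.li₂ : Presentation → ℂ → ℂ
  | .integer, x => dilog x
  | .rational, x => x

/-- `Li₁(x) = -log(1 - x)`, respectively `x`. -/
def Presentation.li₁ : Presentation → ℂ → ℂ
  | .integer, x => -Complex.log (1 - x)
  | .rational, x => x

/-- `Li₀(x) = x d/dx Li₁(x) = x / (1 - x)`, respectively `x`. -/
def Presentation.li₀ : Presentation → ℂ → ℂ
  | .integer, x => x / (1 - x)
  | .rational, x => x

/-- The values at which the principal branches of `log(1 - x)` and `Li₂(x)` are holomorphic, i.e.
`x ∉ [1, ∞)`; no restriction in the rational presentation. -/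
def Presentation.Admissible : Presentation → ℂ → Prop
  | .integer, x => 1 - x ∈ Complex.slitPlane
  | .rational, _ => True

/-- The BPS ray `ℓ_γ = {t : Z_γ / t ∈ i ℝ⁻}`. -/
def ray (γ : Charge m) (z : Fin m → ℂ) : Set ℂ :=
  {t | ∃ s : ℝ, 0 < s ∧ lin γ z / t = -(Complex.I * s)}

/-- The contour integral `∫_{ℓ_γ} f(t) dt`, from `0` to `∞` along the BPS ray, which is
parametrized by `t = r (i Z_γ)`, `0 < r < ∞`. -/
def rayIntegral (γ : Charge m) (z : Fin m → ℂ) (f : ℂ → ℂ) : ℂ :=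
  ∫ r in Set.Ioi (0 : ℝ), f (r * (Complex.I * lin γ z)) * (Complex.I * lin γ z)

/-- The integral `∫_{ℓ_γ} f(t) |dt|` of a nonnegative function. -/
def absRayIntegral (γ : Charge m) (z : Fin m → ℂ) (f : ℂ → ℝ≥0∞) : ℝ≥0∞ :=
  ∫⁻ r in Set.Ioi (0 : ℝ), f (r * (Complex.I * lin γ z)) * ‖Complex.I * lin γ z‖ₑ

variable (B : BPSData m) (P : Presentation)

/-- The sum-integral `∑_γ c(γ) ∫_{ℓ_γ} dt / t² F_γ(t)`, where `c` is `Ω` or `Ωbar`. -/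
def sumInt (z : Fin m → ℂ) (F : Charge m → ℂ → ℂ) : ℂ :=
  ∑' γ, B.index P γ * rayIntegral γ z (fun t => F γ t / t ^ 2)

/-- The corresponding absolute sum-integral `∑_γ |c(γ)| ∫_{ℓ_γ} |dt| / |t|² F_γ(t)` of a family of
nonnegative functions. A sum-integral of `F` converges absolutely if that of `|F|` is finite. -/
def absSumInt (z : Fin m → ℂ) (F : Charge m → ℂ → ℝ≥0∞) : ℝ≥0∞ :=
  ∑' γ, ‖B.index P γ‖ₑ * absRayIntegral γ z (fun t => F γ t * ‖1 / t ^ 2‖ₑ)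

/-- The kernel `K_{γγ'}(t,t') = ⟨γ,γ'⟩ / (2πi) · t t' / (t' - t)`. -/
def kernel (γ γ' : Charge m) (t t' : ℂ) : ℂ :=
  (B.pair γ γ' : ℂ) / (2 * Real.pi * Complex.I) * (t * t' / (t' - t))

/-- The domain `𝒟_γ` of the Fourier mode `X_γ`: the interior of the set of all `(t, z, θ)` with
`t ≠ 0` and `(z, θ) ∈ U` such that `t` lies on no ray `ℓ_γ'` across which `X_γ` jumps. -/
def dom (U : Set (Point m)) (γ : Charge m) : Set (ℂ × Point m) :=
  interior {q | q.1 ≠ 0 ∧ q.2 ∈ U ∧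
    ∀ γ', B.index P γ' ≠ 0 → B.pair γ γ' ≠ 0 → q.1 ∉ ray γ' q.2.1}

/-- Genericity of the open set `U` of parameters `(z, θ)`: active charges have nonzero central
charge, and on the ray of an active charge `γ` the mode `X_γ` is away from its jumps (for finitely
many active rays this says that no two active mutually non-local charges have the same ray, i.e.
that there is no wall of marginal stability in the base of `U`). -/
structure IsGeneric (U : Set (Point m)) : Prop where
  ne_zero : ∀ p ∈ U, ∀ γ, B.index P γ ≠ 0 → lin γ p.1 ≠ 0
  mem_dom : ∀ p ∈ U, ∀ γ, B.index P γ ≠ 0 → ∀ t ∈ ray γ p.1, (t, p) ∈ dom B P U γ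

/-- The semi-flat Fourier modes `σ_γ exp(2πi (θ_γ - Z_γ / t))`. -/
def Xsf (γ : Charge m) (t : ℂ) (p : Point m) : ℂ :=
  (B.sigma γ : ℂ) * Complex.exp (2 * Real.pi * Complex.I * (lin γ p.2 - lin γ p.1 / t))

/-- `X` is a holomorphic family of solutions of the conformal TBA system
`X_γ(t) = Xsf_γ(t) exp[1/(2πi) ∑_{γ'} c(γ') ⟨γ,γ'⟩ ∫_{ℓ_γ'} dt'/t' · t/(t'-t) · Li₁(X_γ'(t'))]`
with parameters in `U`. -/
structure IsSolution (U : Set (Point m)) (X : Charge m → ℂ → Point m → ℂ) : Prop where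
  tba : ∀ γ t p, (t, p) ∈ dom B P U γ →
    X γ t p = Xsf B γ t p * Complex.exp (1 / (2 * Real.pi * Complex.I) *
      ∑' γ', B.index P γ' * B.pair γ γ' *
        rayIntegral γ' p.1 (fun t' => 1 / t' * (t / (t' - t)) * P.li₁ (X γ' t' p)))
  holo : ∀ γ, AnalyticOnNhd ℂ (fun q : ℂ × Point m => X γ q.1 q.2) (dom B P U γ)
  branch : ∀ p ∈ U, ∀ γ, B.index P γ ≠ 0 → ∀ t ∈ ray γ p.1, P.Admissible (X γ t p)

variable (X : Charge m → ℂ → Point m → ℂ)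

/-- The logarithmic derivative `∂_v log X_γ(t)` along a tangent vector `v`, at fixed `t`. -/
def dlog (v : Point m) (p : Point m) (γ : Charge m) (t : ℂ) : ℂ :=
  pd v (X γ t) p / X γ t p

/-- `∂_v log Xsf_γ(t) = 2πi (v^θ_γ - v^z_γ / t)`. -/
def source (v : Point m) (γ : Charge m) (t : ℂ) : ℂ :=
  2 * Real.pi * Complex.I * (lin γ v.2 - lin γ v.1 / t)

/-- The linearized TBA operator
`(T h)_γ(t) = ∑_{γ'} c(γ') ∫_{ℓ_γ'} dt'/t'² K_{γγ'}(t,t') Li₀(X_γ'(t')) h_γ'(t')`. Differentiating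
the TBA system gives `∂_v log X = source v + T (∂_v log X)`. -/
def linOp (p : Point m) (h : Charge m → ℂ → ℂ) (γ : Charge m) (t : ℂ) : ℂ :=
  sumInt B P p.1 (fun γ' t' => kernel B γ γ' t t' * P.li₀ (X γ' t' p) * h γ' t')

/-- The convergence assumptions. The first three say that the sums over charges that define the
potentials and their first derivatives converge absolutely and locally uniformly: the absolute
sum-integrals are bounded near every point of `U`. The next two say the same, at each point, for
the sum-integrals obtained by differentiating under the sum, `v` being any tangent vector.
The last three say that the series `∑_n T^n (source v)`, obtained by iterating the differentiated
TBA system, consists of absolutely convergent sum-integrals, converges to `∂_v log X`, and may be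
integrated term by term in the second derivatives of `W`. -/
structure IsConvergent (U : Set (Point m)) : Prop where
  single₁ : ∀ p ∈ U, ∃ C : ℝ≥0∞, C ≠ ⊤ ∧ ∀ᶠ p' in 𝓝 p,
    absSumInt B P p'.1 (fun γ t =>
      ‖γ‖ₑ * (1 + ‖1 / t‖ₑ) * ‖P.li₁ (X γ t p')‖ₑ) ≤ C
  single₂ : ∀ p ∈ U, ∃ C : ℝ≥0∞, C ≠ ⊤ ∧ ∀ᶠ p' in 𝓝 p,
    absSumInt B P p'.1 (fun γ t => ‖P.li₂ (X γ t p')‖ₑ) ≤ C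
  double : ∀ p ∈ U, ∃ C : ℝ≥0∞, C ≠ ⊤ ∧ ∀ᶠ p' in 𝓝 p,
    absSumInt B P p'.1 (fun γ t => absSumInt B P p'.1 (fun γ' t' =>
      ‖kernel B γ γ' t t' * P.li₁ (X γ t p') * P.li₁ (X γ' t' p')‖ₑ)) ≤ C
  single_deriv : ∀ p ∈ U, ∀ v : Point m,
    absSumInt B P p.1 (fun γ t =>
      ‖γ‖ₑ * ‖P.li₀ (X γ t p) * dlog X v p γ t‖ₑ) ≠ ⊤
  double_deriv : ∀ p ∈ U, ∀ v : Point m,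
    absSumInt B P p.1 (fun γ t => absSumInt B P p.1 (fun γ' t' =>
      ‖kernel B γ γ' t t' * P.li₁ (X γ t p) * (P.li₀ (X γ' t' p) * dlog X v p γ' t')‖ₑ)) ≠ ⊤
  iter_abs : ∀ p ∈ U, ∀ (v : Point m) (n : ℕ),
    absSumInt B P p.1 (fun γ t =>
      ‖γ‖ₑ * ‖P.li₀ (X γ t p) * (linOp B P X p)^[n] (source v) γ t‖ₑ) ≠ ⊤
  iter_tendsto : ∀ γ t p, (t, p) ∈ dom B P U γ → ∀ v : Point m,
    Tendsto (fun N : ℕ => ∑ n ∈ Finset.range N, (linOp B P X p)^[n] (source v) γ t)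
      atTop (𝓝 (dlog X v p γ t))
  iter_integral_tendsto : ∀ p ∈ U, ∀ (v : Point m) (b : Fin m),
    Tendsto (fun N : ℕ => ∑ n ∈ Finset.range N, sumInt B P p.1 (fun γ t =>
        (γ b : ℂ) * P.li₀ (X γ t p) * (linOp B P X p)^[n] (source v) γ t))
      atTop (𝓝 (sumInt B P p.1 (fun γ t =>
        (γ b : ℂ) * P.li₀ (X γ t p) * dlog X v p γ t)))

/-- The Plebański potential
`W = 1/(2πi) ∑_γ c(γ) ∫_{ℓ_γ} dt/t² Li₂(X_γ(t)) + 1/(2 (2πi)²) ∑_{γ,γ'} c(γ) c(γ')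
∫_{ℓ_γ} dt/t ∫_{ℓ_γ'} dt'/t' ⟨γ,γ'⟩/(t-t') Li₁(X_γ(t)) Li₁(X_γ'(t'))`. In the integer presentation
`Li₁(X_γ(t)) Li₁(X_γ'(t')) = log(1 - X_γ(t)) log(1 - X_γ'(t'))`. -/
def plebanski (p : Point m) : ℂ :=
  1 / (2 * Real.pi * Complex.I) *
      ∑' γ, B.index P γ * rayIntegral γ p.1 (fun t => 1 / t ^ 2 * P.li₂ (X γ t p)) +
    1 / (2 * (2 * Real.pi * Complex.I) ^ 2) *
      ∑' γ, ∑' γ', B.index P γ * B.index P γ' *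
        rayIntegral γ p.1 (fun t => 1 / t *
          rayIntegral γ' p.1 (fun t' => 1 / t' * ((B.pair γ γ' : ℂ) / (t - t')) *
            P.li₁ (X γ t p) * P.li₁ (X γ' t' p)))

/-- The integral formula `∑_γ c(γ) Z_γ ∫_{ℓ_γ} dt/t² Li₁(X_γ(t))` for the Joyce potential. In the
integer presentation it reads `-∑_γ Ω(γ) Z_γ ∫_{ℓ_γ} dt/t² log(1 - X_γ(t))`. -/
def joyce (p : Point m) : ℂ :=
  ∑' γ, B.index P γ * lin γ p.1 * rayIntegral γ p.1 (fun t => 1 / t ^ 2 * P.li₁ (X γ t p))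

/-- The vector field `u_a = ∂_{z^a} + t⁻¹ ∂_{θ^a} - (2π)⁻² ∑_{b,c} ω^{bc} ∂_{θ^a} ∂_{θ^b} W ∂_{θ^c}`,
at fixed `t`, applied to a function `f` of `(z, θ)`. -/
def uField (W : Point m → ℂ) (t : ℂ) (a : Fin m) (f : Point m → ℂ) (p : Point m) : ℂ :=
  pd (dz a) f p + 1 / t * pd (dθ a) f p -
    1 / (2 * Real.pi : ℂ) ^ 2 * ∑ b, ∑ c, (B.omega b c : ℂ) *
      pd (dθ a) (pd (dθ b) W) p * pd (dθ c) f p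

end ConformalTBA

end

open ConformalTBA

/-!
The correction exponent of the TBA system is the sum-integral `E_γ(t) = ∑∫ K Li₁(X)`, so that the
double integral in `W` is a single one, `W = (2πi)⁻¹ ∑∫ (Li₂(X) - ½ Li₁(X) E)`. A sum-integral whose
absolute value is locally bounded is a holomorphic function of the parameters, and is differentiated
under the integral sign: the sub-mean-value inequality and Tonelli's theorem turn local boundedness
into domination (`exists_integrable_bound`, `holomorphic_integral`). Parametrizing the ray `ℓ_γ` by
`t = i Z_γ r`, the ray turns with the parameter, but its motion only contributes the integral of a
total derivative in `r`, which vanishes (`integral_Ioi_deriv_eq_zero`,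
`sumInt_contDiffOn_and_fderiv`).

Differentiating `W` and using the symmetry of the kernel to exchange the two factors of the double
integral leaves `∂_v W = (2πi)⁻¹ ∑∫ Li₁(X) S_v` (`pd_plebanski`), from which the formula for `F`
follows with `v = ∑ z^a ∂_{θ^a}` (`joyce_eq`). A further derivative expresses `∂_v ∂_{θ^b} W`
through the moments `∑∫ q_b Li₀(X) D_v` of the solution `D_v = S_v + T D_v` of the linearized system
(`pd_pd_plebanski`, `dlog_eq_source_add`).

The sources satisfy `S_{z^a} = -t⁻¹ S_{θ^a}`, and the commutator of `T` with multiplication by `t⁻¹`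
has finite rank: its values are combinations of the `S_{θ^c}` with the moments as coefficients
(`linOp_one_div_mul`). Iterating, `T^n S_{z^a} + t⁻¹ T^n S_{θ^a}` is a combination of the
`T^k S_{θ^c}` with `k < n`, with coefficients the moments of `T^(n-1-k) S_{θ^a}`
(`iterate_source_dz`): the `n`-th term of a Cauchy product. The three Neumann series are only
conditionally convergent, but Abel's limit theorem still multiplies them
(`sum_mul_eq_of_tendsto_cauchyProduct`), which gives the section condition (`dlog_dz_add`,
`uField_plebanski`). Integrated against `q_b Li₀(X)`, and combined with the symmetry of second
derivatives, it becomes the heavenly equation (`pd_dz_sub_pd_dz`).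
-/

noncomputable section

open MeasureTheory Metric

namespace ConformalTBA

/-! ### Integrals of holomorphic families -/

/-- One-variable mean value inequality along the complex line through `q` in the direction `h`. -/
theorem enorm_le_lintegral_circle {Q : Type*} [NormedAddCommGroup Q] [NormedSpace ℂ Q]
    {f : Q → ℂ} {q h : Q} {ρ : ℝ}
    (hf : DifferentiableOn ℂ f (ball q ρ)) (hh : ‖h‖ < ρ) :
    ENNReal.ofReal (2 * Real.pi) * ‖f q‖ₑ ≤
      ∫⁻ φ in Set.Ioc (0 : ℝ) (2 * Real.pi), ‖f (q + circleMap 0 1 φ • h)‖ₑ := by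
  have hmaps : ∀ w ∈ closedBall (0 : ℂ) 1, q + w • h ∈ ball q ρ := by
    intro w hw
    rw [mem_closedBall_zero_iff] at hw
    rw [mem_ball, dist_eq_norm, add_sub_cancel_left, norm_smul]
    calc ‖w‖ * ‖h‖ ≤ 1 * ‖h‖ := by gcongr
      _ < ρ := by simpa using hh
  have hdiff : DifferentiableOn ℂ (fun w : ℂ => f (q + w • h)) (closedBall 0 1) := by
    refine hf.comp (g := f) (f := fun w : ℂ => q + w • h) ?_ hmaps
    fun_prop
  have hd : DiffContOnCl ℂ (fun w : ℂ => f (q + w • h)) (ball 0 |1|) := by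
    rw [abs_one]
    refine DifferentiableOn.diffContOnCl ?_
    rwa [closure_ball (0 : ℂ) one_ne_zero]
  have hav := hd.circleAverage
  simp only [Real.circleAverage, zero_smul, add_zero] at hav
  have hpi : (0 : ℝ) < 2 * Real.pi := by positivity
  have h2 : ((2 * Real.pi : ℝ) : ℂ) * f q =
      ∫ φ in (0 : ℝ)..2 * Real.pi, f (q + circleMap 0 1 φ • h) := by
    rw [← hav, Complex.real_smul, ← mul_assoc, ← Complex.ofReal_mul,
      mul_inv_cancel₀ hpi.ne', Complex.ofReal_one, one_mul]
  have h3 : ENNReal.ofReal (2 * Real.pi) * ‖f q‖ₑ = ‖((2 * Real.pi : ℝ) : ℂ) * f q‖ₑ := by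
    rw [enorm_mul]
    congr 1
    rw [← ofReal_norm, Complex.norm_real, Real.norm_of_nonneg hpi.le]
  rw [h3, h2, intervalIntegral.integral_of_le hpi.le]
  exact enorm_integral_le_lintegral_enorm _

section HolomorphicParameter

variable {Q : Type*} [NormedAddCommGroup Q] [NormedSpace ℂ Q] [FiniteDimensional ℂ Q]

theorem stronglyMeasurable_clm_of_apply {Ω : Type*} [MeasurableSpace Ω] {L : Ω → Q →L[ℂ] ℂ}
    (h : ∀ v, Measurable fun ω => L ω v) : StronglyMeasurable L := by
  let b := Module.finBasis ℂ Q
  have hL : L = fun ω => ∑ i, L ω (b i) • (LinearMap.toContinuousLinearMap (b.coord i)) := by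
    funext ω
    ext x
    conv_lhs => rw [← b.sum_repr x]
    rw [map_sum]
    simp [mul_comm]
  rw [hL]
  refine Finset.stronglyMeasurable_fun_sum _ fun i _ => ?_
  exact (h (b i)).stronglyMeasurable.smul_const _

theorem stronglyMeasurable_fderiv_param {Ω : Type*} [MeasurableSpace Ω] {F : Ω → Q → ℂ}
    (hF : ∀ q, Measurable fun ω => F ω q) {q : Q} (hd : ∀ ω, DifferentiableAt ℂ (F ω) q) :
    StronglyMeasurable fun ω => fderiv ℂ (F ω) q := by
  refine stronglyMeasurable_clm_of_apply fun v => ?_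
  have hc : Tendsto (fun n : ℕ => ‖(n : ℂ)‖) atTop atTop := by
    simpa using tendsto_natCast_atTop_atTop
  refine measurable_of_tendsto_metrizable
    (f := fun (n : ℕ) ω => (n : ℂ) • (F ω (q + (n : ℂ)⁻¹ • v) - F ω q)) (fun n => ?_) ?_
  · exact ((hF _).sub (hF _)).const_mul _
  · rw [tendsto_pi_nhds]
    intro ω
    exact (hd ω).hasFDerivAt.lim v hc

variable [MeasurableSpace Q] [BorelSpace Q]

theorem measurePreserving_rotation (ν : Measure Q) [ν.IsAddHaarMeasure] {a : ℂ} (ha : ‖a‖ = 1) :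
    MeasurePreserving (fun x : Q => a • x) ν ν := by
  have ha0 : a ≠ 0 := by
    rintro rfl
    simp at ha
  have : FiniteDimensional ℝ Q := FiniteDimensional.complexToReal Q
  have : ProperSpace Q := FiniteDimensional.proper ℂ Q
  let f : Q →ₗ[ℝ] Q := ((a • LinearMap.id : Q →ₗ[ℂ] Q)).restrictScalars ℝ
  have hf : ∀ x, f x = a • x := fun x => rfl
  have hinj : Function.Injective f := by
    intro x y hxy
    exact smul_right_injective Q ha0 hxy
  have hdet : LinearMap.det f ≠ 0 := by
    have := (LinearEquiv.ofInjectiveEndo f hinj).isUnit_det'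
    exact this.ne_zero
  have hmap := Measure.map_linearMap_addHaar_eq_smul_addHaar ν hdet
  have hmeas : Measurable (fun x : Q => a • x) := measurable_const_smul a
  have hpre : (fun x : Q => a • x) ⁻¹' ball 0 1 = ball 0 1 := by
    ext x
    simp [norm_smul, ha]
  have hball : ν (ball (0 : Q) 1) = ENNReal.ofReal |(LinearMap.det f)⁻¹| * ν (ball (0 : Q) 1) := by
    have h1 : Measure.map (⇑f) ν (ball 0 1) = ν (ball 0 1) := by
      rw [show (⇑f) = fun x : Q => a • x from rfl,
        Measure.map_apply hmeas measurableSet_ball, hpre]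
    conv_lhs => rw [← h1, hmap, Measure.smul_apply, smul_eq_mul]
  have hpos : ν (ball (0 : Q) 1) ≠ 0 := (measure_ball_pos ν _ one_pos).ne'
  have hfin : ν (ball (0 : Q) 1) ≠ ⊤ := measure_ball_lt_top.ne
  have hone : ENNReal.ofReal |(LinearMap.det f)⁻¹| = 1 := by
    have := (ENNReal.mul_eq_right hpos hfin).1 hball.symm
    exact this
  refine ⟨hmeas, ?_⟩
  rw [show (fun x : Q => a • x) = ⇑f from rfl, hmap, hone, one_smul]

/-- Sub-mean-value inequality for holomorphic functions of several variables: balls about `0` are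
invariant under the rotations `h ↦ e^{iφ} h`, so averaging the one-variable mean value property
over directions gives an average over a ball. -/
theorem measure_ball_mul_enorm_le (ν : Measure Q) [ν.IsAddHaarMeasure] {f : Q → ℂ}
    (hfm : Measurable f) {q : Q} {ρ : ℝ} (hf : DifferentiableOn ℂ f (ball q ρ)) :
    ν (ball 0 ρ) * ‖f q‖ₑ ≤ ∫⁻ x in ball q ρ, ‖f x‖ₑ ∂ν := by
  have : FiniteDimensional ℝ Q := FiniteDimensional.complexToReal Q
  have : ProperSpace Q := FiniteDimensional.proper ℂ Q
  have hpi : (0 : ℝ) < 2 * Real.pi := by positivity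
  set J : ℝ≥0∞ := ENNReal.ofReal (2 * Real.pi) with hJ
  have hJ0 : J ≠ 0 := by simp [hJ, Real.pi_pos]
  have hJt : J ≠ ⊤ := ENNReal.ofReal_ne_top
  have hm2 : Measurable (fun x : Q × ℝ => ‖f (q + circleMap 0 1 x.2 • x.1)‖ₑ) := by
    refine (hfm.comp ?_).enorm
    refine measurable_const.add (Measurable.smul ?_ measurable_fst)
    exact (continuous_circleMap 0 1).measurable.comp measurable_snd
  have hrot : ∀ φ : ℝ, ∫⁻ h in ball (0 : Q) ρ, ‖f (q + circleMap 0 1 φ • h)‖ₑ ∂ν =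
      ∫⁻ x in ball q ρ, ‖f x‖ₑ ∂ν := by
    intro φ
    have hn : ‖circleMap 0 1 φ‖ = 1 := by simp
    have hmp : MeasurePreserving (fun h : Q => q + circleMap 0 1 φ • h) ν ν :=
      (measurePreserving_add_left ν q).comp (measurePreserving_rotation ν hn)
    have hpre : (fun h : Q => q + circleMap 0 1 φ • h) ⁻¹' ball q ρ = ball 0 ρ := by
      ext x
      simp [dist_eq_norm, norm_smul]
    have := (hmp.restrict_preimage (s := ball q ρ) measurableSet_ball).lintegral_comp
      (f := fun x => ‖f x‖ₑ) hfm.enorm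
    rw [hpre] at this
    exact this
  have key : J * (ν (ball 0 ρ) * ‖f q‖ₑ) ≤ J * ∫⁻ x in ball q ρ, ‖f x‖ₑ ∂ν := by
    calc J * (ν (ball 0 ρ) * ‖f q‖ₑ)
        = ∫⁻ _ in ball (0 : Q) ρ, J * ‖f q‖ₑ ∂ν := by
          rw [setLIntegral_const]; ring
      _ ≤ ∫⁻ h in ball (0 : Q) ρ, (∫⁻ φ in Set.Ioc (0 : ℝ) (2 * Real.pi),
            ‖f (q + circleMap 0 1 φ • h)‖ₑ) ∂ν := by
          refine setLIntegral_mono' measurableSet_ball fun h hh => ?_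
          exact enorm_le_lintegral_circle hf (by simpa using hh)
      _ = ∫⁻ φ in Set.Ioc (0 : ℝ) (2 * Real.pi), ∫⁻ h in ball (0 : Q) ρ,
            ‖f (q + circleMap 0 1 φ • h)‖ₑ ∂ν :=
          lintegral_lintegral_swap hm2.aemeasurable
      _ = J * ∫⁻ x in ball q ρ, ‖f x‖ₑ ∂ν := by
          simp_rw [hrot]
          rw [setLIntegral_const, Real.volume_Ioc, sub_zero, mul_comm]
  exact (ENNReal.mul_le_mul_iff_right hJ0 hJt).1 key

/-- A holomorphic family of integrands whose `L¹` norms are bounded has, locally, an integrable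
upper bound, for the integrand as well as for its derivative. -/
theorem exists_integrable_bound {Ω : Type*} [MeasurableSpace Ω] {μ : Measure Ω} [SFinite μ]
    {F : Ω → Q → ℂ} (hF : Measurable (Function.uncurry F)) {q : Q} {ρ : ℝ} (hρ : 0 < ρ)
    (hd : ∀ ω, DifferentiableOn ℂ (F ω) (ball q (4 * ρ))) {C : ℝ≥0∞} (hC : C ≠ ⊤)
    (hb : ∀ x ∈ ball q (4 * ρ), ∫⁻ ω, ‖F ω x‖ₑ ∂μ ≤ C) :
    ∃ bound : Ω → ℝ, Integrable bound μ ∧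
      ∀ᵐ ω ∂μ, ∀ x ∈ ball q ρ, ‖F ω x‖ ≤ bound ω ∧ ‖fderiv ℂ (F ω) x‖ ≤ bound ω := by
  have : FiniteDimensional ℝ Q := FiniteDimensional.complexToReal Q
  have : ProperSpace Q := FiniteDimensional.proper ℂ Q
  let ν : Measure Q := Measure.addHaar
  set N : Ω → ℝ≥0∞ := fun ω => ∫⁻ x in ball q (4 * ρ), ‖F ω x‖ₑ ∂ν with hN
  have hNm : Measurable N := by
    have : Measurable (Function.uncurry fun ω x => ‖F ω x‖ₑ) := hF.enorm
    exact this.lintegral_prod_right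
  have hfin : ν (ball q (4 * ρ)) ≠ ⊤ := measure_ball_lt_top.ne
  have hNint : ∫⁻ ω, N ω ∂μ ≠ ⊤ := by
    have h1 : ∫⁻ ω, N ω ∂μ = ∫⁻ x in ball q (4 * ρ), ∫⁻ ω, ‖F ω x‖ₑ ∂μ ∂ν :=
      lintegral_lintegral_swap hF.enorm.aemeasurable
    have h2 : ∫⁻ x in ball q (4 * ρ), ∫⁻ ω, ‖F ω x‖ₑ ∂μ ∂ν ≤ C * ν (ball q (4 * ρ)) := by
      rw [← setLIntegral_const]
      exact setLIntegral_mono' measurableSet_ball hb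
    rw [h1]
    exact ne_top_of_le_ne_top (ENNReal.mul_ne_top hC hfin) h2
  set A : ℝ≥0∞ := ν (ball (0 : Q) ρ) with hA
  have hA0 : A ≠ 0 := (measure_ball_pos ν _ hρ).ne'
  have hAt : A ≠ ⊤ := measure_ball_lt_top.ne
  -- balls of radius `ρ` about points of `ball q (3 * ρ)` stay inside `ball q (4 * ρ)`
  have hsub : ∀ ω, ∀ x ∈ ball q (3 * ρ), ‖F ω x‖ₑ ≤ N ω / A := by
    intro ω x hx
    have hss : ball x ρ ⊆ ball q (4 * ρ) := by
      intro y hy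
      rw [mem_ball] at *
      calc dist y q ≤ dist y x + dist x q := dist_triangle _ _ _
        _ < ρ + 3 * ρ := add_lt_add hy hx
        _ = 4 * ρ := by ring
    rw [ENNReal.le_div_iff_mul_le (Or.inl hA0) (Or.inl hAt), mul_comm]
    calc A * ‖F ω x‖ₑ ≤ ∫⁻ y in ball x ρ, ‖F ω y‖ₑ ∂ν :=
          measure_ball_mul_enorm_le ν (hF.of_uncurry_left) ((hd ω).mono hss)
      _ ≤ N ω := lintegral_mono_set hss
  -- the summand `1` serves the integrand, the summand `2 / ρ` its derivative, by Cauchy's estimate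
  refine ⟨fun ω => (1 + 2 / ρ) * (N ω / A).toReal, ?_, ?_⟩
  · refine (integrable_toReal_of_lintegral_ne_top ?_ ?_).const_mul _
    · exact (hNm.div_const A).aemeasurable
    · simp_rw [div_eq_mul_inv]
      rw [lintegral_mul_const _ hNm]
      exact ENNReal.mul_ne_top hNint (ENNReal.inv_ne_top.2 hA0)
  · filter_upwards [ae_lt_top hNm hNint] with ω hω x hx
    have hlt : N ω / A ≠ ⊤ := ENNReal.div_ne_top hω.ne hA0
    have hle : ∀ y ∈ ball q (3 * ρ), ‖F ω y‖ ≤ (N ω / A).toReal := by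
      intro y hy
      rw [← toReal_enorm]
      exact ENNReal.toReal_mono hlt (hsub ω y hy)
    have hnn : 0 ≤ (N ω / A).toReal := ENNReal.toReal_nonneg
    have hx3 : x ∈ ball q (3 * ρ) := ball_subset_ball (by linarith) hx
    have hss : ball x ρ ⊆ ball q (3 * ρ) := by
      intro y hy
      rw [mem_ball] at *
      calc dist y q ≤ dist y x + dist x q := dist_triangle _ _ _
        _ < ρ + ρ := add_lt_add hy hx
        _ ≤ 3 * ρ := by linarith
    have hcau : ‖fderiv ℂ (F ω) x‖ ≤ (2 * (N ω / A).toReal) / ρ := by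
      refine Complex.norm_fderiv_le_div_of_mapsTo_ball
        ((hd ω).mono (hss.trans (ball_subset_ball (by linarith)))) ?_ hρ
      intro y hy
      rw [mem_closedBall, dist_eq_norm]
      calc ‖F ω y - F ω x‖ ≤ ‖F ω y‖ + ‖F ω x‖ := norm_sub_le _ _
        _ ≤ (N ω / A).toReal + (N ω / A).toReal := add_le_add (hle y (hss hy)) (hle x hx3)
        _ = 2 * (N ω / A).toReal := by ring
    have h2 : 0 ≤ 2 / ρ := by positivity
    constructor
    · nlinarith [hle x hx3, mul_nonneg h2 hnn]
    · have : (2 * (N ω / A).toReal) / ρ = 2 / ρ * (N ω / A).toReal := by ring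
      nlinarith [hcau, mul_nonneg h2 hnn]

/-- Holomorphic dependence on parameters: the integral of a family of holomorphic functions whose
`L¹` norms are locally bounded is continuously differentiable, and may be differentiated under the
integral sign. -/
theorem holomorphic_integral {Ω : Type*} [MeasurableSpace Ω] {μ : Measure Ω} [SFinite μ]
    {V : Set Q} (hV : IsOpen V) {F : Ω → Q → ℂ} (hF : Measurable (Function.uncurry F))
    (hd : ∀ ω, AnalyticOnNhd ℂ (F ω) V)
    (hb : ∀ q ∈ V, ∃ C : ℝ≥0∞, C ≠ ⊤ ∧ ∀ᶠ q' in 𝓝 q, ∫⁻ ω, ‖F ω q'‖ₑ ∂μ ≤ C) :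
    ContDiffOn ℂ 1 (fun q => ∫ ω, F ω q ∂μ) V ∧ ∀ q ∈ V, ∀ v,
      Integrable (fun ω => fderiv ℂ (F ω) q v) μ ∧
      fderiv ℂ (fun q => ∫ ω, F ω q ∂μ) q v = ∫ ω, fderiv ℂ (F ω) q v ∂μ := by
  have hslice : ∀ q, Measurable fun ω => F ω q := fun q => hF.of_uncurry_right
  have hdiff : ∀ ω, ∀ q ∈ V, DifferentiableAt ℂ (F ω) q := fun ω q hq =>
    (hd ω q hq).differentiableAt
  -- on a small ball, the integrand and its derivative are dominated
  have hloc : ∀ q ∈ V, ∃ ρ > 0, ball q ρ ⊆ V ∧ ∃ bound : Ω → ℝ, Integrable bound μ ∧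
      ∀ᵐ ω ∂μ, ∀ x ∈ ball q ρ, ‖F ω x‖ ≤ bound ω ∧ ‖fderiv ℂ (F ω) x‖ ≤ bound ω := by
    intro q hq
    obtain ⟨C, hC, hev⟩ := hb q hq
    obtain ⟨ε, hε, hball⟩ := Metric.eventually_nhds_iff_ball.1 (hev.and (hV.mem_nhds hq))
    have h4 : 4 * (ε / 4) = ε := by ring
    refine ⟨ε / 4, by positivity, fun x hx => (hball x ?_).2, ?_⟩
    · exact ball_subset_ball (by linarith) hx
    · refine exists_integrable_bound hF (by positivity) (fun ω x hx => ?_) hC (fun x hx => ?_)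
      · rw [h4] at hx
        exact (hdiff ω x (hball x hx).2).differentiableWithinAt
      · rw [h4] at hx
        exact (hball x hx).1
  have hmain : ∀ q ∈ V, HasFDerivAt (fun q => ∫ ω, F ω q ∂μ) (∫ ω, fderiv ℂ (F ω) q ∂μ) q ∧
      Integrable (fun ω => fderiv ℂ (F ω) q) μ ∧
      ContinuousAt (fun q => ∫ ω, fderiv ℂ (F ω) q ∂μ) q := by
    intro q hq
    obtain ⟨ρ, hρ, hss, bound, hbi, hbd⟩ := hloc q hq
    have hmem : ball q ρ ∈ 𝓝 q := ball_mem_nhds q hρ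
    have hqρ : q ∈ ball q ρ := mem_ball_self hρ
    have hm' : ∀ x ∈ ball q ρ, AEStronglyMeasurable (fun ω => fderiv ℂ (F ω) x) μ := fun x hx =>
      (stronglyMeasurable_fderiv_param hslice
        (fun ω => hdiff ω x (hss hx))).aestronglyMeasurable
    refine ⟨?_, ?_, ?_⟩
    · refine hasFDerivAt_integral_of_dominated_of_fderiv_le (𝕜 := ℂ) (F := fun q ω => F ω q)
        (F' := fun q ω => fderiv ℂ (F ω) q) (bound := bound) hmem
        (Eventually.of_forall fun x => (hslice x).aestronglyMeasurable) ?_ (hm' q hqρ)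
        (hbd.mono fun ω h x hx => (h x hx).2) hbi
        (Eventually.of_forall fun ω x hx => (hdiff ω x (hss hx)).hasFDerivAt)
      exact hbi.mono' (hslice q).aestronglyMeasurable (hbd.mono fun ω h => (h q hqρ).1)
    · exact hbi.mono' (hm' q hqρ) (hbd.mono fun ω h => (h q hqρ).2)
    · refine (continuousOn_of_dominated (s := ball q ρ) hm'
        (fun x hx => hbd.mono fun ω h => (h x hx).2) hbi
        (Eventually.of_forall fun ω x hx => ?_)).continuousAt hmem
      exact ((hd ω).fderiv x (hss hx)).continuousAt.continuousWithinAt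
  constructor
  · rw [show (1 : WithTop ℕ∞) = 0 + 1 from rfl, contDiffOn_succ_iff_fderiv_of_isOpen hV]
    refine ⟨fun q hq => (hmain q hq).1.differentiableAt.differentiableWithinAt, by simp, ?_⟩
    rw [contDiffOn_zero]
    refine ContinuousOn.congr (f := fun q => ∫ ω, fderiv ℂ (F ω) q ∂μ)
      (fun q hq => (hmain q hq).2.2.continuousWithinAt) (fun q hq => (hmain q hq).1.fderiv)
  · intro q hq v
    obtain ⟨h1, h2, -⟩ := hmain q hq
    refine ⟨h2.apply_continuousLinearMap v, ?_⟩
    rw [h1.fderiv, ContinuousLinearMap.integral_apply h2]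

end HolomorphicParameter

/-! ### Total derivatives along a ray -/

/-- The integral over `(0, ∞)` of a total derivative `h'` vanishes as soon as `h'` and `h r / r` are
integrable: the boundary values of `h` exist, and a nonzero one would make `h r / r` diverge. -/
theorem integral_Ioi_deriv_eq_zero {h h' : ℝ → ℂ} (hd : ∀ r, 0 < r → HasDerivAt h (h' r) r)
    (hi : IntegrableOn h' (Set.Ioi 0)) (hi₀ : IntegrableOn (fun r => r⁻¹ • h r) (Set.Ioi 0)) :
    ∫ r in Set.Ioi (0 : ℝ), h' r = 0 := by
  -- the substitution `r = e^u` turns both assumptions into integrability on the real line, of the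
  -- function `h (e^u)` and of its derivative
  have himg : Real.exp '' Set.univ = Set.Ioi 0 := by rw [Set.image_univ, Real.range_exp]
  have hder : ∀ x ∈ Set.univ, HasDerivWithinAt Real.exp (Real.exp x) Set.univ x :=
    fun x _ => (Real.hasDerivAt_exp x).hasDerivWithinAt
  have hinj : Set.InjOn Real.exp Set.univ := Real.exp_injective.injOn
  have h1 := (integrableOn_image_iff_integrableOn_abs_deriv_smul MeasurableSet.univ hder hinj
    h').1 (by rwa [himg])
  have h2 := (integrableOn_image_iff_integrableOn_abs_deriv_smul MeasurableSet.univ hder hinj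
    (fun r => r⁻¹ • h r)).1 (by rwa [himg])
  rw [← himg, integral_image_eq_integral_abs_deriv_smul MeasurableSet.univ hder hinj]
  rw [integrableOn_univ] at h1 h2
  rw [setIntegral_univ]
  simp only [Real.abs_exp] at h1 h2 ⊢
  refine integral_eq_zero_of_hasDerivAt_of_integrable (f := fun u => h (Real.exp u))
    (fun u => ?_) h1 ?_
  · exact (hd _ (Real.exp_pos u)).scomp u (Real.hasDerivAt_exp u)
  · refine h2.congr (Eventually.of_forall fun u => ?_)
    simp only
    rw [smul_smul, mul_inv_cancel₀ (Real.exp_pos u).ne', one_smul]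

/-! ### The dilogarithm -/

theorem one_sub_mul_mem_slitPlane {x : ℂ} (hx : 1 - x ∈ Complex.slitPlane) {s : ℝ}
    (hs : s ∈ Set.Icc (0 : ℝ) 1) : 1 - s * x ∈ Complex.slitPlane := by
  have h : 1 - (s : ℂ) * x = (1 - s : ℝ) • (1 : ℂ) + s • (1 - x) := by
    simp only [Complex.real_smul]
    push_cast
    ring
  rw [h]
  exact Complex.starConvex_one_slitPlane hx (by linarith [hs.2]) hs.1 (by ring)

theorem hasDerivAt_dilog {x : ℂ} (hx : 1 - x ∈ Complex.slitPlane) (hx0 : x ≠ 0) :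
    HasDerivAt dilog (-Complex.log (1 - x) / x) x := by
  have hopen : IsOpen {y : ℂ | 1 - y ∈ Complex.slitPlane} :=
    Complex.isOpen_slitPlane.preimage (by fun_prop)
  obtain ⟨δ, hδ, hball⟩ := Metric.nhds_basis_closedBall.mem_iff.1 (hopen.mem_nhds hx)
  -- compactness bounds the derivative `-(1 - s y)⁻¹` of the integrand, uniformly in `y` and `s`
  have hcomp : IsCompact (closedBall x δ ×ˢ Set.Icc (0 : ℝ) 1) :=
    (isCompact_closedBall x δ).prod isCompact_Icc
  have hcont : ContinuousOn (fun w : ℂ × ℝ => (1 - w.2 * w.1)⁻¹)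
      (closedBall x δ ×ˢ Set.Icc (0 : ℝ) 1) := by
    refine ContinuousOn.inv₀ (by fun_prop) fun w hw => ?_
    exact Complex.slitPlane_ne_zero (one_sub_mul_mem_slitPlane (hball hw.1) hw.2)
  obtain ⟨c, hc⟩ := hcomp.exists_bound_of_continuousOn hcont
  have hxb : x ∈ closedBall x δ := mem_closedBall_self hδ.le
  have hderiv_s : ∀ s ∈ Set.Icc (0 : ℝ) 1,
      HasDerivAt (fun s : ℝ => Complex.log (1 - s * x)) (-x * (1 - s * x)⁻¹) s := by
    intro s hs
    have h1 : HasDerivAt (fun s : ℝ => 1 - (s : ℂ) * x) (-x) s := by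
      have := ((Complex.ofRealCLM.hasDerivAt (x := s)).mul_const x).const_sub 1
      simpa using this
    have := h1.clog_real (one_sub_mul_mem_slitPlane hx hs)
    simpa [div_eq_mul_inv] using this
  have hlog : ∀ s ∈ Set.Icc (0 : ℝ) 1, ‖Complex.log (1 - s * x)‖ ≤ (‖x‖ * c) * s := by
    intro s hs
    have := (convex_Icc (0 : ℝ) 1).norm_image_sub_le_of_norm_hasDerivWithin_le
      (f := fun s : ℝ => Complex.log (1 - s * x)) (C := ‖x‖ * c)
      (fun u hu => (hderiv_s u hu).hasDerivWithinAt) (fun u hu => ?_)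
      (Set.left_mem_Icc.2 zero_le_one) hs
    · simpa [abs_of_nonneg hs.1] using this
    · rw [norm_mul, norm_neg]
      exact mul_le_mul_of_nonneg_left (hc (x, u) ⟨hxb, hu⟩) (norm_nonneg _)
  have hu : Set.uIoc (0 : ℝ) 1 = Set.Ioc 0 1 := Set.uIoc_of_le zero_le_one
  have hcontF : ∀ y ∈ closedBall x δ,
      ContinuousOn (fun s : ℝ => Complex.log (1 - s * y) / s) (Set.Ioc 0 1) := by
    intro y hy
    refine ContinuousOn.div (ContinuousOn.clog (by fun_prop) fun s hs => ?_) (by fun_prop)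
      fun s hs => by exact_mod_cast hs.1.ne'
    exact one_sub_mul_mem_slitPlane (hball hy) (Set.Ioc_subset_Icc_self hs)
  have hcontF' : ContinuousOn (fun s : ℝ => -(1 - s * x)⁻¹) (Set.Icc 0 1) := by
    refine (ContinuousOn.inv₀ (by fun_prop) fun s hs => ?_).neg
    exact Complex.slitPlane_ne_zero (one_sub_mul_mem_slitPlane hx hs)
  have key := (intervalIntegral.hasDerivAt_integral_of_dominated_loc_of_deriv_le
    (𝕜 := ℂ) (μ := volume) (a := 0) (b := 1) (s := closedBall x δ) (x₀ := x)
    (F := fun y (s : ℝ) => Complex.log (1 - s * y) / s)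
    (F' := fun y (s : ℝ) => -(1 - s * y)⁻¹) (bound := fun _ => c)
    (closedBall_mem_nhds x hδ) ?_ ?_ ?_ ?_ ?_ ?_).2
  · have hval : ∫ s in (0 : ℝ)..1, -(1 - (s : ℂ) * x)⁻¹ = Complex.log (1 - x) / x := by
      rw [intervalIntegral.integral_eq_sub_of_hasDerivAt
        (f := fun s : ℝ => Complex.log (1 - s * x) / x)]
      · simp
      · intro s hs
        rw [Set.uIcc_of_le zero_le_one] at hs
        have := (hderiv_s s hs).div_const x
        rwa [neg_mul, neg_div, mul_div_cancel_left₀ _ hx0] at this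
      · refine ContinuousOn.intervalIntegrable ?_
        rwa [Set.uIcc_of_le zero_le_one]
    rw [hval] at key
    have := key.neg
    rw [neg_div]
    exact this
  · filter_upwards [closedBall_mem_nhds x hδ] with y hy
    rw [hu]
    exact (hcontF y hy).aestronglyMeasurable measurableSet_Ioc
  · rw [intervalIntegrable_iff_integrableOn_Ioc_of_le zero_le_one]
    have := (hcontF x hxb).aestronglyMeasurable (μ := volume) measurableSet_Ioc
    refine Integrable.of_bound this (‖x‖ * c) ?_
    refine (ae_restrict_iff' measurableSet_Ioc).2 (Eventually.of_forall fun s hs => ?_)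
    rw [norm_div, Complex.norm_real, Real.norm_of_nonneg hs.1.le, div_le_iff₀ hs.1]
    exact hlog s (Set.Ioc_subset_Icc_self hs)
  · rw [hu]
    exact (hcontF'.mono Set.Ioc_subset_Icc_self).aestronglyMeasurable measurableSet_Ioc
  · refine Eventually.of_forall fun s hs y hy => ?_
    rw [hu] at hs
    rw [norm_neg]
    exact hc (y, s) ⟨hy, Set.Ioc_subset_Icc_self hs⟩
  · exact intervalIntegrable_const
  · refine Eventually.of_forall fun s hs y hy => ?_
    rw [hu] at hs
    have hs0 : (s : ℂ) ≠ 0 := by exact_mod_cast hs.1.ne'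
    have hmem := one_sub_mul_mem_slitPlane (hball hy) (Set.Ioc_subset_Icc_self hs)
    have h1 : HasDerivAt (fun y : ℂ => 1 - (s : ℂ) * y) (-s) y := by
      simpa using ((hasDerivAt_id y).const_mul (s : ℂ)).const_sub 1
    have := (h1.clog hmem).div_const (s : ℂ)
    rwa [neg_div, neg_div, div_div_cancel_left' hs0] at this

namespace Presentation

theorem isOpen_admissible (P : Presentation) : IsOpen {x | P.Admissible x} := by
  cases P
  · exact Complex.isOpen_slitPlane.preimage (by fun_prop)
  · exact isOpen_univ

theorem hasDerivAt_li₂ (P : Presentation) {x : ℂ} (hx : P.Admissible x) (hx0 : x ≠ 0) :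
    HasDerivAt P.li₂ (P.li₁ x / x) x := by
  cases P
  · exact hasDerivAt_dilog hx hx0
  · rw [show rational.li₁ x / x = 1 from div_self hx0]
    exact hasDerivAt_id' x

theorem hasDerivAt_li₁ (P : Presentation) {x : ℂ} (hx : P.Admissible x) (hx0 : x ≠ 0) :
    HasDerivAt P.li₁ (P.li₀ x / x) x := by
  cases P
  · have h1 : HasDerivAt (fun y : ℂ => 1 - y) (-1) x := by
      simpa using (hasDerivAt_id x).const_sub 1
    have := (h1.clog hx).neg
    refine HasDerivAt.congr_deriv (f := integer.li₁) this ?_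
    have := Complex.slitPlane_ne_zero hx
    change -(-1 / (1 - x)) = x / (1 - x) / x
    field_simp
  · rw [show rational.li₀ x / x = 1 from div_self hx0]
    exact hasDerivAt_id' x

theorem analyticAt_of_hasDerivAt {f f' : ℂ → ℂ} (P : Presentation)
    (h : ∀ x, P.Admissible x → x ≠ 0 → HasDerivAt f (f' x) x) {x : ℂ} (hx : P.Admissible x)
    (hx0 : x ≠ 0) : AnalyticAt ℂ f x := by
  have hopen : IsOpen ({y | P.Admissible y} ∩ {0}ᶜ) :=
    P.isOpen_admissible.inter isOpen_compl_singleton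
  have hd : DifferentiableOn ℂ f ({y | P.Admissible y} ∩ {0}ᶜ) := fun y hy =>
    (h y hy.1 hy.2).differentiableAt.differentiableWithinAt
  exact hd.analyticAt (hopen.mem_nhds ⟨hx, hx0⟩)

theorem analyticAt_li₂ (P : Presentation) {x : ℂ} (hx : P.Admissible x) (hx0 : x ≠ 0) :
    AnalyticAt ℂ P.li₂ x :=
  P.analyticAt_of_hasDerivAt (fun _ => P.hasDerivAt_li₂) hx hx0

theorem analyticAt_li₁ (P : Presentation) {x : ℂ} (hx : P.Admissible x) (hx0 : x ≠ 0) :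
    AnalyticAt ℂ P.li₁ x :=
  P.analyticAt_of_hasDerivAt (fun _ => P.hasDerivAt_li₁) hx hx0

theorem analyticAt_li₀ (P : Presentation) {x : ℂ} (hx : P.Admissible x) :
    AnalyticAt ℂ P.li₀ x := by
  cases P
  · exact analyticAt_id.div (analyticAt_const.sub analyticAt_id) (Complex.slitPlane_ne_zero hx)
  · exact analyticAt_id

end Presentation

/-! ### Cauchy products of conditionally convergent series -/

theorem summable_mul_pow_of_tendsto {f : ℕ → ℂ} {l : ℂ}
    (h : Tendsto (fun N => ∑ n ∈ Finset.range N, f n) atTop (𝓝 l)) {x : ℝ} (hx0 : 0 ≤ x)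
    (hx1 : x < 1) : Summable fun n => ‖f n * (x : ℂ) ^ n‖ := by
  have h0 : Tendsto f atTop (𝓝 0) := by
    have := (h.comp (tendsto_add_atTop_nat 1)).sub h
    simpa [Finset.sum_range_succ, Function.comp_def] using this
  obtain ⟨C, hC⟩ := h0.norm.bddAbove_range
  refine Summable.of_nonneg_of_le (fun _ => norm_nonneg _) (fun n => ?_)
    ((summable_geometric_of_lt_one hx0 hx1).mul_left C)
  rw [norm_mul, norm_pow, Complex.norm_real, Real.norm_of_nonneg hx0]
  gcongr
  exact hC ⟨n, rfl⟩

/-- Abel's theorem on Cauchy products, for a finite sum of products: if the series `∑ f i`, `∑ g i`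
and the sum over `i` of their Cauchy products all converge, conditionally perhaps, then their sums
are related as expected. -/
theorem sum_mul_eq_of_tendsto_cauchyProduct {ι : Type*} [Fintype ι] {f g : ι → ℕ → ℂ}
    {A D : ι → ℂ} {l : ℂ}
    (hf : ∀ i, Tendsto (fun N => ∑ n ∈ Finset.range N, f i n) atTop (𝓝 (A i)))
    (hg : ∀ i, Tendsto (fun N => ∑ n ∈ Finset.range N, g i n) atTop (𝓝 (D i)))
    (hfg : Tendsto (fun N => ∑ n ∈ Finset.range N,
      ∑ i, ∑ kl ∈ Finset.HasAntidiagonal.antidiagonal n, f i kl.1 * g i kl.2) atTop (𝓝 l)) :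
    ∑ i, A i * D i = l := by
  have hF := fun i => tendsto_map'_iff.1 (Complex.tendsto_tsum_powerSeries_nhdsWithin_lt (hf i))
  have hG := fun i => tendsto_map'_iff.1 (Complex.tendsto_tsum_powerSeries_nhdsWithin_lt (hg i))
  have hL := tendsto_map'_iff.1 (Complex.tendsto_tsum_powerSeries_nhdsWithin_lt hfg)
  have hprod := tendsto_finsetSum Finset.univ fun i _ => (hF i).mul (hG i)
  refine tendsto_nhds_unique (hprod.congr' ?_) hL
  filter_upwards [Ioo_mem_nhdsLT (zero_lt_one' ℝ)] with x hx
  simp only [Function.comp_def]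
  have hsf := fun i => summable_mul_pow_of_tendsto (hf i) hx.1.le hx.2
  have hsg := fun i => summable_mul_pow_of_tendsto (hg i) hx.1.le hx.2
  have h1 : ∀ i, (∑' n, f i n * (x : ℂ) ^ n) * (∑' n, g i n * (x : ℂ) ^ n) =
      ∑' n, (∑ kl ∈ Finset.HasAntidiagonal.antidiagonal n, f i kl.1 * g i kl.2) * (x : ℂ) ^ n := by
    intro i
    rw [tsum_mul_tsum_eq_tsum_sum_antidiagonal_of_summable_norm (hsf i) (hsg i)]
    refine tsum_congr fun n => ?_
    rw [Finset.sum_mul]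
    refine Finset.sum_congr rfl fun kl hkl => ?_
    rw [← Finset.HasAntidiagonal.mem_antidiagonal.1 hkl, pow_add]
    ring
  have h2 : ∀ i, Summable fun n =>
      (∑ kl ∈ Finset.HasAntidiagonal.antidiagonal n, f i kl.1 * g i kl.2) * (x : ℂ) ^ n := by
    intro i
    refine (summable_norm_sum_mul_antidiagonal_of_summable_norm (hsf i) (hsg i)).of_norm.congr
      fun n => ?_
    rw [Finset.sum_mul]
    refine Finset.sum_congr rfl fun kl hkl => ?_
    rw [← Finset.HasAntidiagonal.mem_antidiagonal.1 hkl, pow_add]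
    ring
  simp_rw [h1]
  rw [← Summable.tsum_finsetSum fun i _ => h2 i]
  exact tsum_congr fun n => by rw [Finset.sum_mul]

/-! ### Sum-integrals as integrals over a measure space -/

section SumIntegral

variable {m : ℕ}

/-- The measure `count ⊗ dr` on pairs `(γ, r)`, `r > 0`; the pair `(γ, r)` stands for the point
`t = r (i Z_γ)` of the BPS ray of `γ`. -/
def rayMeasure (m : ℕ) : Measure (Charge m × ℝ) :=
  Measure.count.prod (volume.restrict (Set.Ioi 0))

instance : SFinite (rayMeasure m) := by
  unfold rayMeasure
  infer_instance

/-- The point `r (i Z_γ)` of the BPS ray of `γ`. -/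
def rayPoint (z : Fin m → ℂ) (ω : Charge m × ℝ) : ℂ := ω.2 * (Complex.I * lin ω.1 z)

variable (B : BPSData m) (P : Presentation)

/-- The density of `c(γ) dt / t²` along the BPS rays with respect to `rayMeasure`; it is set to zero
for `r ≤ 0`. -/
def rayWeight (z : Fin m → ℂ) (ω : Charge m × ℝ) : ℂ :=
  if 0 < ω.2 then B.index P ω.1 * ((Complex.I * lin ω.1 z) / rayPoint z ω ^ 2) else 0

/-- The integrand of the sum-integral of `f` with respect to `rayMeasure`. -/
def pull (z : Fin m → ℂ) (f : Charge m → ℂ → ℂ) (ω : Charge m × ℝ) : ℂ :=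
  rayWeight B P z ω * f ω.1 (rayPoint z ω)

/-- Absolute convergence of the sum-integral of `f`. -/
def SumIntegrable (z : Fin m → ℂ) (f : Charge m → ℂ → ℂ) : Prop :=
  Integrable (pull B P z f) (rayMeasure m)

/-- Active charges have nonzero central charge. -/
def Nondegenerate (z : Fin m → ℂ) : Prop := ∀ γ, B.index P γ ≠ 0 → lin γ z ≠ 0

/-- Continuity along the BPS rays of active charges. -/
def RayContinuous (z : Fin m → ℂ) (f : Charge m → ℂ → ℂ) : Prop :=
  ∀ γ, B.index P γ ≠ 0 → ContinuousOn (f γ) (ray γ z)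

variable {B P} {z : Fin m → ℂ}

theorem rayPoint_mem {γ : Charge m} (hz : lin γ z ≠ 0) {r : ℝ} (hr : 0 < r) :
    rayPoint z (γ, r) ∈ ray γ z := by
  refine ⟨r⁻¹, inv_pos.2 hr, ?_⟩
  have hr' : (r : ℂ) ≠ 0 := by exact_mod_cast hr.ne'
  simp only [rayPoint]
  push_cast
  field_simp
  simp

theorem ne_zero_of_mem_ray {γ : Charge m} {t : ℂ} (ht : t ∈ ray γ z) :
    t ≠ 0 := by
  rintro rfl
  obtain ⟨s, hs, h⟩ := ht
  rw [div_zero, zero_eq_neg] at h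
  exact mul_ne_zero Complex.I_ne_zero (by exact_mod_cast hs.ne') h

theorem rayPoint_ne_zero {γ : Charge m} (hz : lin γ z ≠ 0) {r : ℝ} (hr : 0 < r) :
    rayPoint z (γ, r) ≠ 0 :=
  ne_zero_of_mem_ray (rayPoint_mem hz hr)

theorem pull_of_pos {f : Charge m → ℂ → ℂ} {γ : Charge m} {r : ℝ} (hr : 0 < r) :
    pull B P z f (γ, r) = B.index P γ *
      (f γ (r * (Complex.I * lin γ z)) / (r * (Complex.I * lin γ z)) ^ 2 *
        (Complex.I * lin γ z)) := by
  simp only [pull, rayWeight, rayPoint, hr, if_true]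
  ring

theorem pull_of_nonpos {f : Charge m → ℂ → ℂ} {γ : Charge m} {r : ℝ} (hr : ¬ 0 < r) :
    pull B P z f (γ, r) = 0 := by
  simp [pull, rayWeight, hr]

theorem pull_of_inactive {f : Charge m → ℂ → ℂ} {γ : Charge m} {r : ℝ} (h : B.index P γ = 0) :
    pull B P z f (γ, r) = 0 := by
  simp [pull, rayWeight, h]

theorem pull_congr {f g : Charge m → ℂ → ℂ} (hz : Nondegenerate B P z)
    (h : ∀ γ, B.index P γ ≠ 0 → ∀ t ∈ ray γ z, f γ t = g γ t) :
    pull B P z f = pull B P z g := by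
  funext ⟨γ, r⟩
  by_cases hγ : B.index P γ = 0
  · rw [pull_of_inactive hγ, pull_of_inactive hγ]
  by_cases hr : 0 < r
  · simp only [pull]
    rw [h γ hγ _ (rayPoint_mem (hz γ hγ) hr)]
  · rw [pull_of_nonpos hr, pull_of_nonpos hr]

theorem integral_rayMeasure {f : Charge m × ℝ → ℂ} (hf : Integrable f (rayMeasure m)) :
    ∫ ω, f ω ∂rayMeasure m = ∑' γ, ∫ r in Set.Ioi (0 : ℝ), f (γ, r) := by
  rw [rayMeasure, integral_prod f hf, integral_countable hf.integral_prod_left]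
  simp [Measure.real]

theorem Integrable.slice {f : Charge m × ℝ → ℂ} (hf : Integrable f (rayMeasure m))
    (γ : Charge m) : IntegrableOn (fun r => f (γ, r)) (Set.Ioi 0) :=
  Measure.ae_count_iff.1 (Integrable.prod_right_ae hf) γ

theorem lintegral_rayMeasure {f : Charge m × ℝ → ℝ≥0∞} (hf : Measurable f) :
    ∫⁻ ω, f ω ∂rayMeasure m = ∑' γ, ∫⁻ r in Set.Ioi (0 : ℝ), f (γ, r) := by
  rw [rayMeasure, lintegral_prod _ hf.aemeasurable, lintegral_count]

theorem sumInt_eq_integral {f : Charge m → ℂ → ℂ} (hf : SumIntegrable B P z f) :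
    sumInt B P z f = ∫ ω, pull B P z f ω ∂rayMeasure m := by
  rw [integral_rayMeasure hf, sumInt]
  refine tsum_congr fun γ => ?_
  rw [rayIntegral, ← integral_const_mul]
  exact setIntegral_congr_fun measurableSet_Ioi fun r hr => (pull_of_pos hr).symm

theorem absSumInt_eq_lintegral {F : Charge m → ℂ → ℝ≥0∞}
    (hF : Measurable fun ω => ‖rayWeight B P z ω‖ₑ * F ω.1 (rayPoint z ω)) :
    absSumInt B P z F =
      ∫⁻ ω, ‖rayWeight B P z ω‖ₑ * F ω.1 (rayPoint z ω) ∂rayMeasure m := by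
  rw [lintegral_rayMeasure hF, absSumInt]
  refine tsum_congr fun γ => ?_
  rw [absRayIntegral, ← lintegral_const_mul' _ _ enorm_ne_top]
  refine setLIntegral_congr_fun measurableSet_Ioi fun r hr => ?_
  simp only [rayWeight, rayPoint, Set.mem_Ioi.1 hr, if_true, div_eq_mul_inv, one_mul, enorm_mul]
  ring

theorem absSumInt_mono {F G : Charge m → ℂ → ℝ≥0∞} (hz : Nondegenerate B P z)
    (h : ∀ γ, B.index P γ ≠ 0 → ∀ t ∈ ray γ z, F γ t ≤ G γ t) :
    absSumInt B P z F ≤ absSumInt B P z G := by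
  refine ENNReal.tsum_le_tsum fun γ => ?_
  by_cases hγ : B.index P γ = 0
  · simp [hγ]
  refine mul_le_mul_right (setLIntegral_mono' measurableSet_Ioi fun r hr => ?_) _
  have := h γ hγ _ (rayPoint_mem (hz γ hγ) hr)
  simp only [rayPoint] at this
  dsimp only
  gcongr

theorem absSumInt_const_mul {F : Charge m → ℂ → ℝ≥0∞} {C : ℝ≥0∞} (hC : C ≠ ⊤) :
    absSumInt B P z (fun γ t => C * F γ t) = C * absSumInt B P z F := by
  simp only [absSumInt]
  rw [← ENNReal.tsum_mul_left]
  refine tsum_congr fun γ => ?_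
  rw [mul_left_comm, absRayIntegral, absRayIntegral, ← lintegral_const_mul' _ _ hC]
  congr 2
  funext r
  ring

/-! ### Measurability of the integrands -/

theorem measurable_of_continuousOn_of_eq_zero {Y : Type*} [TopologicalSpace Y] [MeasurableSpace Y]
    [OpensMeasurableSpace Y] {h : Y → ℂ} {S : Set Y} (hS : MeasurableSet S)
    (hc : ContinuousOn h S) (h0 : ∀ y, y ∉ S → h y = 0) : Measurable h := by
  classical
  have : h = S.piecewise h (fun _ => 0) := by
    funext y
    by_cases hy : y ∈ S
    · simp [hy]
    · simp [hy, h0 y hy]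
  rw [this]
  exact hc.measurable_piecewise continuousOn_const hS

theorem measurable_of_slices {Y : Type*} [MeasurableSpace Y] {f : (Charge m × ℝ) × Y → ℂ}
    (h : ∀ γ, Measurable fun x : ℝ × Y => f ((γ, x.1), x.2)) : Measurable f := by
  have h1 : Measurable fun x : Charge m × (ℝ × Y) => f ((x.1, x.2.1), x.2.2) :=
    measurable_from_prod_countable_right h
  exact h1.comp MeasurableEquiv.prodAssoc.measurable

theorem measurable_of_slices_right {f : ℝ × (Charge m × ℝ) → ℂ}
    (h : ∀ γ, Measurable fun x : ℝ × ℝ => f (x.1, (γ, x.2))) : Measurable f := by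
  have h1 : Measurable fun x : Charge m × (ℝ × ℝ) => f (x.2.1, (x.1, x.2.2)) :=
    measurable_from_prod_countable_right h
  have h2 : Measurable fun x : ℝ × (Charge m × ℝ) => (x.2.1, (x.1, x.2.2)) := by fun_prop
  exact h1.comp h2

theorem continuous_rayPoint (z : Fin m → ℂ) (γ : Charge m) :
    Continuous fun r : ℝ => rayPoint z (γ, r) := by
  unfold rayPoint
  fun_prop

theorem continuousOn_rayWeight {γ : Charge m} (hz : lin γ z ≠ 0) :
    ContinuousOn (fun r : ℝ => rayWeight B P z (γ, r)) (Set.Ioi 0) := by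
  refine ContinuousOn.congr (f := fun r : ℝ => B.index P γ *
    ((Complex.I * lin γ z) / rayPoint z (γ, r) ^ 2)) ?_ fun r hr => ?_
  · refine continuousOn_const.mul (continuousOn_const.div
      ((continuous_rayPoint z γ).continuousOn.pow 2) fun r hr => ?_)
    exact pow_ne_zero _ (rayPoint_ne_zero hz hr)
  · simp [rayWeight, Set.mem_Ioi.1 hr]

theorem measurable_pull {f : Charge m → ℂ → ℂ} (hz : Nondegenerate B P z)
    (hf : RayContinuous B P z f) : Measurable (pull B P z f) := by
  refine measurable_from_prod_countable_right fun γ => ?_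
  by_cases hγ : B.index P γ = 0
  · simp only [pull_of_inactive hγ]
    exact measurable_const
  refine measurable_of_continuousOn_of_eq_zero measurableSet_Ioi ?_ fun r hr => pull_of_nonpos hr
  exact (continuousOn_rayWeight (hz γ hγ)).mul ((hf γ hγ).comp
    (continuous_rayPoint z γ).continuousOn fun r hr => rayPoint_mem (hz γ hγ) hr)

/-- The integrand of a double sum-integral is measurable on the product of two copies of the space
of pairs `(γ, r)`. -/
theorem measurable_pull_pull {f : Charge m → ℂ → Charge m → ℂ → ℂ} (hz : Nondegenerate B P z)
    (hf : ∀ γ γ', B.index P γ ≠ 0 → B.index P γ' ≠ 0 →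
      ContinuousOn (fun x : ℂ × ℂ => f γ x.1 γ' x.2) (ray γ z ×ˢ ray γ' z)) :
    Measurable fun x : (Charge m × ℝ) × (Charge m × ℝ) =>
      pull B P z (fun γ t => pull B P z (f γ t) x.2) x.1 := by
  refine measurable_of_slices fun γ => measurable_of_slices_right fun γ' => ?_
  by_cases hγ : B.index P γ = 0
  · simp only [pull_of_inactive hγ]
    exact measurable_const
  by_cases hγ' : B.index P γ' = 0
  · simp only [pull, rayWeight, hγ', zero_mul, ite_self, mul_zero]
    exact measurable_const
  refine measurable_of_continuousOn_of_eq_zero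
    (measurableSet_Ioi.prod measurableSet_Ioi : MeasurableSet (Set.Ioi (0 : ℝ) ×ˢ Set.Ioi (0 : ℝ)))
    ?_ fun x hx => ?_
  · have h1 : ContinuousOn (fun x : ℝ × ℝ => rayWeight B P z (γ, x.1))
        (Set.Ioi (0 : ℝ) ×ˢ Set.Ioi (0 : ℝ)) :=
      (continuousOn_rayWeight (hz γ hγ)).comp continuous_fst.continuousOn fun x hx => hx.1
    have h2 : ContinuousOn (fun x : ℝ × ℝ => rayWeight B P z (γ', x.2))
        (Set.Ioi (0 : ℝ) ×ˢ Set.Ioi (0 : ℝ)) :=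
      (continuousOn_rayWeight (hz γ' hγ')).comp continuous_snd.continuousOn fun x hx => hx.2
    have h3 : ContinuousOn (fun x : ℝ × ℝ => f γ (rayPoint z (γ, x.1)) γ' (rayPoint z (γ', x.2)))
        (Set.Ioi (0 : ℝ) ×ˢ Set.Ioi (0 : ℝ)) := by
      refine (hf γ γ' hγ hγ').comp (f := fun x : ℝ × ℝ =>
        (rayPoint z (γ, x.1), rayPoint z (γ', x.2))) ?_ fun x hx =>
        ⟨rayPoint_mem (hz γ hγ) hx.1, rayPoint_mem (hz γ' hγ') hx.2⟩
      exact (((continuous_rayPoint z γ).comp continuous_fst).prodMk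
        ((continuous_rayPoint z γ').comp continuous_snd)).continuousOn
    exact h1.mul (h2.mul h3)
  · by_cases h1 : 0 < x.1
    · have h2 : ¬ 0 < x.2 := fun h2 => hx ⟨h1, h2⟩
      simp only [pull, rayWeight, h2, if_false, zero_mul, mul_zero]
    · exact pull_of_nonpos h1

/-! ### Absolute convergence and linearity of sum-integrals -/

theorem absSumInt_enorm_eq {f : Charge m → ℂ → ℂ} (hz : Nondegenerate B P z)
    (hf : RayContinuous B P z f) :
    absSumInt B P z (fun γ t => ‖f γ t‖ₑ) = ∫⁻ ω, ‖pull B P z f ω‖ₑ ∂rayMeasure m := by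
  have := (measurable_pull hz hf).enorm
  simp only [pull, enorm_mul] at this ⊢
  exact absSumInt_eq_lintegral this

theorem sumIntegrable_of_absSumInt {f : Charge m → ℂ → ℂ} (hz : Nondegenerate B P z)
    (hf : RayContinuous B P z f) (h : absSumInt B P z (fun γ t => ‖f γ t‖ₑ) ≠ ⊤) :
    SumIntegrable B P z f := by
  rw [absSumInt_enorm_eq hz hf] at h
  exact ⟨(measurable_pull hz hf).aestronglyMeasurable, lt_top_iff_ne_top.2 h⟩

theorem enorm_sumInt_le (f : Charge m → ℂ → ℂ) :
    ‖sumInt B P z f‖ₑ ≤ absSumInt B P z (fun γ t => ‖f γ t‖ₑ) := by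
  rw [sumInt, absSumInt]
  refine enorm_tsum_le_tsum_enorm.trans (ENNReal.tsum_le_tsum fun γ => ?_)
  rw [enorm_mul, rayIntegral, absRayIntegral]
  refine mul_le_mul_right ((enorm_integral_le_lintegral_enorm _).trans_eq ?_) _
  refine lintegral_congr fun r => ?_
  simp only [div_eq_mul_inv, one_mul, enorm_mul]

theorem SumIntegrable.congr {f g : Charge m → ℂ → ℂ} (hf : SumIntegrable B P z f)
    (hz : Nondegenerate B P z) (h : ∀ γ, B.index P γ ≠ 0 → ∀ t ∈ ray γ z, f γ t = g γ t) :
    SumIntegrable B P z g := by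
  rw [SumIntegrable, ← pull_congr hz h]
  exact hf

theorem SumIntegrable.congr_fun {f g : Charge m → ℂ → ℂ} (hf : SumIntegrable B P z f)
    (h : ∀ γ t, f γ t = g γ t) : SumIntegrable B P z g := by
  have : f = g := funext fun γ => funext fun t => h γ t
  rwa [← this]

theorem SumIntegrable.add {f g : Charge m → ℂ → ℂ} (hf : SumIntegrable B P z f)
    (hg : SumIntegrable B P z g) : SumIntegrable B P z fun γ t => f γ t + g γ t := by
  refine (Integrable.add hf hg).congr (Eventually.of_forall fun ω => ?_)
  simp only [pull, Pi.add_apply]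
  ring

theorem SumIntegrable.const_mul {f : Charge m → ℂ → ℂ} (c : ℂ) (hf : SumIntegrable B P z f) :
    SumIntegrable B P z fun γ t => c * f γ t := by
  refine (Integrable.const_mul hf c).congr (Eventually.of_forall fun ω => ?_)
  simp only [pull]
  ring

theorem SumIntegrable.neg {f : Charge m → ℂ → ℂ} (hf : SumIntegrable B P z f) :
    SumIntegrable B P z fun γ t => -f γ t := by
  simpa using hf.const_mul (-1)

theorem SumIntegrable.sub {f g : Charge m → ℂ → ℂ} (hf : SumIntegrable B P z f)
    (hg : SumIntegrable B P z g) : SumIntegrable B P z fun γ t => f γ t - g γ t := by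
  simpa [sub_eq_add_neg] using hf.add hg.neg

theorem SumIntegrable.finset_sum {ι : Type*} (s : Finset ι) {f : ι → Charge m → ℂ → ℂ}
    (hf : ∀ i ∈ s, SumIntegrable B P z (f i)) :
    SumIntegrable B P z fun γ t => ∑ i ∈ s, f i γ t := by
  refine (integrable_finsetSum s hf).congr (Eventually.of_forall fun ω => ?_)
  simp only [pull, Finset.mul_sum]

theorem SumIntegrable.mono {f g : Charge m → ℂ → ℂ} (hf : SumIntegrable B P z f)
    (hz : Nondegenerate B P z) (hg : RayContinuous B P z g) {C : ℝ}
    (h : ∀ γ, B.index P γ ≠ 0 → ∀ t ∈ ray γ z, ‖g γ t‖ ≤ C * ‖f γ t‖) :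
    SumIntegrable B P z g := by
  refine (hf.norm.const_mul C).mono' (measurable_pull hz hg).aestronglyMeasurable
    (Eventually.of_forall fun ⟨γ, r⟩ => ?_)
  by_cases hγ : B.index P γ = 0
  · simp [pull_of_inactive hγ]
  by_cases hr : 0 < r
  · simp only [pull, norm_mul]
    rw [mul_left_comm]
    exact mul_le_mul_of_nonneg_left (h γ hγ _ (rayPoint_mem (hz γ hγ) hr)) (norm_nonneg _)
  · simp [pull_of_nonpos hr]

theorem sumInt_congr {f g : Charge m → ℂ → ℂ} (hz : Nondegenerate B P z)
    (h : ∀ γ, B.index P γ ≠ 0 → ∀ t ∈ ray γ z, f γ t = g γ t) :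
    sumInt B P z f = sumInt B P z g := by
  refine tsum_congr fun γ => ?_
  by_cases hγ : B.index P γ = 0
  · simp [hγ]
  congr 1
  refine setIntegral_congr_fun measurableSet_Ioi fun r hr => ?_
  have := h γ hγ _ (rayPoint_mem (hz γ hγ) hr)
  simp only [rayPoint] at this
  simp only [this]

theorem sumInt_const_mul (c : ℂ) (f : Charge m → ℂ → ℂ) :
    sumInt B P z (fun γ t => c * f γ t) = c * sumInt B P z f := by
  simp only [sumInt]
  rw [← tsum_mul_left]
  refine tsum_congr fun γ => ?_
  rw [mul_left_comm, rayIntegral, rayIntegral, ← integral_const_mul c]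
  congr 2
  funext r
  ring

theorem sumInt_neg (f : Charge m → ℂ → ℂ) :
    sumInt B P z (fun γ t => -f γ t) = -sumInt B P z f := by
  simpa using sumInt_const_mul (-1) f

theorem sumInt_add {f g : Charge m → ℂ → ℂ} (hf : SumIntegrable B P z f)
    (hg : SumIntegrable B P z g) :
    sumInt B P z (fun γ t => f γ t + g γ t) = sumInt B P z f + sumInt B P z g := by
  rw [sumInt_eq_integral hf, sumInt_eq_integral hg, sumInt_eq_integral (hf.add hg),
    ← integral_add hf hg]
  refine integral_congr_ae (Eventually.of_forall fun ω => ?_)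
  simp only [pull]
  ring

theorem sumInt_sub {f g : Charge m → ℂ → ℂ} (hf : SumIntegrable B P z f)
    (hg : SumIntegrable B P z g) :
    sumInt B P z (fun γ t => f γ t - g γ t) = sumInt B P z f - sumInt B P z g := by
  simp only [sub_eq_add_neg]
  rw [sumInt_add hf hg.neg, sumInt_neg]

theorem sumInt_finset_sum {ι : Type*} (s : Finset ι) {f : ι → Charge m → ℂ → ℂ}
    (hf : ∀ i ∈ s, SumIntegrable B P z (f i)) :
    sumInt B P z (fun γ t => ∑ i ∈ s, f i γ t) = ∑ i ∈ s, sumInt B P z (f i) := by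
  rw [Finset.sum_congr rfl fun i hi => sumInt_eq_integral (hf i hi),
    sumInt_eq_integral (SumIntegrable.finset_sum s hf), ← integral_finsetSum s hf]
  refine integral_congr_ae (Eventually.of_forall fun ω => ?_)
  simp only [pull, Finset.mul_sum]

end SumIntegral

/-! ### Differentiation of sum-integrals -/

/-- The linear form `v ↦ lin γ v` as a continuous linear map. -/
def linCLM {m : ℕ} (γ : Charge m) : (Fin m → ℂ) →L[ℂ] ℂ :=
  ∑ a, (γ a : ℂ) • ContinuousLinearMap.proj a

theorem linCLM_apply {m : ℕ} (γ : Charge m) (v : Fin m → ℂ) : linCLM γ v = lin γ v := by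
  simp [linCLM, lin]

section Param

variable {m : ℕ} {B : BPSData m} {P : Presentation}
  {Q : Type*} [NormedAddCommGroup Q] [NormedSpace ℂ Q]

theorem AnalyticAt.fderiv_slice {G : ℂ × Q → ℂ} {t : ℂ} {q : Q}
    (hG : AnalyticAt ℂ G (t, q)) (v : Q) :
    fderiv ℂ (fun q' => G (t, q')) q v = fderiv ℂ G (t, q) (0, v) := by
  have h1 : HasFDerivAt (fun q' : Q => (t, q')) (ContinuousLinearMap.inr ℂ ℂ Q) q :=
    (hasFDerivAt_const t q).prodMk (hasFDerivAt_id q)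
  have h2 : HasFDerivAt (fun q' => G (t, q')) _ q :=
    hG.differentiableAt.hasFDerivAt.comp q h1
  rw [h2.fderiv]
  simp

/-- The integrand `c dt/dr / t² · G(t, q)` at `t = r τ(q)`, differentiated in the direction `v` of
the parameter `q`: the first summand is the derivative at fixed `t`, the second one the effect of
the rotation of the ray, which by `hasDerivAt_radial` is a total derivative in `r`. -/
theorem fderiv_comp_ray {G : ℂ × Q → ℂ} {τ : Q →L[ℂ] ℂ} {q v : Q} {c r : ℂ} (hr : r ≠ 0)
    (hτ : τ q ≠ 0) (hG : AnalyticAt ℂ G (r * τ q, q)) :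
    fderiv ℂ (fun q' => c * (τ q' / (r * τ q') ^ 2) * G (r * τ q', q')) q v =
      c * (τ q / (r * τ q) ^ 2) * fderiv ℂ G (r * τ q, q) (0, v) +
      τ v / τ q * (-(c / (r ^ 2 * τ q)) * G (r * τ q, q) +
        c / (r * τ q) * (τ q * fderiv ℂ G (r * τ q, q) (1, 0))) := by
  set G' := fderiv ℂ G (r * τ q, q) with hG'
  have hGd : HasFDerivAt G G' (r * τ q, q) := hG.differentiableAt.hasFDerivAt
  have hlin : HasFDerivAt (fun q' => (r * τ q', q'))
      ((r • τ).prod (ContinuousLinearMap.id ℂ Q)) q :=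
    ((r • τ).hasFDerivAt).prodMk (hasFDerivAt_id q)
  have h1 : HasFDerivAt (fun q' => G (r * τ q', q')) _ q :=
    HasFDerivAt.comp (g := G) q hGd hlin
  have h2 : HasDerivAt (fun x : ℂ => c * (x / (r * x) ^ 2)) (-(c / (r ^ 2 * τ q ^ 2))) (τ q) := by
    have h3 : HasDerivAt (fun x : ℂ => c / r ^ 2 * x⁻¹) (c / r ^ 2 * (-(τ q ^ 2)⁻¹)) (τ q) :=
      (hasDerivAt_inv hτ).const_mul _
    refine (h3.congr_deriv ?_).congr_of_eventuallyEq ?_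
    · field_simp
    · filter_upwards [isOpen_ne.mem_nhds hτ] with x hx
      have : x ≠ 0 := hx
      field_simp
  have h4 : HasFDerivAt ((fun x : ℂ => c * (x / (r * x) ^ 2)) ∘ τ) _ q :=
    HasDerivAt.comp_hasFDerivAt q h2 τ.hasFDerivAt
  have h6 : HasFDerivAt (fun q' => c * (τ q' / (r * τ q') ^ 2) * G (r * τ q', q')) _ q :=
    h4.mul h1
  rw [h6.fderiv]
  have h5 : G' (r * τ v, v) = r * τ v * G' (1, 0) + G' (0, v) := by
    have : (r * τ v, v) = (r * τ v) • ((1 : ℂ), (0 : Q)) + ((0 : ℂ), v) := by simp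
    rw [this, map_add, map_smul, smul_eq_mul]
  simp [h5]
  field_simp
  ring

theorem hasDerivAt_radial {G : ℂ × Q → ℂ} {q : Q} {c τ : ℂ} {r : ℝ} (hr : r ≠ 0)
    (hτ : τ ≠ 0) (hG : AnalyticAt ℂ G (r * τ, q)) :
    HasDerivAt (fun r : ℝ => c / (r * τ) * G (r * τ, q))
      (-(c / (r ^ 2 * τ)) * G (r * τ, q) + c / (r * τ) * (τ * fderiv ℂ G (r * τ, q) (1, 0))) r := by
  have hr' : (r : ℂ) ≠ 0 := by exact_mod_cast hr
  have hlin : HasDerivAt (fun x : ℂ => (x * τ, q)) (τ, 0) (r : ℂ) :=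
    (by simpa using (hasDerivAt_id (r : ℂ)).mul_const τ : HasDerivAt (fun x : ℂ => x * τ) τ
      (r : ℂ)).prodMk (hasDerivAt_const _ q)
  have h1 : HasDerivAt (fun x : ℂ => G (x * τ, q)) (fderiv ℂ G (r * τ, q) (τ, 0)) (r : ℂ) :=
    HasFDerivAt.comp_hasDerivAt (r : ℂ) hG.differentiableAt.hasFDerivAt hlin
  have h2 : HasDerivAt (fun x : ℂ => c / (x * τ)) (-(c / (r ^ 2 * τ))) (r : ℂ) := by
    have h3 : HasDerivAt (fun x : ℂ => c / τ * x⁻¹) (c / τ * (-((r : ℂ) ^ 2)⁻¹)) (r : ℂ) :=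
      (hasDerivAt_inv hr').const_mul _
    refine (h3.congr_deriv ?_).congr_of_eventuallyEq ?_
    · field_simp
    · filter_upwards [isOpen_ne.mem_nhds hr'] with x hx
      have : x ≠ 0 := hx
      field_simp
  have h5 : fderiv ℂ G (r * τ, q) (τ, 0) = τ * fderiv ℂ G (r * τ, q) (1, 0) := by
    have : (τ, (0 : Q)) = τ • ((1 : ℂ), (0 : Q)) := by simp
    rw [this, map_smul, smul_eq_mul]
  have := (h2.mul h1).comp_ofReal
  rw [h5] at this
  exact this

variable {V : Set Q} {ζ : Q →L[ℂ] (Fin m → ℂ)} {g : Charge m → ℂ → Q → ℂ}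

theorem analyticAt_rayWeight {γ : Charge m} {r : ℝ} (hr : 0 < r) {q : Q}
    (hz : lin γ (ζ q) ≠ 0) :
    AnalyticAt ℂ (fun q' => rayWeight B P (ζ q') (γ, r)) q := by
  have hτ : AnalyticAt ℂ (fun q' => lin γ (ζ q')) q := by
    have := ((linCLM γ).comp ζ).analyticAt q
    exact this.congr (Eventually.of_forall fun q' => linCLM_apply γ _)
  have hp : AnalyticAt ℂ (fun q' => rayPoint (ζ q') (γ, r)) q :=
    analyticAt_const.mul (analyticAt_const.mul hτ)
  have : AnalyticAt ℂ (fun q' => B.index P γ *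
      (Complex.I * lin γ (ζ q') / rayPoint (ζ q') (γ, r) ^ 2)) q :=
    analyticAt_const.mul ((analyticAt_const.mul hτ).div (hp.pow 2)
      (pow_ne_zero _ (rayPoint_ne_zero hz hr)))
  simpa [rayWeight, hr] using this

theorem analyticAt_pull {q : Q} (hz : Nondegenerate B P (ζ q))
    (hg : ∀ γ, B.index P γ ≠ 0 → ∀ t ∈ ray γ (ζ q),
      AnalyticAt ℂ (fun x : ℂ × Q => g γ x.1 x.2) (t, q)) (ω : Charge m × ℝ) :
    AnalyticAt ℂ (fun q' => pull B P (ζ q') (fun γ t => g γ t q') ω) q := by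
  obtain ⟨γ, r⟩ := ω
  by_cases hγ : B.index P γ = 0
  · simp only [pull_of_inactive hγ]
    exact analyticAt_const
  by_cases hr : 0 < r
  · have hp : AnalyticAt ℂ (fun q' => (rayPoint (ζ q') (γ, r), q')) q := by
      refine AnalyticAt.prod ?_ analyticAt_id
      have := (((r : ℂ) * Complex.I) • ((linCLM γ).comp ζ)).analyticAt q
      refine this.congr (Eventually.of_forall fun q' => ?_)
      simp [linCLM_apply, rayPoint, mul_assoc]
    exact (analyticAt_rayWeight hr (hz γ hγ)).mul
      ((hg γ hγ _ (rayPoint_mem (hz γ hγ) hr)).comp_of_eq hp rfl)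
  · simp only [pull_of_nonpos hr]
    exact analyticAt_const

theorem rayContinuous_of_analyticAt {q : Q}
    (hg : ∀ γ, B.index P γ ≠ 0 → ∀ t ∈ ray γ (ζ q),
      AnalyticAt ℂ (fun x : ℂ × Q => g γ x.1 x.2) (t, q)) :
    RayContinuous B P (ζ q) (fun γ t => g γ t q) := fun γ hγ t ht => by
  refine ContinuousAt.continuousWithinAt ?_
  exact ContinuousAt.comp (g := fun x : ℂ × Q => g γ x.1 x.2) (f := fun t => (t, q))
    (hg γ hγ t ht).continuousAt (by fun_prop)

variable [FiniteDimensional ℂ Q]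

/-- The integrand of a parametrized sum-integral is jointly measurable in the point of the rays and
the parameter. It is extended by zero off `V`, where it is not controlled. -/
theorem measurable_pull_param [MeasurableSpace Q] [BorelSpace Q] (hV : IsOpen V)
    (hz : ∀ q ∈ V, Nondegenerate B P (ζ q))
    (hg : ∀ q ∈ V, ∀ γ, B.index P γ ≠ 0 → ∀ t ∈ ray γ (ζ q),
      AnalyticAt ℂ (fun x : ℂ × Q => g γ x.1 x.2) (t, q)) :
    Measurable (Function.uncurry fun (ω : Charge m × ℝ) (q : Q) =>
      V.indicator (fun q => pull B P (ζ q) (fun γ t => g γ t q) ω) q) := by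
  have : FiniteDimensional ℝ Q := FiniteDimensional.complexToReal Q
  have : ProperSpace Q := FiniteDimensional.proper ℂ Q
  refine measurable_of_slices fun γ => ?_
  by_cases hγ : B.index P γ = 0
  · simp only [Function.uncurry, pull_of_inactive hγ, Set.indicator_zero]
    exact measurable_const
  refine measurable_of_continuousOn_of_eq_zero
    (measurableSet_Ioi.prod hV.measurableSet : MeasurableSet (Set.Ioi (0 : ℝ) ×ˢ V)) ?_ ?_
  · have hlin : Continuous fun x : ℝ × Q => lin γ (ζ x.2) := by
      have : Continuous fun x : ℝ × Q => linCLM γ (ζ x.2) := by fun_prop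
      simpa [linCLM_apply] using this
    have hp : Continuous fun x : ℝ × Q => rayPoint (ζ x.2) (γ, x.1) :=
      (Complex.continuous_ofReal.comp continuous_fst).mul (continuous_const.mul hlin)
    have h1 : ContinuousOn (fun x : ℝ × Q => B.index P γ *
        ((Complex.I * lin γ (ζ x.2)) / rayPoint (ζ x.2) (γ, x.1) ^ 2) *
        g γ (rayPoint (ζ x.2) (γ, x.1)) x.2) (Set.Ioi (0 : ℝ) ×ˢ V) := by
      refine ContinuousOn.mul (continuousOn_const.mul (ContinuousOn.div
        (continuous_const.mul hlin).continuousOn (hp.continuousOn.pow 2) fun x hx => ?_)) ?_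
      · exact pow_ne_zero _ (rayPoint_ne_zero (hz _ hx.2 γ hγ) hx.1)
      · intro x hx
        refine ContinuousAt.continuousWithinAt ?_
        refine ContinuousAt.comp (g := fun x : ℂ × Q => g γ x.1 x.2)
          (f := fun x : ℝ × Q => (rayPoint (ζ x.2) (γ, x.1), x.2)) ?_ (by fun_prop)
        exact (hg _ hx.2 γ hγ _ (rayPoint_mem (hz _ hx.2 γ hγ) hx.1)).continuousAt
    refine h1.congr fun x hx => ?_
    simp [Function.uncurry, hx.2, pull, rayWeight, Set.mem_Ioi.1 hx.1]
  · intro x hx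
    by_cases hxV : x.2 ∈ V
    · have hr : ¬ 0 < x.1 := fun h => hx ⟨h, hxV⟩
      simp [Function.uncurry, hxV, pull_of_nonpos hr]
    · simp [Function.uncurry, hxV]

/-- Sum-integrals of families of analytic functions whose absolute sum-integrals are locally bounded
are continuously differentiable. They may be differentiated under the sum and the integral as if
the contours were fixed: the rotation of a ray contributes the integral of a total derivative, which
vanishes. -/
theorem sumInt_contDiffOn_and_fderiv (hV : IsOpen V) (hz : ∀ q ∈ V, Nondegenerate B P (ζ q))
    (hg : ∀ q ∈ V, ∀ γ, B.index P γ ≠ 0 → ∀ t ∈ ray γ (ζ q),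
      AnalyticAt ℂ (fun x : ℂ × Q => g γ x.1 x.2) (t, q))
    (hb : ∀ q ∈ V, ∃ C : ℝ≥0∞, C ≠ ⊤ ∧ ∀ᶠ q' in 𝓝 q,
      absSumInt B P (ζ q') (fun γ t => ‖g γ t q'‖ₑ) ≤ C) :
    ContDiffOn ℂ 1 (fun q => sumInt B P (ζ q) fun γ t => g γ t q) V ∧
    ∀ q ∈ V, ∀ v, SumIntegrable B P (ζ q) (fun γ t => fderiv ℂ (g γ t) q v) →
      fderiv ℂ (fun q => sumInt B P (ζ q) fun γ t => g γ t q) q v =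
        sumInt B P (ζ q) (fun γ t => fderiv ℂ (g γ t) q v) := by
  let : MeasurableSpace Q := borel Q
  have : BorelSpace Q := ⟨rfl⟩
  set F : Charge m × ℝ → Q → ℂ := fun ω q =>
    V.indicator (fun q => pull B P (ζ q) (fun γ t => g γ t q) ω) q with hF
  have hFV : ∀ q ∈ V, ∀ ω, F ω q = pull B P (ζ q) (fun γ t => g γ t q) ω := fun q hq ω =>
    Set.indicator_of_mem hq _
  have hFev : ∀ q ∈ V, ∀ ω, F ω =ᶠ[𝓝 q] fun q => pull B P (ζ q) (fun γ t => g γ t q) ω :=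
    fun q hq ω => eventually_of_mem (hV.mem_nhds hq) fun q' hq' => hFV q' hq' ω
  have hcont : ∀ q ∈ V, RayContinuous B P (ζ q) (fun γ t => g γ t q) := fun q hq =>
    rayContinuous_of_analyticAt (hg q hq)
  have hint : ∀ q ∈ V, SumIntegrable B P (ζ q) (fun γ t => g γ t q) := by
    intro q hq
    obtain ⟨C, hC, hev⟩ := hb q hq
    exact sumIntegrable_of_absSumInt (hz q hq) (hcont q hq)
      (ne_top_of_le_ne_top hC hev.self_of_nhds)
  have hsum : ∀ q ∈ V, sumInt B P (ζ q) (fun γ t => g γ t q) = ∫ ω, F ω q ∂rayMeasure m := by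
    intro q hq
    rw [sumInt_eq_integral (hint q hq)]
    exact integral_congr_ae (Eventually.of_forall fun ω => (hFV q hq ω).symm)
  obtain ⟨hC1, hder⟩ := holomorphic_integral (μ := rayMeasure m) hV
    (measurable_pull_param hV hz hg)
    (fun ω q hq => (analyticAt_pull (hz q hq) (hg q hq) ω).congr (hFev q hq ω).symm) (by
      intro q hq
      obtain ⟨C, hC, hev⟩ := hb q hq
      refine ⟨C, hC, ?_⟩
      filter_upwards [hev, hV.mem_nhds hq] with q' h1 h2
      rw [absSumInt_enorm_eq (hz q' h2) (hcont q' h2)] at h1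
      refine le_of_eq_of_le (lintegral_congr fun ω => ?_) h1
      exact congrArg _ (hFV q' h2 ω))
  refine ⟨hC1.congr hsum, fun q hq v hvint => ?_⟩
  have hfd : fderiv ℂ (fun q => sumInt B P (ζ q) fun γ t => g γ t q) q =
      fderiv ℂ (fun q => ∫ ω, F ω q ∂rayMeasure m) q :=
    Filter.EventuallyEq.fderiv_eq (eventually_of_mem (hV.mem_nhds hq) hsum)
  obtain ⟨hi, hd⟩ := hder q hq v
  rw [hfd, hd, sumInt_eq_integral hvint, ← sub_eq_zero, ← integral_sub hi hvint]
  have hR := hi.sub hvint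
  refine (integral_rayMeasure hR).trans ?_
  have hzero : ∀ γ, ∫ r in Set.Ioi (0 : ℝ), (fderiv ℂ (F (γ, r)) q v -
      pull B P (ζ q) (fun γ t => fderiv ℂ (g γ t) q v) (γ, r)) = 0 := by
    intro γ
    by_cases hγ : B.index P γ = 0
    · have : ∀ r, F (γ, r) = fun _ => 0 := fun r => by
        funext q'
        simp [hF, pull_of_inactive hγ]
      simp [this, pull_of_inactive hγ]
    -- the ray of `γ` at the parameter `q'` consists of the points `r τ(q')`
    set τ : Q →L[ℂ] ℂ := Complex.I • ((linCLM γ).comp ζ) with hτ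
    have hτa : ∀ q', τ q' = Complex.I * lin γ (ζ q') := fun q' => by
      simp [hτ, linCLM_apply]
    have hτ0 : τ q ≠ 0 := by
      rw [hτa]
      exact mul_ne_zero Complex.I_ne_zero (hz q hq γ hγ)
    set G : ℂ × Q → ℂ := fun x => g γ x.1 x.2 with hG
    have hray : ∀ r : ℝ, 0 < r → AnalyticAt ℂ G (r * τ q, q) := fun r hr => by
      rw [hτa]
      exact hg q hq γ hγ _ (rayPoint_mem (hz q hq γ hγ) hr)
    have hRr : ∀ r : ℝ, 0 < r → fderiv ℂ (F (γ, r)) q v -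
        pull B P (ζ q) (fun γ t => fderiv ℂ (g γ t) q v) (γ, r) =
        τ v / τ q * (-(B.index P γ / (r ^ 2 * τ q)) * G (r * τ q, q) +
        B.index P γ / (r * τ q) * (τ q * fderiv ℂ G (r * τ q, q) (1, 0))) := by
      intro r hr
      have hr' : (r : ℂ) ≠ 0 := by exact_mod_cast hr.ne'
      have h1 : fderiv ℂ (F (γ, r)) q = fderiv ℂ (fun q' => B.index P γ *
          (τ q' / (r * τ q') ^ 2) * G (r * τ q', q')) q := by
        rw [Filter.EventuallyEq.fderiv_eq (hFev q hq (γ, r))]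
        congr 1
        funext q'
        simp only [pull, rayWeight, hr, if_true, rayPoint, hτa, hG]
      have h2 : pull B P (ζ q) (fun γ t => fderiv ℂ (g γ t) q v) (γ, r) =
          B.index P γ * (τ q / (r * τ q) ^ 2) * fderiv ℂ G (r * τ q, q) (0, v) := by
        rw [← AnalyticAt.fderiv_slice (hray r hr) v]
        simp only [pull, rayWeight, hr, if_true, rayPoint, hτa, hG]
      rw [h1, h2, fderiv_comp_ray hr' hτ0 (hray r hr), add_sub_cancel_left]
    refine integral_Ioi_deriv_eq_zero
      (h := fun r => τ v / τ q * (B.index P γ / (r * τ q) * G (r * τ q, q))) ?_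
      (Integrable.slice hR γ) ?_
    · intro r hr
      rw [hRr r hr]
      exact (hasDerivAt_radial hr.ne' hτ0 (hray r hr)).const_mul _
    · refine IntegrableOn.congr_fun ((Integrable.slice (hint q hq) γ).const_mul (τ v / τ q))
        (fun r hr => ?_) measurableSet_Ioi
      have hr' : (r : ℂ) ≠ 0 := by exact_mod_cast (Set.mem_Ioi.1 hr).ne'
      have := Set.mem_Ioi.1 hr
      simp only [pull, rayWeight, this, if_true, rayPoint, ← hτa, Complex.real_smul, hG]
      push_cast
      field_simp
  exact (tsum_congr hzero).trans tsum_zero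

end Param

/-! ### The pairing and the kernel -/

section Kernel

variable {m : ℕ} {B : BPSData m} {P : Presentation} {U : Set (Point m)}

theorem BPSData.pair_swap (B : BPSData m) (γ γ' : Charge m) : B.pair γ' γ = -B.pair γ γ' := by
  have h : ∀ a b, B.omega b a = -B.omega a b := fun a b => by
    have := congrFun (congrFun B.skew a) b
    simpa using this
  simp only [BPSData.pair]
  rw [Finset.sum_comm, ← Finset.sum_neg_distrib]
  refine Finset.sum_congr rfl fun a _ => ?_
  rw [← Finset.sum_neg_distrib]
  refine Finset.sum_congr rfl fun b _ => ?_
  rw [h a b]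
  ring

theorem kernel_swap (γ γ' : Charge m) (t t' : ℂ) : kernel B γ' γ t' t = kernel B γ γ' t t' := by
  simp only [kernel]
  rw [B.pair_swap γ γ', ← neg_sub t' t, div_neg]
  push_cast
  ring

theorem pair_cast (γ γ' : Charge m) :
    (B.pair γ γ' : ℂ) = ∑ a, ∑ b, (γ a : ℂ) * B.omega a b * γ' b := by
  simp [BPSData.pair]

theorem norm_coe_le (γ : Charge m) (a : Fin m) : ‖(γ a : ℂ)‖ ≤ ‖γ‖ := by
  rw [Complex.norm_intCast, ← Int.norm_eq_abs]
  exact norm_le_pi_norm γ a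

theorem norm_lin_le (γ : Charge m) (v : Fin m → ℂ) : ‖lin γ v‖ ≤ ‖γ‖ * ∑ a, ‖v a‖ := by
  rw [lin, Finset.mul_sum]
  refine (norm_sum_le _ _).trans (Finset.sum_le_sum fun a _ => ?_)
  rw [norm_mul]
  exact mul_le_mul_of_nonneg_right (norm_coe_le γ a) (norm_nonneg _)

theorem exists_norm_pair_le (B : BPSData m) (γ : Charge m) :
    ∃ C : ℝ, 0 ≤ C ∧ ∀ γ', ‖(B.pair γ γ' : ℂ)‖ ≤ C * ‖γ'‖ := by
  refine ⟨∑ a, ∑ b, ‖(γ a : ℂ) * B.omega a b‖, by positivity, fun γ' => ?_⟩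
  rw [pair_cast, Finset.sum_mul]
  refine (norm_sum_le _ _).trans (Finset.sum_le_sum fun a _ => ?_)
  rw [Finset.sum_mul]
  refine (norm_sum_le _ _).trans (Finset.sum_le_sum fun b _ => ?_)
  rw [norm_mul]
  exact mul_le_mul_of_nonneg_left (norm_coe_le γ' b) (norm_nonneg _)

theorem isOpen_dom (γ : Charge m) : IsOpen (dom B P U γ) := isOpen_interior

theorem dom_spec {γ : Charge m} {t : ℂ} {p : Point m} (h : (t, p) ∈ dom B P U γ) :
    t ≠ 0 ∧ p ∈ U ∧ ∀ γ', B.index P γ' ≠ 0 → B.pair γ γ' ≠ 0 → t ∉ ray γ' p.1 := by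
  have h' : (t, p) ∈ {q : ℂ × Point m | q.1 ≠ 0 ∧ q.2 ∈ U ∧
    ∀ γ', B.index P γ' ≠ 0 → B.pair γ γ' ≠ 0 → q.1 ∉ ray γ' q.2.1} := interior_subset h
  exact h'

/-- Near a point of `𝒟_γ` the kernel is bounded by a multiple of the norm of the other charge,
because a point of `𝒟_γ` has a positive distance from all rays across which `X_γ` jumps. -/
theorem exists_kernel_bound {γ : Charge m} {t : ℂ} {p : Point m} (h : (t, p) ∈ dom B P U γ) :
    ∃ C : ℝ, 0 ≤ C ∧ ∀ᶠ q in 𝓝 (t, p), ∀ γ', B.index P γ' ≠ 0 → ∀ t' ∈ ray γ' q.2.1,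
      ‖kernel B γ γ' q.1 t'‖ ≤ C * ‖γ'‖ := by
  obtain ⟨ε, hε, hball⟩ := Metric.isOpen_iff.1 (isOpen_dom γ) _ h
  obtain ⟨A, hA, hpair⟩ := exists_norm_pair_le B γ
  set R : ℝ := ‖t‖ + ε with hR
  have hR0 : 0 < R := by positivity
  refine ⟨A * (R * (1 + R / (ε / 2))), by positivity, ?_⟩
  filter_upwards [ball_mem_nhds (t, p) (half_pos hε)] with q hq γ' hγ' t' ht'
  by_cases hp0 : B.pair γ γ' = 0
  · simp only [kernel, hp0, Int.cast_zero, zero_div, zero_mul, norm_zero]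
    positivity
  have hqt : dist q.1 t < ε / 2 := (le_max_left _ _).trans_lt hq
  have hqR : ‖q.1‖ ≤ R := by
    have : ‖q.1‖ ≤ ‖t‖ + dist q.1 t := by
      rw [dist_eq_norm]
      simpa using norm_add_le t (q.1 - t)
    linarith
  -- otherwise `(t', q.2)` would lie in the domain although `t'` is on a jump of the mode
  have hdist : ε / 2 ≤ ‖t' - q.1‖ := by
    by_contra hlt
    push Not at hlt
    have hmem : (t', q.2) ∈ ball (t, p) ε := by
      rw [mem_ball, Prod.dist_eq]
      refine max_lt ?_ (((le_max_right _ _).trans_lt hq).trans (half_lt_self hε))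
      calc dist t' t ≤ dist t' q.1 + dist q.1 t := dist_triangle _ _ _
        _ < ε / 2 + ε / 2 := add_lt_add (by rwa [dist_eq_norm]) hqt
        _ = ε := add_halves ε
    exact (dom_spec (hball hmem)).2.2 γ' hγ' hp0 ht'
  have hpos : 0 < ‖t' - q.1‖ := (half_pos hε).trans_le hdist
  have h1 : ‖t' / (t' - q.1)‖ ≤ 1 + R / (ε / 2) := by
    have hne : t' - q.1 ≠ 0 := norm_pos_iff.1 hpos
    have : t' / (t' - q.1) = 1 + q.1 / (t' - q.1) := by
      field_simp
      ring
    rw [this]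
    refine (norm_add_le _ _).trans ?_
    rw [norm_one, norm_div]
    gcongr
  have hpi : ‖(2 * Real.pi * Complex.I : ℂ)‖ = 2 * Real.pi := by
    simp [abs_of_pos Real.pi_pos]
  have hpi1 : (1 : ℝ) ≤ 2 * Real.pi := by linarith [Real.pi_gt_three]
  calc ‖kernel B γ γ' q.1 t'‖
      = ‖(B.pair γ γ' : ℂ)‖ / (2 * Real.pi) * (‖q.1‖ * ‖t' / (t' - q.1)‖) := by
        rw [kernel, norm_mul, norm_div, hpi, mul_div_assoc, norm_mul]
    _ ≤ ‖(B.pair γ γ' : ℂ)‖ * (‖q.1‖ * ‖t' / (t' - q.1)‖) := by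
        gcongr
        exact div_le_self (norm_nonneg _) hpi1
    _ ≤ (A * ‖γ'‖) * (R * (1 + R / (ε / 2))) := by
        gcongr
        exact hpair γ'
    _ = A * (R * (1 + R / (ε / 2))) * ‖γ'‖ := by ring

theorem analyticAt_kernel {γ γ' : Charge m} {t t' : ℂ} {p : Point m}
    (h : (t, p) ∈ dom B P U γ) (hγ' : B.index P γ' ≠ 0) (ht' : t' ∈ ray γ' p.1) :
    AnalyticAt ℂ (fun x : ℂ × ℂ => kernel B γ γ' x.2 x.1) (t', t) := by
  by_cases hp0 : B.pair γ γ' = 0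
  · simp only [kernel, hp0, Int.cast_zero, zero_div, zero_mul]
    exact analyticAt_const
  have hne : t' - t ≠ 0 := by
    rw [sub_ne_zero]
    rintro rfl
    exact (dom_spec h).2.2 γ' hγ' hp0 ht'
  unfold kernel
  exact analyticAt_const.mul ((analyticAt_snd.mul analyticAt_fst).div
    (analyticAt_fst.sub analyticAt_snd) hne)

end Kernel

/-! ### The linearized TBA equations -/

section TBA

variable {m : ℕ} {B : BPSData m} {P : Presentation} {U : Set (Point m)}
  {X : Charge m → ℂ → Point m → ℂ}

theorem IsGeneric.nondegenerate (hgen : IsGeneric B P U) {p : Point m} (hp : p ∈ U) :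
    Nondegenerate B P p.1 := hgen.ne_zero p hp

theorem IsSolution.ne_zero (hX : IsSolution B P U X) {γ : Charge m} {t : ℂ} {p : Point m}
    (h : (t, p) ∈ dom B P U γ) : X γ t p ≠ 0 := by
  rw [hX.tba γ t p h, Xsf]
  exact mul_ne_zero (mul_ne_zero (Units.ne_zero _) (Complex.exp_ne_zero _)) (Complex.exp_ne_zero _)

theorem IsSolution.differentiableAt (hX : IsSolution B P U X) {γ : Charge m} {t : ℂ} {p : Point m}
    (h : (t, p) ∈ dom B P U γ) : DifferentiableAt ℂ (X γ t) p :=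
  DifferentiableAt.comp p (g := fun q : ℂ × Point m => X γ q.1 q.2) (f := fun p' => (t, p'))
    (hX.holo γ _ h).differentiableAt (by fun_prop)

/-- The properties of a point `(t, p)` on the ray of an active charge `γ` that matter for the
differentiation of `Li_k(X_γ)`: it lies in `𝒟_γ`, and the value of `X_γ` is admissible. -/
structure OnRay (B : BPSData m) (P : Presentation) (U : Set (Point m))
    (X : Charge m → ℂ → Point m → ℂ) (γ : Charge m) (t : ℂ) (p : Point m) : Prop where
  mem_dom : (t, p) ∈ dom B P U γ
  admissible : P.Admissible (X γ t p)

theorem onRay (hgen : IsGeneric B P U) (hX : IsSolution B P U X) {p : Point m} (hp : p ∈ U)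
    {γ : Charge m} (hγ : B.index P γ ≠ 0) {t : ℂ} (ht : t ∈ ray γ p.1) : OnRay B P U X γ t p :=
  ⟨hgen.mem_dom p hp γ hγ t ht, hX.branch p hp γ hγ t ht⟩

theorem IsSolution.analyticAt_li₂ (hX : IsSolution B P U X) {γ : Charge m} {t : ℂ} {p : Point m}
    (h : OnRay B P U X γ t p) :
    AnalyticAt ℂ (fun q : ℂ × Point m => P.li₂ (X γ q.1 q.2)) (t, p) :=
  AnalyticAt.comp_of_eq (P.analyticAt_li₂ h.admissible (hX.ne_zero h.mem_dom))
    (hX.holo γ _ h.mem_dom) rfl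

theorem IsSolution.analyticAt_li₁ (hX : IsSolution B P U X) {γ : Charge m} {t : ℂ} {p : Point m}
    (h : OnRay B P U X γ t p) :
    AnalyticAt ℂ (fun q : ℂ × Point m => P.li₁ (X γ q.1 q.2)) (t, p) :=
  AnalyticAt.comp_of_eq (P.analyticAt_li₁ h.admissible (hX.ne_zero h.mem_dom))
    (hX.holo γ _ h.mem_dom) rfl

theorem IsSolution.analyticAt_li₀ (hX : IsSolution B P U X) {γ : Charge m} {t : ℂ} {p : Point m}
    (h : OnRay B P U X γ t p) :
    AnalyticAt ℂ (fun q : ℂ × Point m => P.li₀ (X γ q.1 q.2)) (t, p) :=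
  AnalyticAt.comp_of_eq (P.analyticAt_li₀ h.admissible) (hX.holo γ _ h.mem_dom) rfl

theorem IsSolution.fderiv_li₂ (hX : IsSolution B P U X) {γ : Charge m} {t : ℂ} {p : Point m}
    (h : OnRay B P U X γ t p) (v : Point m) :
    fderiv ℂ (fun p => P.li₂ (X γ t p)) p v = P.li₁ (X γ t p) * dlog X v p γ t := by
  have h1 : HasFDerivAt (fun p => P.li₂ (X γ t p)) _ p :=
    (P.hasDerivAt_li₂ h.admissible (hX.ne_zero h.mem_dom)).comp_hasFDerivAt p
      (hX.differentiableAt h.mem_dom).hasFDerivAt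
  rw [h1.fderiv]
  simp [dlog, pd]
  ring

theorem IsSolution.fderiv_li₁ (hX : IsSolution B P U X) {γ : Charge m} {t : ℂ} {p : Point m}
    (h : OnRay B P U X γ t p) (v : Point m) :
    fderiv ℂ (fun p => P.li₁ (X γ t p)) p v = P.li₀ (X γ t p) * dlog X v p γ t := by
  have h1 : HasFDerivAt (fun p => P.li₁ (X γ t p)) _ p :=
    (P.hasDerivAt_li₁ h.admissible (hX.ne_zero h.mem_dom)).comp_hasFDerivAt p
      (hX.differentiableAt h.mem_dom).hasFDerivAt
  rw [h1.fderiv]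
  simp [dlog, pd]
  ring

theorem IsSolution.differentiableAt_li₁ (hX : IsSolution B P U X) {γ : Charge m} {t : ℂ}
    {p : Point m} (h : OnRay B P U X γ t p) :
    DifferentiableAt ℂ (fun p => P.li₁ (X γ t p)) p :=
  DifferentiableAt.comp p (P.hasDerivAt_li₁ h.admissible (hX.ne_zero h.mem_dom)).differentiableAt
    (hX.differentiableAt h.mem_dom)

theorem continuousAt_ray_slice {G : ℂ × Point m → ℂ} {t : ℂ} {p : Point m}
    (h : AnalyticAt ℂ G (t, p)) : ContinuousAt (fun t' => G (t', p)) t :=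
  ContinuousAt.comp (f := fun t' => (t', p)) h.continuousAt (by fun_prop)

theorem rayContinuous_li₁ (hgen : IsGeneric B P U) (hX : IsSolution B P U X) {p : Point m}
    (hp : p ∈ U) : RayContinuous B P p.1 (fun γ t => P.li₁ (X γ t p)) := fun _ hγ _ ht =>
  (continuousAt_ray_slice (hX.analyticAt_li₁ (onRay hgen hX hp hγ ht))).continuousWithinAt

theorem rayContinuous_li₀ (hgen : IsGeneric B P U) (hX : IsSolution B P U X) {p : Point m}
    (hp : p ∈ U) : RayContinuous B P p.1 (fun γ t => P.li₀ (X γ t p)) := fun _ hγ _ ht =>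
  (continuousAt_ray_slice (hX.analyticAt_li₀ (onRay hgen hX hp hγ ht))).continuousWithinAt

theorem IsSolution.analyticAt_dlog (hX : IsSolution B P U X) {γ : Charge m} {t : ℂ} {p : Point m}
    (h : (t, p) ∈ dom B P U γ) (v : Point m) :
    AnalyticAt ℂ (fun q : ℂ × Point m => dlog X v q.2 γ q.1) (t, p) := by
  have h1 : AnalyticAt ℂ (fun q : ℂ × Point m =>
      fderiv ℂ (fun q : ℂ × Point m => X γ q.1 q.2) q (0, v) / X γ q.1 q.2) (t, p) := by
    refine AnalyticAt.div ?_ (hX.holo γ _ h) (hX.ne_zero h)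
    exact ((ContinuousLinearMap.apply ℂ ℂ ((0 : ℂ), v)).analyticAt _).comp (hX.holo γ _ h).fderiv
  refine h1.congr ?_
  filter_upwards [(isOpen_dom γ).mem_nhds h] with q hq
  simp only [dlog, pd]
  rw [← AnalyticAt.fderiv_slice (G := fun q : ℂ × Point m => X γ q.1 q.2) (hX.holo γ q hq) v]

theorem rayContinuous_dlog (hgen : IsGeneric B P U) (hX : IsSolution B P U X) {p : Point m}
    (hp : p ∈ U) (v : Point m) : RayContinuous B P p.1 (dlog X v p) := fun _ hγ _ ht =>
  (continuousAt_ray_slice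
    (hX.analyticAt_dlog (onRay hgen hX hp hγ ht).mem_dom v)).continuousWithinAt

theorem rayContinuous_kernel {γ : Charge m} {t : ℂ} {p : Point m} (h : (t, p) ∈ dom B P U γ) :
    RayContinuous B P p.1 (fun γ' t' => kernel B γ γ' t t') := fun _ hγ' _ ht' =>
  (ContinuousAt.comp (f := fun t' => (t', t)) (analyticAt_kernel h hγ' ht').continuousAt
    (by fun_prop)).continuousWithinAt

/-- The correction `∑∫ K Li₁(X)` to the semi-flat value of `log X_γ`. -/
def logCorrection (B : BPSData m) (P : Presentation) (X : Charge m → ℂ → Point m → ℂ)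
    (γ : Charge m) (t : ℂ) (p : Point m) : ℂ :=
  sumInt B P p.1 (fun γ' t' => kernel B γ γ' t t' * P.li₁ (X γ' t' p))

theorem IsSolution.eq_exp (hgen : IsGeneric B P U) (hX : IsSolution B P U X) {γ : Charge m} {t : ℂ}
    {p : Point m} (h : (t, p) ∈ dom B P U γ) :
    X γ t p = Xsf B γ t p * Complex.exp (logCorrection B P X γ t p) := by
  rw [hX.tba γ t p h]
  congr 2
  rw [logCorrection, sumInt, ← tsum_mul_left]
  refine tsum_congr fun γ' => ?_
  by_cases hγ' : B.index P γ' = 0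
  · simp [hγ']
  rw [mul_assoc (B.index P γ'), mul_left_comm, rayIntegral, rayIntegral, ← mul_assoc (1 / _),
    ← integral_const_mul]
  congr 1
  refine setIntegral_congr_fun measurableSet_Ioi fun r hr => ?_
  have h0 := rayPoint_ne_zero (hgen.ne_zero p (dom_spec h).2.1 γ' hγ') hr
  simp only [rayPoint] at h0
  simp only [kernel]
  set t' := (r : ℂ) * (Complex.I * lin γ' p.1)
  have : t / (t' - t) / t' = t * t' / (t' - t) / t' ^ 2 := by
    field_simp
  have h2 : 1 / t' * (t / (t' - t)) = t * t' / (t' - t) / t' ^ 2 := by rw [← this]; ring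
  rw [h2]
  ring

/-- A sum-integral against the kernel converges absolutely on all of `𝒟_γ` as soon as it does with
the kernel replaced by the norm of the charge. -/
theorem sumIntegrable_kernel_mul (hgen : IsGeneric B P U) {γ : Charge m} {t : ℂ} {p : Point m}
    (h : (t, p) ∈ dom B P U γ) {f : Charge m → ℂ → ℂ} (hf : RayContinuous B P p.1 f)
    (hi : SumIntegrable B P p.1 (fun γ t => (‖γ‖ : ℂ) * f γ t)) :
    SumIntegrable B P p.1 (fun γ' t' => kernel B γ γ' t t' * f γ' t') := by
  obtain ⟨C, -, hC⟩ := exists_kernel_bound h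
  have hC' := hC.self_of_nhds
  refine hi.mono (hgen.nondegenerate (dom_spec h).2.1) (C := C)
    (fun γ' hγ' => (rayContinuous_kernel h γ' hγ').mul (hf γ' hγ')) fun γ' hγ' t' ht' => ?_
  rw [norm_mul, norm_mul, ← mul_assoc, Complex.norm_real, norm_norm]
  exact mul_le_mul_of_nonneg_right (hC' γ' hγ' t' ht') (norm_nonneg _)

theorem sumIntegrable_norm_mul (hgen : IsGeneric B P U) {p : Point m} (hp : p ∈ U)
    {f : Charge m → ℂ → ℂ} (hf : RayContinuous B P p.1 f)
    (hi : absSumInt B P p.1 (fun γ t => ‖γ‖ₑ * ‖f γ t‖ₑ) ≠ ⊤) :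
    SumIntegrable B P p.1 (fun γ t => (‖γ‖ : ℂ) * f γ t) := by
  refine sumIntegrable_of_absSumInt (hgen.nondegenerate hp)
    (fun γ hγ => continuousOn_const.mul (hf γ hγ)) ?_
  have : ∀ γ : Charge m, ‖(‖γ‖ : ℂ)‖ₑ = ‖γ‖ₑ := fun γ => by
    rw [← ofReal_norm, Complex.norm_real, norm_norm, ofReal_norm]
  simpa [enorm_mul, this] using hi

theorem sumIntegrable_coe_mul (hgen : IsGeneric B P U) {p : Point m} (hp : p ∈ U)
    {f : Charge m → ℂ → ℂ} (hf : RayContinuous B P p.1 f)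
    (hi : SumIntegrable B P p.1 (fun γ t => (‖γ‖ : ℂ) * f γ t)) (b : Fin m) :
    SumIntegrable B P p.1 (fun γ t => (γ b : ℂ) * f γ t) := by
  refine hi.mono (hgen.nondegenerate hp) (C := 1)
    (fun γ hγ => continuousOn_const.mul (hf γ hγ)) fun γ hγ t ht => ?_
  rw [norm_mul, norm_mul, Complex.norm_real, norm_norm, one_mul]
  exact mul_le_mul_of_nonneg_right (norm_coe_le γ b) (norm_nonneg _)

theorem rayContinuous_li₀_dlog (hgen : IsGeneric B P U) (hX : IsSolution B P U X) {p : Point m}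
    (hp : p ∈ U) (v : Point m) :
    RayContinuous B P p.1 (fun γ t => P.li₀ (X γ t p) * dlog X v p γ t) := fun γ hγ =>
  (rayContinuous_li₀ hgen hX hp γ hγ).mul (rayContinuous_dlog hgen hX hp v γ hγ)

theorem sumIntegrable_norm_li₀_dlog (hgen : IsGeneric B P U) (hX : IsSolution B P U X)
    (hconv : IsConvergent B P X U) {p : Point m} (hp : p ∈ U) (v : Point m) :
    SumIntegrable B P p.1 (fun γ t => (‖γ‖ : ℂ) * (P.li₀ (X γ t p) * dlog X v p γ t)) :=
  sumIntegrable_norm_mul hgen hp (rayContinuous_li₀_dlog hgen hX hp v) (hconv.single_deriv p hp v)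

theorem analyticAt_kernel_li₁ (hgen : IsGeneric B P U) (hX : IsSolution B P U X) {γ γ' : Charge m}
    {t t' : ℂ} {p : Point m} (h : (t, p) ∈ dom B P U γ) (hγ' : B.index P γ' ≠ 0)
    (ht' : t' ∈ ray γ' p.1) :
    AnalyticAt ℂ (fun x : ℂ × (ℂ × Point m) =>
      kernel B γ γ' x.2.1 x.1 * P.li₁ (X γ' x.1 x.2.2)) (t', (t, p)) := by
  refine AnalyticAt.mul ?_ ?_
  · exact AnalyticAt.comp_of_eq (g := fun x : ℂ × ℂ => kernel B γ γ' x.2 x.1)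
      (f := fun x : ℂ × (ℂ × Point m) => (x.1, x.2.1)) (analyticAt_kernel h hγ' ht')
      (analyticAt_fst.prod (analyticAt_fst.comp analyticAt_snd)) rfl
  · exact AnalyticAt.comp_of_eq (g := fun x : ℂ × Point m => P.li₁ (X γ' x.1 x.2))
      (f := fun x : ℂ × (ℂ × Point m) => (x.1, x.2.2))
      (hX.analyticAt_li₁ (onRay hgen hX (dom_spec h).2.1 hγ' ht'))
      (analyticAt_fst.prod (analyticAt_snd.comp analyticAt_snd)) rfl

/-- The correction is continuously differentiable on `𝒟_γ`, jointly in `t` and the parameters, and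
its derivative along the parameters is `T (∂_v log X)`. -/
theorem logCorrection_contDiffOn_and_fderiv (hgen : IsGeneric B P U) (hX : IsSolution B P U X)
    (hconv : IsConvergent B P X U) (γ : Charge m) :
    ContDiffOn ℂ 1 (fun q : ℂ × Point m => logCorrection B P X γ q.1 q.2) (dom B P U γ) ∧
    ∀ q ∈ dom B P U γ, ∀ v, fderiv ℂ (fun q : ℂ × Point m => logCorrection B P X γ q.1 q.2) q (0, v)
      = linOp B P X q.2 (dlog X v q.2) γ q.1 := by
  let ζ : (ℂ × Point m) →L[ℂ] (Fin m → ℂ) :=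
    (ContinuousLinearMap.fst ℂ _ _).comp (ContinuousLinearMap.snd ℂ _ _)
  have key := sumInt_contDiffOn_and_fderiv (B := B) (P := P) (V := dom B P U γ) (ζ := ζ)
    (g := fun γ' t' q => kernel B γ γ' q.1 t' * P.li₁ (X γ' t' q.2)) (isOpen_dom γ)
    (fun q hq => hgen.nondegenerate (dom_spec hq).2.1)
    (fun q hq γ' hγ' t' ht' => analyticAt_kernel_li₁ hgen hX hq hγ' ht') (by
      intro q hq
      obtain ⟨C, hC0, hC⟩ := exists_kernel_bound hq
      obtain ⟨D, hD, hDev⟩ := hconv.single₁ q.2 (dom_spec hq).2.1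
      have hDev' :=
        (continuous_snd (X := ℂ) (Y := Point m)).continuousAt (x := q) |>.eventually hDev
      refine ⟨ENNReal.ofReal C * D, ENNReal.mul_ne_top ENNReal.ofReal_ne_top hD, ?_⟩
      filter_upwards [hC, hDev', (isOpen_dom γ).mem_nhds hq] with q' h1 h2 h3
      refine le_trans ?_ (mul_le_mul_right h2 _)
      rw [← absSumInt_const_mul ENNReal.ofReal_ne_top]
      refine absSumInt_mono (hgen.nondegenerate (dom_spec h3).2.1) fun γ' hγ' t' ht' => ?_
      rw [enorm_mul, ← mul_assoc, ← mul_assoc]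
      refine mul_le_mul_left ?_ _
      calc ‖kernel B γ γ' q'.1 t'‖ₑ ≤ ENNReal.ofReal C * ‖γ'‖ₑ := by
            rw [← ofReal_norm, ← ofReal_norm, ← ENNReal.ofReal_mul hC0]
            exact ENNReal.ofReal_le_ofReal (h1 γ' hγ' t' ht')
        _ ≤ ENNReal.ofReal C * ‖γ'‖ₑ * (1 + ‖1 / t'‖ₑ) := le_mul_of_one_le_right' le_self_add)
  refine ⟨key.1, fun q hq v => ?_⟩
  have hp := (dom_spec hq).2.1
  have hslice : ∀ γ', B.index P γ' ≠ 0 → ∀ t' ∈ ray γ' q.2.1,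
      fderiv ℂ (fun q : ℂ × Point m => kernel B γ γ' q.1 t' * P.li₁ (X γ' t' q.2)) q (0, v) =
      kernel B γ γ' q.1 t' * P.li₀ (X γ' t' q.2) * dlog X v q.2 γ' t' := by
    intro γ' hγ' t' ht'
    have han : AnalyticAt ℂ (fun q : ℂ × Point m => kernel B γ γ' q.1 t' * P.li₁ (X γ' t' q.2)) q :=
      AnalyticAt.comp_of_eq (f := fun q : ℂ × Point m => (t', q))
        (analyticAt_kernel_li₁ hgen hX hq hγ' ht') (analyticAt_const.prod analyticAt_id) rfl
    have hray := onRay hgen hX hp hγ' ht'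
    rw [← AnalyticAt.fderiv_slice (t := q.1) (q := q.2) han v]
    simp only
    rw [fderiv_const_mul (hX.differentiableAt_li₁ hray)]
    simp only [smul_apply, smul_eq_mul]
    rw [hX.fderiv_li₁ hray, mul_assoc]
  have hi : SumIntegrable B P q.2.1 (fun γ' t' =>
      fderiv ℂ (fun q : ℂ × Point m => kernel B γ γ' q.1 t' * P.li₁ (X γ' t' q.2)) q (0, v)) := by
    refine (sumIntegrable_kernel_mul hgen hq (rayContinuous_li₀_dlog hgen hX hp v)
      (sumIntegrable_norm_li₀_dlog hgen hX hconv hp v)).congr (hgen.nondegenerate hp) ?_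
    intro γ' hγ' t' ht'
    rw [hslice γ' hγ' t' ht', mul_assoc]
  refine (key.2 q hq (0, v) hi).trans ?_
  exact sumInt_congr (hgen.nondegenerate hp) hslice

theorem analyticAt_Xsf (γ : Charge m) {t : ℂ} (ht : t ≠ 0) (p : Point m) :
    AnalyticAt ℂ (fun q : ℂ × Point m => Xsf B γ q.1 q.2) (t, p) := by
  have h1 : AnalyticAt ℂ (fun q : ℂ × Point m => lin γ q.2.2) (t, p) :=
    (((linCLM γ).comp ((ContinuousLinearMap.snd ℂ _ _).comp
      (ContinuousLinearMap.snd ℂ ℂ (Point m)))).analyticAt _).congr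
      (Eventually.of_forall fun q => linCLM_apply γ _)
  have h2 : AnalyticAt ℂ (fun q : ℂ × Point m => lin γ q.2.1) (t, p) :=
    (((linCLM γ).comp ((ContinuousLinearMap.fst ℂ _ _).comp
      (ContinuousLinearMap.snd ℂ ℂ (Point m)))).analyticAt _).congr
      (Eventually.of_forall fun q => linCLM_apply γ _)
  exact analyticAt_const.mul ((analyticAt_const.mul (h1.sub (h2.div analyticAt_fst ht))).cexp)

/-- The correction to `log X_γ` is a continuous logarithm of an analytic function, hence
analytic. -/
theorem analyticAt_logCorrection (hgen : IsGeneric B P U) (hX : IsSolution B P U X)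
    (hconv : IsConvergent B P X U) {γ : Charge m} {t : ℂ} {p : Point m}
    (h : (t, p) ∈ dom B P U γ) :
    AnalyticAt ℂ (fun q : ℂ × Point m => logCorrection B P X γ q.1 q.2) (t, p) := by
  set E : ℂ × Point m → ℂ := fun q => logCorrection B P X γ q.1 q.2 with hE
  have hcont : ContinuousAt E (t, p) :=
    ((logCorrection_contDiffOn_and_fderiv hgen hX hconv γ).1.continuousOn.continuousAt
      ((isOpen_dom γ).mem_nhds h))
  have hsf : ∀ q : ℂ × Point m, Xsf B γ q.1 q.2 ≠ 0 := fun q =>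
    mul_ne_zero (Units.ne_zero _) (Complex.exp_ne_zero _)
  have hquot : AnalyticAt ℂ (fun q : ℂ × Point m =>
      X γ q.1 q.2 / Xsf B γ q.1 q.2 / Complex.exp (E (t, p))) (t, p) :=
    ((hX.holo γ _ h).div (analyticAt_Xsf γ (dom_spec h).1 p) (hsf _)).div analyticAt_const
      (Complex.exp_ne_zero _)
  have heq : ∀ q ∈ dom B P U γ, X γ q.1 q.2 / Xsf B γ q.1 q.2 / Complex.exp (E (t, p)) =
      Complex.exp (E q - E (t, p)) := by
    intro q hq
    rw [hX.eq_exp hgen hq, mul_div_cancel_left₀ _ (hsf q), Complex.exp_sub]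
  have hval : X γ t p / Xsf B γ t p / Complex.exp (E (t, p)) = 1 := by
    have := heq _ h
    simpa using this
  have hlog : AnalyticAt ℂ (fun q : ℂ × Point m => E (t, p) + Complex.log
      (X γ q.1 q.2 / Xsf B γ q.1 q.2 / Complex.exp (E (t, p)))) (t, p) := by
    refine analyticAt_const.add (hquot.clog ?_)
    simp only [hval]
    exact Complex.one_mem_slitPlane
  refine hlog.congr ?_
  have hsmall : ∀ᶠ q in 𝓝 (t, p), ‖E q - E (t, p)‖ < Real.pi := by
    have : Tendsto (fun q => ‖E q - E (t, p)‖) (𝓝 (t, p)) (𝓝 0) := by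
      have := (hcont.sub continuousAt_const (g := fun _ => E (t, p))).norm
      simpa [ContinuousAt] using this
    exact this.eventually (gt_mem_nhds Real.pi_pos)
  filter_upwards [hsmall, (isOpen_dom γ).mem_nhds h] with q h1 h2
  have h3 := (Complex.abs_im_le_norm (E q - E (t, p))).trans_lt h1
  rw [abs_lt] at h3
  rw [heq q h2, Complex.log_exp h3.1 h3.2.le, add_sub_cancel]

theorem pd_logCorrection (hgen : IsGeneric B P U) (hX : IsSolution B P U X)
    (hconv : IsConvergent B P X U) {γ : Charge m} {t : ℂ} {p : Point m}
    (h : (t, p) ∈ dom B P U γ) (v : Point m) :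
    pd v (logCorrection B P X γ t) p = linOp B P X p (dlog X v p) γ t := by
  rw [pd, ← (logCorrection_contDiffOn_and_fderiv hgen hX hconv γ).2 (t, p) h v]
  exact AnalyticAt.fderiv_slice (analyticAt_logCorrection hgen hX hconv h) v

/-- The linearized TBA equations, obtained by differentiating the TBA system. -/
theorem dlog_eq_source_add (hgen : IsGeneric B P U) (hX : IsSolution B P U X)
    (hconv : IsConvergent B P X U) {γ : Charge m} {t : ℂ} {p : Point m}
    (h : (t, p) ∈ dom B P U γ) (v : Point m) :
    dlog X v p γ t = source v γ t + linOp B P X p (dlog X v p) γ t := by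
  have hE : DifferentiableAt ℂ (logCorrection B P X γ t) p :=
    DifferentiableAt.comp p (f := fun p' => (t, p'))
      (analyticAt_logCorrection hgen hX hconv h).differentiableAt (by fun_prop)
  have hlin : HasFDerivAt (fun p : Point m =>
      2 * Real.pi * Complex.I * (lin γ p.2 - lin γ p.1 / t)) ((2 * Real.pi * Complex.I : ℂ) •
        ((linCLM γ).comp (ContinuousLinearMap.snd ℂ _ _) -
          t⁻¹ • (linCLM γ).comp (ContinuousLinearMap.fst ℂ _ _))) p := by
    refine HasFDerivAt.congr_of_eventuallyEq (ContinuousLinearMap.hasFDerivAt _)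
      (Eventually.of_forall fun p' => ?_)
    simp [linCLM_apply]
    ring
  have hXd : HasFDerivAt (fun p' => (B.sigma γ : ℂ) * Complex.exp
      (2 * Real.pi * Complex.I * (lin γ p'.2 - lin γ p'.1 / t)) *
      Complex.exp (logCorrection B P X γ t p')) _ p :=
    (hlin.cexp.const_mul (B.sigma γ : ℂ)).mul hE.hasFDerivAt.cexp
  have hev : X γ t =ᶠ[𝓝 p] fun p' => (B.sigma γ : ℂ) * Complex.exp
      (2 * Real.pi * Complex.I * (lin γ p'.2 - lin γ p'.1 / t)) *
      Complex.exp (logCorrection B P X γ t p') := by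
    have : ∀ᶠ p' in 𝓝 p, (t, p') ∈ dom B P U γ :=
      (show ContinuousAt (fun p' : Point m => (t, p')) p by fun_prop).eventually
        ((isOpen_dom γ).mem_nhds h)
    filter_upwards [this] with p' hp'
    rw [hX.eq_exp hgen hp', Xsf]
  rw [dlog, div_eq_iff (hX.ne_zero h), pd, hev.fderiv_eq, hXd.fderiv, hX.eq_exp hgen h,
    ← pd_logCorrection hgen hX hconv h v, Xsf, source, pd]
  simp [linCLM_apply]
  ring

end TBA

/-! ### Double sum-integrals -/

section Slices

variable {m : ℕ} {Y : Type*} [MeasurableSpace Y] {ρ : Measure Y} [SFinite ρ]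

theorem measurePreserving_assoc :
    MeasurePreserving (MeasurableEquiv.prodAssoc.symm : Charge m × (ℝ × Y) ≃ᵐ _)
      ((Measure.count (α := Charge m)).prod ((volume.restrict (Set.Ioi 0)).prod ρ))
      ((rayMeasure m).prod ρ) :=
  (measurePreserving_prodAssoc Measure.count (volume.restrict (Set.Ioi 0)) ρ).symm _

theorem integrable_slice {f : (Charge m × ℝ) × Y → ℂ} (hf : Integrable f ((rayMeasure m).prod ρ))
    (γ : Charge m) :
    Integrable (fun x : ℝ × Y => f ((γ, x.1), x.2)) ((volume.restrict (Set.Ioi 0)).prod ρ) := by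
  have h1 := (measurePreserving_assoc (ρ := ρ)).integrable_comp_of_integrable hf
  exact Measure.ae_count_iff.1 (Integrable.prod_right_ae h1) γ

theorem integral_eq_tsum_slice {f : (Charge m × ℝ) × Y → ℂ}
    (hf : Integrable f ((rayMeasure m).prod ρ)) :
    ∫ x, f x ∂(rayMeasure m).prod ρ =
      ∑' γ, ∫ x : ℝ × Y, f ((γ, x.1), x.2) ∂(volume.restrict (Set.Ioi 0)).prod ρ := by
  have h1 := (measurePreserving_assoc (ρ := ρ)).integrable_comp_of_integrable hf
  rw [← (measurePreserving_assoc (ρ := ρ)).integral_comp']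
  refine (integral_prod _ h1).trans ?_
  rw [integral_countable h1.integral_prod_left]
  simp [Measure.real, MeasurableEquiv.prodAssoc]

/-- An absolutely convergent double sum-integral, as an iterated sum of iterated integrals. -/
theorem integral_eq_tsum_tsum {f : (Charge m × ℝ) × (Charge m × ℝ) → ℂ}
    (hf : Integrable f ((rayMeasure m).prod (rayMeasure m))) :
    ∫ x, f x ∂(rayMeasure m).prod (rayMeasure m) =
      ∑' γ, ∑' γ', ∫ r in Set.Ioi (0 : ℝ), ∫ r' in Set.Ioi (0 : ℝ), f ((γ, r), (γ', r')) := by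
  rw [integral_eq_tsum_slice hf]
  refine tsum_congr fun γ => ?_
  have h1 := (integrable_slice hf γ).swap
  rw [← integral_prod_swap]
  refine (integral_eq_tsum_slice h1).trans (tsum_congr fun γ' => ?_)
  rw [← integral_prod_swap]
  exact integral_prod _ (integrable_slice h1 γ').swap

end Slices

section Double

variable {m : ℕ} {B : BPSData m} {P : Presentation} {U : Set (Point m)}
  {X : Charge m → ℂ → Point m → ℂ} {p : Point m} {a b : Charge m → ℂ → ℂ}

/-- The integrand of `∑∫ ∑∫ a₁ K₁₂ b₂` on the product of two copies of the space of pairs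
`(γ, r)`. -/
def doublePull (B : BPSData m) (P : Presentation) (z : Fin m → ℂ) (a b : Charge m → ℂ → ℂ)
    (x : (Charge m × ℝ) × (Charge m × ℝ)) : ℂ :=
  pull B P z (fun γ t => pull B P z (fun γ' t' => a γ t * (kernel B γ γ' t t' * b γ' t')) x.2) x.1

theorem doublePull_swap (z : Fin m → ℂ) (x : (Charge m × ℝ) × (Charge m × ℝ)) :
    doublePull B P z b a x = doublePull B P z a b x.swap := by
  simp only [doublePull, pull, Prod.fst_swap, Prod.snd_swap]
  rw [kernel_swap]
  ring

theorem measurable_doublePull (hgen : IsGeneric B P U) (hp : p ∈ U)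
    (ha : RayContinuous B P p.1 a) (hb : RayContinuous B P p.1 b) :
    Measurable (doublePull B P p.1 a b) := by
  refine measurable_pull_pull (f := fun γ t γ' t' => a γ t * (kernel B γ γ' t t' * b γ' t'))
    (hgen.nondegenerate hp) fun γ γ' hγ hγ' => ?_
  have h1 : ContinuousOn (fun x : ℂ × ℂ => a γ x.1) (ray γ p.1 ×ˢ ray γ' p.1) :=
    (ha γ hγ).comp continuous_fst.continuousOn fun x hx => hx.1
  have h2 : ContinuousOn (fun x : ℂ × ℂ => b γ' x.2) (ray γ p.1 ×ˢ ray γ' p.1) :=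
    (hb γ' hγ').comp continuous_snd.continuousOn fun x hx => hx.2
  refine h1.mul (ContinuousOn.mul (fun x hx => ContinuousAt.continuousWithinAt ?_) h2)
  exact ContinuousAt.comp (g := fun x : ℂ × ℂ => kernel B γ γ' x.2 x.1) (f := Prod.swap)
    (analyticAt_kernel (hgen.mem_dom p hp γ hγ x.1 hx.1) hγ' hx.2).continuousAt
    continuous_swap.continuousAt

theorem integrable_doublePull (hgen : IsGeneric B P U) (hp : p ∈ U)
    (ha : RayContinuous B P p.1 a) (hb : RayContinuous B P p.1 b)
    (h : absSumInt B P p.1 (fun γ t => absSumInt B P p.1 (fun γ' t' =>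
      ‖kernel B γ γ' t t' * a γ t * b γ' t'‖ₑ)) ≠ ⊤) :
    Integrable (doublePull B P p.1 a b) ((rayMeasure m).prod (rayMeasure m)) := by
  have hz := hgen.nondegenerate hp
  have hm := measurable_doublePull hgen hp ha hb
  refine ⟨hm.aestronglyMeasurable, ?_⟩
  rw [hasFiniteIntegral_iff_enorm, lintegral_prod _ hm.enorm.aemeasurable, lt_top_iff_ne_top]
  have hinner : ∀ ω : Charge m × ℝ, ∫⁻ ω', ‖doublePull B P p.1 a b (ω, ω')‖ₑ ∂rayMeasure m =
      ‖rayWeight B P p.1 ω‖ₑ * absSumInt B P p.1 (fun γ' t' =>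
        ‖kernel B ω.1 γ' (rayPoint p.1 ω) t' * a ω.1 (rayPoint p.1 ω) * b γ' t'‖ₑ) := by
    rintro ⟨γ, r⟩
    by_cases hact : B.index P γ ≠ 0 ∧ 0 < r
    · obtain ⟨hγ, hr⟩ := hact
      have ht := rayPoint_mem (hz γ hγ) hr
      have hc : RayContinuous B P p.1 (fun γ' t' => kernel B γ γ' (rayPoint p.1 (γ, r)) t' *
          a γ (rayPoint p.1 (γ, r)) * b γ' t') := by
        intro γ' hγ'
        exact ((rayContinuous_kernel (hgen.mem_dom p hp γ hγ _ ht) γ' hγ').mul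
          continuousOn_const).mul (hb γ' hγ')
      rw [absSumInt_enorm_eq hz hc, ← lintegral_const_mul' _ _ enorm_ne_top]
      refine lintegral_congr fun ω' => ?_
      rw [← enorm_mul]
      simp only [doublePull, pull]
      congr 1
      ring
    · have h0 : rayWeight B P p.1 (γ, r) = 0 := by
        by_cases hr : 0 < r
        · have hγ : B.index P γ = 0 := by
            by_contra hγ
            exact hact ⟨hγ, hr⟩
          simp [rayWeight, hγ]
        · simp [rayWeight, hr]
      simp [doublePull, pull, h0]
  have hmi : Measurable fun ω => ∫⁻ ω', ‖doublePull B P p.1 a b (ω, ω')‖ₑ ∂rayMeasure m :=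
    hm.enorm.lintegral_prod_right'
  rw [lintegral_congr hinner]
  simp only [hinner] at hmi
  exact (absSumInt_eq_lintegral (F := fun γ t => absSumInt B P p.1 (fun γ' t' =>
      ‖kernel B γ γ' t t' * a γ t * b γ' t'‖ₑ)) hmi).symm.trans_ne h

theorem doublePull_eq_mul (z : Fin m → ℂ) (ω ω' : Charge m × ℝ) :
    doublePull B P z a b (ω, ω') = rayWeight B P z ω * a ω.1 (rayPoint z ω) *
      pull B P z (fun γ' t' => kernel B ω.1 γ' (rayPoint z ω) t' * b γ' t') ω' := by
  simp only [doublePull, pull]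
  ring

/-- `∑∫ a ∑∫ K b` as an integral over the product space. -/
theorem sumInt_mul_sumInt (hgen : IsGeneric B P U) (hp : p ∈ U) (hb : RayContinuous B P p.1 b)
    (hbi : SumIntegrable B P p.1 (fun γ t => (‖γ‖ : ℂ) * b γ t))
    (h : Integrable (doublePull B P p.1 a b) ((rayMeasure m).prod (rayMeasure m))) :
    SumIntegrable B P p.1
      (fun γ t => a γ t * sumInt B P p.1 (fun γ' t' => kernel B γ γ' t t' * b γ' t')) ∧
    sumInt B P p.1
      (fun γ t => a γ t * sumInt B P p.1 (fun γ' t' => kernel B γ γ' t t' * b γ' t')) =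
      ∫ x, doublePull B P p.1 a b x ∂(rayMeasure m).prod (rayMeasure m) := by
  have hz := hgen.nondegenerate hp
  have heq : (fun ω => ∫ ω', doublePull B P p.1 a b (ω, ω') ∂rayMeasure m) = pull B P p.1
      (fun γ t => a γ t * sumInt B P p.1 (fun γ' t' => kernel B γ γ' t t' * b γ' t')) := by
    funext ⟨γ, r⟩
    by_cases hact : B.index P γ ≠ 0 ∧ 0 < r
    · obtain ⟨hγ, hr⟩ := hact
      have hmem := hgen.mem_dom p hp γ hγ _ (rayPoint_mem (hz γ hγ) hr)
      simp_rw [doublePull_eq_mul]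
      rw [integral_const_mul, pull, sumInt_eq_integral (sumIntegrable_kernel_mul hgen hmem hb hbi),
        mul_assoc]
    · have h0 : rayWeight B P p.1 (γ, r) = 0 := by
        by_cases hr : 0 < r
        · have hγ : B.index P γ = 0 := by
            by_contra hγ
            exact hact ⟨hγ, hr⟩
          simp [rayWeight, hγ]
        · simp [rayWeight, hr]
      simp [doublePull, pull, h0]
  have hi : SumIntegrable B P p.1
      (fun γ t => a γ t * sumInt B P p.1 (fun γ' t' => kernel B γ γ' t t' * b γ' t')) := by
    rw [SumIntegrable, ← heq]
    exact h.integral_prod_left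
  refine ⟨hi, ?_⟩
  rw [sumInt_eq_integral hi, ← heq, integral_prod _ h]

theorem integrable_doublePull_swap
    (h : Integrable (doublePull B P p.1 a b) ((rayMeasure m).prod (rayMeasure m))) :
    Integrable (doublePull B P p.1 b a) ((rayMeasure m).prod (rayMeasure m)) :=
  h.swap.congr (Eventually.of_forall fun x => (doublePull_swap p.1 x).symm)

/-- Fubini's theorem, with the symmetry of the kernel: `∑∫ a ∑∫ K b = ∑∫ b ∑∫ K a`. -/
theorem sumInt_mul_sumInt_comm (hgen : IsGeneric B P U) (hp : p ∈ U)
    (ha : RayContinuous B P p.1 a) (hb : RayContinuous B P p.1 b)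
    (hai : SumIntegrable B P p.1 (fun γ t => (‖γ‖ : ℂ) * a γ t))
    (hbi : SumIntegrable B P p.1 (fun γ t => (‖γ‖ : ℂ) * b γ t))
    (h : Integrable (doublePull B P p.1 a b) ((rayMeasure m).prod (rayMeasure m))) :
    sumInt B P p.1
      (fun γ t => a γ t * sumInt B P p.1 (fun γ' t' => kernel B γ γ' t t' * b γ' t')) =
    sumInt B P p.1
      (fun γ t => b γ t * sumInt B P p.1 (fun γ' t' => kernel B γ γ' t t' * a γ' t')) := by
  rw [(sumInt_mul_sumInt hgen hp hb hbi h).2,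
    (sumInt_mul_sumInt hgen hp ha hai (integrable_doublePull_swap h)).2, ← integral_prod_swap]
  exact integral_congr_ae (Eventually.of_forall fun x => (doublePull_swap p.1 x).symm)

/-- The iterated sums and integrals in the definition of the Plebański potential. -/
theorem tsum_tsum_rayIntegral (hz : Nondegenerate B P p.1)
    (h : Integrable (doublePull B P p.1 a b) ((rayMeasure m).prod (rayMeasure m))) :
    ∑' γ, ∑' γ', B.index P γ * B.index P γ' *
        rayIntegral γ p.1 (fun t => 1 / t *
          rayIntegral γ' p.1 (fun t' => 1 / t' * ((B.pair γ γ' : ℂ) / (t - t')) *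
            a γ t * b γ' t')) =
      -(2 * Real.pi * Complex.I) *
        ∫ x, doublePull B P p.1 a b x ∂(rayMeasure m).prod (rayMeasure m) := by
  rw [integral_eq_tsum_tsum h, ← tsum_mul_left]
  refine tsum_congr fun γ => ?_
  rw [← tsum_mul_left]
  refine tsum_congr fun γ' => ?_
  by_cases hγ : B.index P γ = 0
  · simp [hγ, doublePull, pull, rayWeight]
  by_cases hγ' : B.index P γ' = 0
  · simp [hγ', doublePull, pull, rayWeight]
  rw [rayIntegral, ← integral_const_mul, ← integral_const_mul]
  refine setIntegral_congr_fun measurableSet_Ioi fun r hr => ?_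
  have h0 := rayPoint_ne_zero (hz γ hγ) hr
  simp only [rayPoint] at h0
  simp only [rayIntegral]
  rw [← integral_const_mul, ← integral_const_mul, ← integral_mul_const, ← integral_const_mul]
  refine setIntegral_congr_fun measurableSet_Ioi fun r' hr' => ?_
  have h0' := rayPoint_ne_zero (hz γ' hγ') hr'
  simp only [rayPoint] at h0'
  simp only [doublePull, pull, rayWeight, Set.mem_Ioi.1 hr, Set.mem_Ioi.1 hr', if_true, rayPoint,
    kernel]
  set t := (r : ℂ) * (Complex.I * lin γ p.1)
  set t' := (r' : ℂ) * (Complex.I * lin γ' p.1)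
  have hpi : (2 * Real.pi * Complex.I : ℂ) ≠ 0 := Complex.two_pi_I_ne_zero
  rw [← neg_sub t t', div_neg]
  set D := t - t'
  rw [div_eq_mul_inv _ D, div_eq_mul_inv _ D]
  generalize D⁻¹ = d
  generalize hπ : (2 * Real.pi * Complex.I : ℂ) = π' at *
  field_simp

end Double

/-! ### First derivatives of the Plebański potential -/

section Plebanski

variable {m : ℕ} {B : BPSData m} {P : Presentation} {U : Set (Point m)}
  {X : Charge m → ℂ → Point m → ℂ}

theorem absSumInt_li₁_ne_top (hconv : IsConvergent B P X U) {p : Point m} (hp : p ∈ U) :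
    absSumInt B P p.1 (fun γ t => ‖γ‖ₑ * (1 + ‖1 / t‖ₑ) * ‖P.li₁ (X γ t p)‖ₑ) ≠ ⊤ := by
  obtain ⟨C, hC, hev⟩ := hconv.single₁ p hp
  exact ne_top_of_le_ne_top hC hev.self_of_nhds

theorem sumIntegrable_norm_li₁ (hgen : IsGeneric B P U) (hX : IsSolution B P U X)
    (hconv : IsConvergent B P X U) {p : Point m} (hp : p ∈ U) :
    SumIntegrable B P p.1 (fun γ t => (‖γ‖ : ℂ) * P.li₁ (X γ t p)) := by
  refine sumIntegrable_norm_mul hgen hp (rayContinuous_li₁ hgen hX hp)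
    (ne_top_of_le_ne_top (absSumInt_li₁_ne_top hconv hp) ?_)
  refine absSumInt_mono (hgen.nondegenerate hp) fun γ _ t _ => ?_
  exact mul_le_mul_left (le_mul_of_one_le_right' le_self_add) _

theorem exists_source_bound (v : Point m) :
    ∃ C : ℝ, 0 ≤ C ∧ ∀ (γ : Charge m) t, ‖source v γ t‖ ≤ C * (‖γ‖ * (1 + ‖1 / t‖)) := by
  set A := ∑ a, ‖v.1 a‖
  set D := ∑ a, ‖v.2 a‖
  have hA : 0 ≤ A := by positivity
  have hD : 0 ≤ D := by positivity
  refine ⟨2 * Real.pi * (A + D), by positivity, fun γ t => ?_⟩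
  have hpi : ‖(2 * Real.pi * Complex.I : ℂ)‖ = 2 * Real.pi := by
    simp [abs_of_pos Real.pi_pos]
  rw [source, norm_mul, hpi, mul_assoc (2 * Real.pi)]
  refine mul_le_mul_of_nonneg_left ?_ (by positivity)
  have h1 := norm_lin_le γ v.1
  have h2 := norm_lin_le γ v.2
  calc ‖lin γ v.2 - lin γ v.1 / t‖ ≤ ‖lin γ v.2‖ + ‖lin γ v.1‖ * ‖1 / t‖ := by
        rw [div_eq_mul_one_div (lin γ v.1), ← norm_mul]
        exact norm_sub_le _ _
    _ ≤ ‖γ‖ * D + ‖γ‖ * A * ‖1 / t‖ := by gcongr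
    _ ≤ (A + D) * (‖γ‖ * (1 + ‖1 / t‖)) := by
        have h3 : 0 ≤ ‖γ‖ * A := by positivity
        have h4 : 0 ≤ ‖γ‖ * D * ‖1 / t‖ := by positivity
        nlinarith

theorem continuousOn_source {z : Fin m → ℂ} (v : Point m) (γ : Charge m) :
    ContinuousOn (source v γ) (ray γ z) := by
  refine continuousOn_const.mul (continuousOn_const.sub (continuousOn_const.div continuousOn_id
    fun t ht => ?_))
  exact ne_zero_of_mem_ray ht

theorem analyticAt_source {q : Point m} (v : Point m) (γ : Charge m) {t : ℂ} (ht : t ≠ 0) :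
    AnalyticAt ℂ (fun x : ℂ × Point m => source v γ x.1) (t, q) :=
  analyticAt_const.mul (analyticAt_const.sub (analyticAt_const.div analyticAt_fst ht))

theorem enorm_li₁_source_le {C : ℝ} {v : Point m}
    (hC : 0 ≤ C ∧ ∀ (γ : Charge m) t, ‖source v γ t‖ ≤ C * (‖γ‖ * (1 + ‖1 / t‖)))
    (γ : Charge m) (t x : ℂ) :
    ‖x * source v γ t‖ₑ ≤ ENNReal.ofReal C * (‖γ‖ₑ * (1 + ‖1 / t‖ₑ) * ‖x‖ₑ) := by
  rw [enorm_mul, mul_comm, ← mul_assoc]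
  refine mul_le_mul_left ?_ _
  have h1 : (1 : ℝ≥0∞) + ‖1 / t‖ₑ = ENNReal.ofReal (1 + ‖1 / t‖) := by
    rw [ENNReal.ofReal_add zero_le_one (norm_nonneg _), ENNReal.ofReal_one, ofReal_norm]
  rw [h1, ← ofReal_norm, ← ofReal_norm, ← ENNReal.ofReal_mul (norm_nonneg _),
    ← ENNReal.ofReal_mul hC.1]
  exact ENNReal.ofReal_le_ofReal (hC.2 γ t)

theorem rayContinuous_li₁_source (hgen : IsGeneric B P U) (hX : IsSolution B P U X) {p : Point m}
    (hp : p ∈ U) (v : Point m) :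
    RayContinuous B P p.1 (fun γ t => P.li₁ (X γ t p) * source v γ t) := fun γ hγ =>
  (rayContinuous_li₁ hgen hX hp γ hγ).mul (continuousOn_source v γ)

theorem absSumInt_li₁_source_le (hgen : IsGeneric B P U) (v : Point m) :
    ∃ C : ℝ≥0∞, C ≠ ⊤ ∧ ∀ p ∈ U,
      absSumInt B P p.1 (fun γ t => ‖P.li₁ (X γ t p) * source v γ t‖ₑ) ≤
      C * absSumInt B P p.1 (fun γ t => ‖γ‖ₑ * (1 + ‖1 / t‖ₑ) * ‖P.li₁ (X γ t p)‖ₑ) := by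
  obtain ⟨C, hC⟩ := exists_source_bound v
  refine ⟨ENNReal.ofReal C, ENNReal.ofReal_ne_top, fun p hp => ?_⟩
  rw [← absSumInt_const_mul ENNReal.ofReal_ne_top]
  exact absSumInt_mono (hgen.nondegenerate hp) fun γ _ t _ => enorm_li₁_source_le hC γ t _

theorem sumIntegrable_li₁_source (hgen : IsGeneric B P U) (hX : IsSolution B P U X)
    (hconv : IsConvergent B P X U) {p : Point m} (hp : p ∈ U) (v : Point m) :
    SumIntegrable B P p.1 (fun γ t => P.li₁ (X γ t p) * source v γ t) := by
  obtain ⟨C, hC, hle⟩ := absSumInt_li₁_source_le (B := B) (P := P) (X := X) hgen v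
  exact sumIntegrable_of_absSumInt (hgen.nondegenerate hp) (rayContinuous_li₁_source hgen hX hp v)
    (ne_top_of_le_ne_top (ENNReal.mul_ne_top hC (absSumInt_li₁_ne_top hconv hp)) (hle p hp))

/-- The integrand of the Plebański potential as a single sum-integral: the double sum-integral is
`∑∫ Li₁(X) log(X / Xsf)`, up to a factor. -/
def plebanskiDensity (P : Presentation) (B : BPSData m) (X : Charge m → ℂ → Point m → ℂ)
    (γ : Charge m) (t : ℂ) (p : Point m) : ℂ :=
  P.li₂ (X γ t p) - 1 / 2 * (P.li₁ (X γ t p) * logCorrection B P X γ t p)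

theorem integrable_doublePull_li₁ (hgen : IsGeneric B P U) (hX : IsSolution B P U X)
    (hconv : IsConvergent B P X U) {p : Point m} (hp : p ∈ U) :
    Integrable (doublePull B P p.1 (fun γ t => P.li₁ (X γ t p)) (fun γ t => P.li₁ (X γ t p)))
      ((rayMeasure m).prod (rayMeasure m)) := by
  obtain ⟨C, hC, hev⟩ := hconv.double p hp
  exact integrable_doublePull hgen hp (rayContinuous_li₁ hgen hX hp) (rayContinuous_li₁ hgen hX hp)
    (ne_top_of_le_ne_top hC hev.self_of_nhds)

theorem integrable_doublePull_li₀_dlog (hgen : IsGeneric B P U) (hX : IsSolution B P U X)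
    (hconv : IsConvergent B P X U) {p : Point m} (hp : p ∈ U) (v : Point m) :
    Integrable (doublePull B P p.1 (fun γ t => P.li₁ (X γ t p))
      (fun γ t => P.li₀ (X γ t p) * dlog X v p γ t)) ((rayMeasure m).prod (rayMeasure m)) :=
  integrable_doublePull hgen hp (rayContinuous_li₁ hgen hX hp) (rayContinuous_li₀_dlog hgen hX hp v)
    (hconv.double_deriv p hp v)

theorem rayContinuous_li₂ (hgen : IsGeneric B P U) (hX : IsSolution B P U X) {p : Point m}
    (hp : p ∈ U) : RayContinuous B P p.1 (fun γ t => P.li₂ (X γ t p)) := fun _ hγ _ ht =>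
  (continuousAt_ray_slice (hX.analyticAt_li₂ (onRay hgen hX hp hγ ht))).continuousWithinAt

theorem sumIntegrable_li₂ (hgen : IsGeneric B P U) (hX : IsSolution B P U X)
    (hconv : IsConvergent B P X U) {p : Point m} (hp : p ∈ U) :
    SumIntegrable B P p.1 (fun γ t => P.li₂ (X γ t p)) := by
  obtain ⟨C, hC, hev⟩ := hconv.single₂ p hp
  exact sumIntegrable_of_absSumInt (hgen.nondegenerate hp) (rayContinuous_li₂ hgen hX hp)
    (ne_top_of_le_ne_top hC hev.self_of_nhds)

theorem plebanski_eq (hgen : IsGeneric B P U) (hX : IsSolution B P U X)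
    (hconv : IsConvergent B P X U) {p : Point m} (hp : p ∈ U) :
    plebanski B P X p = 1 / (2 * Real.pi * Complex.I) *
      sumInt B P p.1 (fun γ t => plebanskiDensity P B X γ t p) := by
  have hD := integrable_doublePull_li₁ hgen hX hconv hp
  have h1 := tsum_tsum_rayIntegral (hgen.nondegenerate hp) hD
  obtain ⟨h2, h3⟩ := sumInt_mul_sumInt hgen hp (rayContinuous_li₁ hgen hX hp)
    (sumIntegrable_norm_li₁ hgen hX hconv hp) hD
  rw [plebanski, h1, ← h3]
  simp only [plebanskiDensity, logCorrection]
  rw [sumInt_sub (sumIntegrable_li₂ hgen hX hconv hp) (h2.const_mul (1 / 2)), sumInt_const_mul]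
  have h4 : ∑' γ, B.index P γ * rayIntegral γ p.1 (fun t => 1 / t ^ 2 * P.li₂ (X γ t p)) =
      sumInt B P p.1 (fun γ t => P.li₂ (X γ t p)) := by
    rw [sumInt]
    simp only [div_eq_mul_inv, one_mul, mul_comm]
  rw [h4]
  have hpi : (2 * Real.pi * Complex.I : ℂ) ≠ 0 := Complex.two_pi_I_ne_zero
  generalize (2 * Real.pi * Complex.I : ℂ) = π' at *
  field_simp
  ring

theorem analyticAt_li₁_logCorrection (hgen : IsGeneric B P U) (hX : IsSolution B P U X)
    (hconv : IsConvergent B P X U) {γ : Charge m} {t : ℂ} {p : Point m}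
    (h : OnRay B P U X γ t p) :
    AnalyticAt ℂ (fun q : ℂ × Point m => P.li₁ (X γ q.1 q.2) * logCorrection B P X γ q.1 q.2)
      (t, p) :=
  (hX.analyticAt_li₁ h).mul (analyticAt_logCorrection hgen hX hconv h.mem_dom)

theorem absSumInt_plebanskiDensity_le (hgen : IsGeneric B P U) (hX : IsSolution B P U X)
    (hconv : IsConvergent B P X U) {p : Point m} (hp : p ∈ U) :
    absSumInt B P p.1 (fun γ t => ‖plebanskiDensity P B X γ t p‖ₑ) ≤
      absSumInt B P p.1 (fun γ t => ‖P.li₂ (X γ t p)‖ₑ) +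
      absSumInt B P p.1 (fun γ t => absSumInt B P p.1 (fun γ' t' =>
      ‖kernel B γ γ' t t' * P.li₁ (X γ t p) * P.li₁ (X γ' t' p)‖ₑ)) := by
  have hz := hgen.nondegenerate hp
  have hc1 := rayContinuous_li₂ hgen hX hp
  have hc2 : RayContinuous B P p.1
      (fun γ t => P.li₁ (X γ t p) * logCorrection B P X γ t p) := fun γ hγ t ht =>
    (continuousAt_ray_slice (analyticAt_li₁_logCorrection hgen hX hconv
      (onRay hgen hX hp hγ ht))).continuousWithinAt
  have hc : RayContinuous B P p.1 (fun γ t => plebanskiDensity P B X γ t p) := fun γ hγ =>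
    (hc1 γ hγ).sub (continuousOn_const.mul (hc2 γ hγ))
  have h1 : absSumInt B P p.1 (fun γ t => ‖P.li₁ (X γ t p) * logCorrection B P X γ t p‖ₑ) ≤
      absSumInt B P p.1 (fun γ t => absSumInt B P p.1 (fun γ' t' =>
        ‖kernel B γ γ' t t' * P.li₁ (X γ t p) * P.li₁ (X γ' t' p)‖ₑ)) := by
    refine absSumInt_mono hz fun γ _ t _ => ?_
    rw [enorm_mul]
    refine (mul_le_mul_right (enorm_sumInt_le _) _).trans_eq ?_
    rw [← absSumInt_const_mul enorm_ne_top]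
    congr 1
    funext γ' t'
    rw [← enorm_mul]
    congr 1
    ring
  refine le_trans ?_ (add_le_add_right h1 _)
  rw [absSumInt_enorm_eq hz hc, absSumInt_enorm_eq hz hc1, absSumInt_enorm_eq hz hc2,
    ← lintegral_add_left (measurable_pull hz hc1).enorm]
  refine lintegral_mono fun ω => ?_
  have h2 : pull B P p.1 (fun γ t => plebanskiDensity P B X γ t p) ω =
      pull B P p.1 (fun γ t => P.li₂ (X γ t p)) ω + -(1 / 2) *
        pull B P p.1 (fun γ t => P.li₁ (X γ t p) * logCorrection B P X γ t p) ω := by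
    simp only [pull, plebanskiDensity]
    ring
  rw [h2]
  refine (enorm_add_le _ _).trans (add_le_add_right ?_ _)
  rw [enorm_mul]
  refine mul_le_of_le_one_left' ?_
  rw [← ofReal_norm, norm_neg]
  norm_num

/-- The derivative of the density, with `Li₁(X) ∂_v log X` rewritten by the linearized TBA
equations. The last two summands have opposite sum-integrals, by the symmetry of the kernel. -/
theorem fderiv_plebanskiDensity (hgen : IsGeneric B P U) (hX : IsSolution B P U X)
    (hconv : IsConvergent B P X U) {γ : Charge m} {t : ℂ} {p : Point m}
    (h : OnRay B P U X γ t p) (v : Point m) :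
    fderiv ℂ (plebanskiDensity P B X γ t) p v =
      P.li₁ (X γ t p) * source v γ t +
        (1 / 2 * (P.li₁ (X γ t p) * linOp B P X p (dlog X v p) γ t) -
        1 / 2 * (P.li₀ (X γ t p) * dlog X v p γ t * logCorrection B P X γ t p)) := by
  have h2 : DifferentiableAt ℂ (fun p => P.li₂ (X γ t p)) p :=
    DifferentiableAt.comp p
      (P.hasDerivAt_li₂ h.admissible (hX.ne_zero h.mem_dom)).differentiableAt
      (hX.differentiableAt h.mem_dom)
  have h1 := hX.differentiableAt_li₁ h
  have hE : DifferentiableAt ℂ (logCorrection B P X γ t) p :=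
    DifferentiableAt.comp p (f := fun p' => (t, p'))
      (analyticAt_logCorrection hgen hX hconv h.mem_dom).differentiableAt (by fun_prop)
  have hd : HasFDerivAt (plebanskiDensity P B X γ t) _ p :=
    h2.hasFDerivAt.sub ((h1.hasFDerivAt.mul hE.hasFDerivAt).const_mul (1 / 2))
  rw [hd.fderiv]
  have e1 := pd_logCorrection hgen hX hconv h.mem_dom v
  rw [pd] at e1
  have e2 := dlog_eq_source_add hgen hX hconv h.mem_dom v
  simp only [sub_apply, smul_apply, add_apply,
    smul_eq_mul, hX.fderiv_li₂ h, hX.fderiv_li₁ h, e1]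
  linear_combination P.li₁ (X γ t p) * e2

/-- `W` is differentiable, and `∂_v W = (2πi)⁻¹ ∑∫ Li₁(X) S_v`: the terms that contain derivatives
of `X` cancel by the symmetry of the kernel. -/
theorem pd_plebanski (hU : IsOpen U) (hgen : IsGeneric B P U) (hX : IsSolution B P U X)
    (hconv : IsConvergent B P X U) :
    DifferentiableOn ℂ (plebanski B P X) U ∧ ∀ p ∈ U, ∀ v, pd v (plebanski B P X) p =
      1 / (2 * Real.pi * Complex.I) *
        sumInt B P p.1 (fun γ t => P.li₁ (X γ t p) * source v γ t) := by
  obtain ⟨hC1, hder⟩ := sumInt_contDiffOn_and_fderiv (B := B) (P := P) (V := U)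
    (ζ := ContinuousLinearMap.fst ℂ (Fin m → ℂ) (Fin m → ℂ))
    (g := fun γ t p => plebanskiDensity P B X γ t p) hU (fun p hp => hgen.nondegenerate hp)
    (fun p hp γ hγ t ht => (hX.analyticAt_li₂ (onRay hgen hX hp hγ ht)).sub
      (analyticAt_const.mul
        (analyticAt_li₁_logCorrection hgen hX hconv (onRay hgen hX hp hγ ht)))) (by
      intro p hp
      obtain ⟨C, hC, hCev⟩ := hconv.single₂ p hp
      obtain ⟨D, hD, hDev⟩ := hconv.double p hp
      refine ⟨C + D, ENNReal.add_ne_top.2 ⟨hC, hD⟩, ?_⟩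
      filter_upwards [hCev, hDev, hU.mem_nhds hp] with p' h1 h2 h3
      exact (absSumInt_plebanskiDensity_le hgen hX hconv h3).trans (add_le_add h1 h2))
  have heq : ∀ p ∈ U, plebanski B P X p = 1 / (2 * Real.pi * Complex.I) *
      sumInt B P p.1 (fun γ t => plebanskiDensity P B X γ t p) := fun p hp =>
    plebanski_eq hgen hX hconv hp
  have hdiff : DifferentiableOn ℂ
      (fun p => sumInt B P p.1 (fun γ t => plebanskiDensity P B X γ t p)) U :=
    hC1.differentiableOn one_ne_zero
  refine ⟨(hdiff.const_mul _).congr heq, fun p hp v => ?_⟩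
  have hz := hgen.nondegenerate hp
  have hfd : fderiv ℂ (plebanski B P X) p = fderiv ℂ (fun p => 1 / (2 * Real.pi * Complex.I) *
      sumInt B P p.1 (fun γ t => plebanskiDensity P B X γ t p)) p :=
    Filter.EventuallyEq.fderiv_eq (eventually_of_mem (hU.mem_nhds hp) heq)
  rw [pd, hfd, fderiv_const_mul (hdiff.differentiableAt (hU.mem_nhds hp)),
    smul_apply, smul_eq_mul]
  congr 1
  have hc1 := rayContinuous_li₁ hgen hX hp
  have hc0 := rayContinuous_li₀_dlog hgen hX hp v
  have hn1 := sumIntegrable_norm_li₁ hgen hX hconv hp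
  have hn0 := sumIntegrable_norm_li₀_dlog hgen hX hconv hp v
  have hD := integrable_doublePull_li₀_dlog hgen hX hconv hp v
  have hi1 := (sumInt_mul_sumInt hgen hp hc0 hn0 hD).1
  have hi2 := (sumInt_mul_sumInt hgen hp hc1 hn1 (integrable_doublePull_swap hD)).1
  have hcomm := sumInt_mul_sumInt_comm hgen hp hc1 hc0 hn1 hn0 hD
  have hS := sumIntegrable_li₁_source hgen hX hconv hp v
  have hform : ∀ γ, B.index P γ ≠ 0 → ∀ t ∈ ray γ p.1,
      P.li₁ (X γ t p) * source v γ t + (1 / 2 * (P.li₁ (X γ t p) * sumInt B P p.1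
        (fun γ' t' => kernel B γ γ' t t' * (P.li₀ (X γ' t' p) * dlog X v p γ' t'))) -
        1 / 2 * (P.li₀ (X γ t p) * dlog X v p γ t * sumInt B P p.1
        (fun γ' t' => kernel B γ γ' t t' * P.li₁ (X γ' t' p)))) =
      fderiv ℂ (plebanskiDensity P B X γ t) p v := by
    intro γ hγ t ht
    rw [fderiv_plebanskiDensity hgen hX hconv (onRay hgen hX hp hγ ht) v]
    simp only [linOp, logCorrection, mul_assoc]
  have hdiff2 := (hi1.const_mul (1 / 2)).sub (hi2.const_mul (1 / 2))
  have hsum := hS.add hdiff2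
  refine (hder p hp v (hsum.congr hz hform)).trans ?_
  refine (sumInt_congr hz hform).symm.trans ?_
  rw [sumInt_add hS hdiff2, sumInt_sub (hi1.const_mul _) (hi2.const_mul _), sumInt_const_mul,
    sumInt_const_mul, hcomm, sub_self, add_zero]

/-! ### Second derivatives of the Plebański potential -/

/-- The first derivatives of `W`, up to a factor, may again be differentiated under the
sum-integral. -/
theorem sumInt_li₁_source_contDiffOn_and_fderiv (hU : IsOpen U) (hgen : IsGeneric B P U)
    (hX : IsSolution B P U X) (hconv : IsConvergent B P X U) (w : Point m) :
    ContDiffOn ℂ 1 (fun p => sumInt B P p.1 (fun γ t => P.li₁ (X γ t p) * source w γ t)) U ∧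
    ∀ p ∈ U, ∀ v, SumIntegrable B P p.1
        (fun γ t => P.li₀ (X γ t p) * dlog X v p γ t * source w γ t) →
      fderiv ℂ (fun p => sumInt B P p.1 (fun γ t => P.li₁ (X γ t p) * source w γ t)) p v =
        sumInt B P p.1 (fun γ t => P.li₀ (X γ t p) * dlog X v p γ t * source w γ t) := by
  obtain ⟨hC1, hder⟩ := sumInt_contDiffOn_and_fderiv (B := B) (P := P) (V := U)
    (ζ := ContinuousLinearMap.fst ℂ (Fin m → ℂ) (Fin m → ℂ))
    (g := fun γ t p => P.li₁ (X γ t p) * source w γ t) hU (fun p hp => hgen.nondegenerate hp)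
    (fun p hp γ hγ t ht => (hX.analyticAt_li₁ (onRay hgen hX hp hγ ht)).mul
      (analyticAt_source w γ (ne_zero_of_mem_ray ht))) (by
      intro p hp
      obtain ⟨A, hA, hle⟩ := absSumInt_li₁_source_le (B := B) (P := P) (X := X) hgen w
      obtain ⟨C, hC, hCev⟩ := hconv.single₁ p hp
      refine ⟨A * C, ENNReal.mul_ne_top hA hC, ?_⟩
      filter_upwards [hCev, hU.mem_nhds hp] with p' h1 h2
      exact (hle p' h2).trans (mul_le_mul_right h1 _))
  refine ⟨hC1, fun p hp v hi => ?_⟩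
  have hform : ∀ γ, B.index P γ ≠ 0 → ∀ t ∈ ray γ p.1,
      P.li₀ (X γ t p) * dlog X v p γ t * source w γ t =
      fderiv ℂ (fun p => P.li₁ (X γ t p) * source w γ t) p v := by
    intro γ hγ t ht
    have hray := onRay hgen hX hp hγ ht
    rw [fderiv_mul_const (hX.differentiableAt_li₁ hray), smul_apply,
      hX.fderiv_li₁ hray, smul_eq_mul, mul_comm]
  have hz := hgen.nondegenerate hp
  exact (hder p hp v (hi.congr hz hform)).trans (sumInt_congr hz hform).symm

theorem contDiffOn_plebanski (hU : IsOpen U) (hgen : IsGeneric B P U) (hX : IsSolution B P U X)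
    (hconv : IsConvergent B P X U) : ContDiffOn ℂ 2 (plebanski B P X) U := by
  obtain ⟨hd, hpd⟩ := pd_plebanski hU hgen hX hconv
  rw [show (2 : WithTop ℕ∞) = 1 + 1 from one_add_one_eq_two.symm,
    contDiffOn_succ_iff_fderiv_of_isOpen hU]
  refine ⟨hd, by simp, ?_⟩
  rw [contDiffOn_clm_apply]
  intro v
  refine ContDiffOn.congr ?_ fun p hp => hpd p hp v
  exact contDiffOn_const.mul (sumInt_li₁_source_contDiffOn_and_fderiv hU hgen hX hconv v).1

theorem pd_pd_plebanski (hU : IsOpen U) (hgen : IsGeneric B P U) (hX : IsSolution B P U X)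
    (hconv : IsConvergent B P X U) {p : Point m} (hp : p ∈ U) (v w : Point m)
    (hi : SumIntegrable B P p.1 (fun γ t => P.li₀ (X γ t p) * dlog X v p γ t * source w γ t)) :
    pd v (pd w (plebanski B P X)) p = 1 / (2 * Real.pi * Complex.I) *
      sumInt B P p.1 (fun γ t => P.li₀ (X γ t p) * dlog X v p γ t * source w γ t) := by
  obtain ⟨hC1, hder⟩ := sumInt_li₁_source_contDiffOn_and_fderiv hU hgen hX hconv w
  have hfd : fderiv ℂ (pd w (plebanski B P X)) p = fderiv ℂ (fun p =>
      1 / (2 * Real.pi * Complex.I) *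
        sumInt B P p.1 (fun γ t => P.li₁ (X γ t p) * source w γ t)) p :=
    Filter.EventuallyEq.fderiv_eq (eventually_of_mem (hU.mem_nhds hp) fun p' hp' =>
      (pd_plebanski hU hgen hX hconv).2 p' hp' w)
  rw [pd, hfd, fderiv_const_mul
    ((hC1.differentiableOn one_ne_zero).differentiableAt (hU.mem_nhds hp)),
    smul_apply, smul_eq_mul, hder p hp v hi]

theorem pd_comm {W : Point m → ℂ} (hU : IsOpen U) (hW : ContDiffOn ℂ 2 W U) {p : Point m}
    (hp : p ∈ U) (v w : Point m) : pd v (pd w W) p = pd w (pd v W) p := by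
  have hat : ContDiffAt ℂ 2 W p := hW.contDiffAt (hU.mem_nhds hp)
  have hsymm : IsSymmSndFDerivAt ℂ W p := hat.isSymmSndFDerivAt (by simp)
  have hd : DifferentiableAt ℂ (fderiv ℂ W) p :=
    (hat.fderiv_right (m := 1) (by norm_num)).differentiableAt one_ne_zero
  have h : ∀ u, fderiv ℂ (fun p => fderiv ℂ W p u) p = (fderiv ℂ (fderiv ℂ W) p).flip u := by
    intro u
    refine ContinuousLinearMap.ext fun x => ?_
    rw [fderiv_clm_apply hd (differentiableAt_const u)]
    simp
  change fderiv ℂ (fun p => fderiv ℂ W p w) p v = fderiv ℂ (fun p => fderiv ℂ W p v) p w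
  rw [h, h]
  exact hsymm v w

end Plebanski

/-! ### The Neumann series of the linearized TBA equations -/

section Neumann

variable {m : ℕ} {B : BPSData m} {P : Presentation} {U : Set (Point m)}
  {X : Charge m → ℂ → Point m → ℂ} {p : Point m}

/-- Functions to which the linearized TBA operator can be applied: they are continuous on the rays,
and their sum-integrals against `‖γ‖ Li₀(X)` converge absolutely. -/
structure LinOpAdmissible (B : BPSData m) (P : Presentation) (X : Charge m → ℂ → Point m → ℂ)
    (p : Point m) (h : Charge m → ℂ → ℂ) : Prop where
  cont : RayContinuous B P p.1 h
  int : SumIntegrable B P p.1 (fun γ t => (‖γ‖ : ℂ) * (P.li₀ (X γ t p) * h γ t))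

/-- The linear functionals `h ↦ ∑∫ q_b Li₀(X) h`, whose values on `∂_v log X` are the second
derivatives `∂_v ∂_{θ^b} W`. -/
def moment (B : BPSData m) (P : Presentation) (X : Charge m → ℂ → Point m → ℂ) (p : Point m)
    (b : Fin m) (h : Charge m → ℂ → ℂ) : ℂ :=
  sumInt B P p.1 (fun γ t => (γ b : ℂ) * P.li₀ (X γ t p) * h γ t)

variable {h : Charge m → ℂ → ℂ}

theorem moment_const_mul (b : Fin m) (c : ℂ) (h : Charge m → ℂ → ℂ) :
    moment B P X p b (fun γ t => c * h γ t) = c * moment B P X p b h := by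
  rw [moment, moment, ← sumInt_const_mul c]
  congr 1
  funext γ t
  ring

theorem LinOpAdmissible.const_mul (hh : LinOpAdmissible B P X p h) (c : ℂ) :
    LinOpAdmissible B P X p (fun γ t => c * h γ t) where
  cont γ hγ := continuousOn_const.mul (hh.cont γ hγ)
  int := (SumIntegrable.const_mul c hh.int).congr_fun fun γ t => by ring

theorem LinOpAdmissible.finset_sum {ι : Type*} (s : Finset ι) {h : ι → Charge m → ℂ → ℂ}
    (hh : ∀ i ∈ s, LinOpAdmissible B P X p (h i)) :
    LinOpAdmissible B P X p (fun γ t => ∑ i ∈ s, h i γ t) where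
  cont γ hγ := continuousOn_finsetSum s fun i hi => (hh i hi).cont γ hγ
  int := (SumIntegrable.finset_sum s fun i hi => (hh i hi).int).congr_fun fun γ t => by
    simp only [Finset.mul_sum]

theorem linOpAdmissible_dlog (hgen : IsGeneric B P U) (hX : IsSolution B P U X)
    (hconv : IsConvergent B P X U) (hp : p ∈ U) (v : Point m) :
    LinOpAdmissible B P X p (dlog X v p) :=
  ⟨rayContinuous_dlog hgen hX hp v, sumIntegrable_norm_li₀_dlog hgen hX hconv hp v⟩

theorem LinOpAdmissible.kernel_int (hgen : IsGeneric B P U) (hX : IsSolution B P U X)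
    (hh : LinOpAdmissible B P X p h) {γ : Charge m} {t : ℂ}
    (ht : (t, p) ∈ dom B P U γ) :
    SumIntegrable B P p.1 (fun γ' t' => kernel B γ γ' t t' * P.li₀ (X γ' t' p) * h γ' t') :=
  (sumIntegrable_kernel_mul hgen ht (f := fun γ' t' => P.li₀ (X γ' t' p) * h γ' t')
    (fun γ' hγ' => (rayContinuous_li₀ hgen hX (dom_spec ht).2.1 γ' hγ').mul (hh.cont γ' hγ'))
    hh.int).congr_fun fun γ' t' => by ring

theorem linOp_finset_sum (hgen : IsGeneric B P U) (hX : IsSolution B P U X)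
    {ι : Type*} (s : Finset ι) {h : ι → Charge m → ℂ → ℂ}
    (hh : ∀ i ∈ s, LinOpAdmissible B P X p (h i)) {γ : Charge m} {t : ℂ}
    (ht : (t, p) ∈ dom B P U γ) :
    linOp B P X p (fun γ t => ∑ i ∈ s, h i γ t) γ t = ∑ i ∈ s, linOp B P X p (h i) γ t := by
  simp only [linOp, Finset.mul_sum]
  exact sumInt_finset_sum s fun i hi => (hh i hi).kernel_int hgen hX ht

theorem LinOpAdmissible.li₀_cont (hgen : IsGeneric B P U) (hX : IsSolution B P U X) (hp : p ∈ U)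
    (hh : LinOpAdmissible B P X p h) :
    RayContinuous B P p.1 (fun γ t => P.li₀ (X γ t p) * h γ t) := fun γ hγ =>
  (rayContinuous_li₀ hgen hX hp γ hγ).mul (hh.cont γ hγ)

theorem LinOpAdmissible.coe_int (hgen : IsGeneric B P U) (hX : IsSolution B P U X) (hp : p ∈ U)
    (hh : LinOpAdmissible B P X p h) (b : Fin m) :
    SumIntegrable B P p.1 (fun γ t => (γ b : ℂ) * P.li₀ (X γ t p) * h γ t) :=
  (sumIntegrable_coe_mul hgen hp (hh.li₀_cont hgen hX hp) hh.int b).congr_fun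
    fun γ t => by ring

theorem moment_finset_sum (hgen : IsGeneric B P U) (hX : IsSolution B P U X) (hp : p ∈ U)
    (b : Fin m) {ι : Type*} (s : Finset ι) {h : ι → Charge m → ℂ → ℂ}
    (hh : ∀ i ∈ s, LinOpAdmissible B P X p (h i)) :
    moment B P X p b (fun γ t => ∑ i ∈ s, h i γ t) = ∑ i ∈ s, moment B P X p b (h i) := by
  simp only [moment, Finset.mul_sum]
  exact sumInt_finset_sum s fun i hi => (hh i hi).coe_int hgen hX hp b

/-- The sum-integral of `⟨γ, ·⟩ Li₀(X) h` is the combination of the moments of `h` that the matrix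
of the pairing prescribes. -/
theorem sumIntegrable_pair_mul (hgen : IsGeneric B P U) (hX : IsSolution B P U X) (hp : p ∈ U)
    (hh : LinOpAdmissible B P X p h) (γ : Charge m) :
    SumIntegrable B P p.1 (fun γ' t' => (B.pair γ γ' : ℂ) * (P.li₀ (X γ' t' p) * h γ' t')) ∧
    sumInt B P p.1 (fun γ' t' => (B.pair γ γ' : ℂ) * (P.li₀ (X γ' t' p) * h γ' t')) =
      ∑ b, ∑ c, (γ b : ℂ) * B.omega b c * moment B P X p c h := by
  have heq : (fun (γ' : Charge m) t' => (B.pair γ γ' : ℂ) * (P.li₀ (X γ' t' p) * h γ' t')) =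
      fun γ' t' => ∑ b, ∑ c, (γ b : ℂ) * B.omega b c *
        ((γ' c : ℂ) * P.li₀ (X γ' t' p) * h γ' t') := by
    funext γ' t'
    rw [pair_cast]
    simp only [Finset.sum_mul]
    refine Finset.sum_congr rfl fun b _ => Finset.sum_congr rfl fun c _ => ?_
    ring
  have hi : ∀ b c, SumIntegrable B P p.1 (fun γ' t' => (γ b : ℂ) * B.omega b c *
      ((γ' c : ℂ) * P.li₀ (X γ' t' p) * h γ' t')) := fun b c =>
    (hh.coe_int hgen hX hp c).const_mul _
  have hi' : ∀ b, SumIntegrable B P p.1 (fun γ' t' => ∑ c, (γ b : ℂ) * B.omega b c *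
      ((γ' c : ℂ) * P.li₀ (X γ' t' p) * h γ' t')) := fun b =>
    SumIntegrable.finset_sum _ fun c _ => hi b c
  rw [heq]
  refine ⟨SumIntegrable.finset_sum _ fun b _ => hi' b, ?_⟩
  rw [sumInt_finset_sum _ fun b _ => hi' b]
  refine Finset.sum_congr rfl fun b _ => ?_
  rw [sumInt_finset_sum _ fun c _ => hi b c]
  exact Finset.sum_congr rfl fun c _ => sumInt_const_mul _ _

/-- The commutator of the linearized TBA operator with multiplication by `1 / t`: since
`K₀₁ / t₁ = K₀₁ / t₀ - ⟨γ₀, γ₁⟩ / 2πi`, it has finite rank. -/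
theorem linOp_one_div_mul (hgen : IsGeneric B P U) (hX : IsSolution B P U X) (hp : p ∈ U)
    (hh : LinOpAdmissible B P X p h) {γ : Charge m} {t : ℂ}
    (ht : (t, p) ∈ dom B P U γ) :
    SumIntegrable B P p.1
      (fun γ' t' => kernel B γ γ' t t' * P.li₀ (X γ' t' p) * (1 / t' * h γ' t')) ∧
    linOp B P X p (fun γ t => 1 / t * h γ t) γ t = 1 / t * linOp B P X p h γ t -
      1 / (2 * Real.pi * Complex.I) *
        ∑ b, ∑ c, (γ b : ℂ) * B.omega b c * moment B P X p c h := by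
  have hz := hgen.nondegenerate hp
  obtain ⟨ht0, -, hjump⟩ := dom_spec ht
  have hK := hh.kernel_int hgen hX ht
  obtain ⟨hp1, hp2⟩ := sumIntegrable_pair_mul hgen hX hp hh γ
  have hform : ∀ γ', B.index P γ' ≠ 0 → ∀ t' ∈ ray γ' p.1,
      1 / t * (kernel B γ γ' t t' * P.li₀ (X γ' t' p) * h γ' t') -
        1 / (2 * Real.pi * Complex.I) * ((B.pair γ γ' : ℂ) * (P.li₀ (X γ' t' p) * h γ' t')) =
      kernel B γ γ' t t' * P.li₀ (X γ' t' p) * (1 / t' * h γ' t') := by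
    intro γ' hγ' t' ht'
    have ht'0 : t' ≠ 0 := ne_zero_of_mem_ray ht'
    by_cases hp0 : B.pair γ γ' = 0
    · simp [kernel, hp0]
    have hne : t' - t ≠ 0 := by
      rw [sub_ne_zero]
      rintro rfl
      exact hjump γ' hγ' hp0 ht'
    have hpi : (2 * Real.pi * Complex.I : ℂ) ≠ 0 := Complex.two_pi_I_ne_zero
    simp only [kernel]
    generalize (2 * Real.pi * Complex.I : ℂ) = π' at *
    field_simp
    ring
  have hi := ((hK.const_mul (1 / t)).sub (hp1.const_mul (1 / (2 * Real.pi * Complex.I))))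
  refine ⟨hi.congr hz hform, ?_⟩
  rw [linOp, ← sumInt_congr hz hform, sumInt_sub (hK.const_mul _) (hp1.const_mul _),
    sumInt_const_mul, sumInt_const_mul, hp2, linOp]

/-- The image under the linearized TBA operator is continuous on the rays, by dominated
convergence. -/
theorem rayContinuous_linOp (hgen : IsGeneric B P U) (hX : IsSolution B P U X) (hp : p ∈ U)
    (hh : LinOpAdmissible B P X p h) :
    RayContinuous B P p.1 (linOp B P X p h) := by
  intro γ hγ t ht
  have hz := hgen.nondegenerate hp
  have hmem := hgen.mem_dom p hp γ hγ t ht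
  obtain ⟨C, hC0, hC⟩ := exists_kernel_bound hmem
  have hline : ContinuousAt (fun t' : ℂ => (t', p)) t := by fun_prop
  have hev : ∀ᶠ s in 𝓝 t, (s, p) ∈ dom B P U γ ∧ ∀ γ', B.index P γ' ≠ 0 → ∀ t' ∈ ray γ' p.1,
      ‖kernel B γ γ' s t'‖ ≤ C * ‖γ'‖ :=
    (hline.eventually ((isOpen_dom γ).mem_nhds hmem)).and (hline.eventually hC)
  have heq : (fun s => ∫ ω, pull B P p.1 (fun γ' t' =>
      kernel B γ γ' s t' * P.li₀ (X γ' t' p) * h γ' t') ω ∂rayMeasure m) =ᶠ[𝓝 t]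
      linOp B P X p h γ := by
    filter_upwards [hev] with s hs
    exact (sumInt_eq_integral (hh.kernel_int hgen hX hs.1)).symm
  refine ContinuousAt.continuousWithinAt (ContinuousAt.congr ?_ heq)
  refine continuousAt_of_dominated (bound := fun ω => C * ‖pull B P p.1 (fun γ t =>
    (‖γ‖ : ℂ) * (P.li₀ (X γ t p) * h γ t)) ω‖) ?_ ?_ (hh.int.norm.const_mul C) ?_
  · filter_upwards [hev] with s hs
    exact (hh.kernel_int hgen hX hs.1).aestronglyMeasurable
  · filter_upwards [hev] with s hs
    refine Eventually.of_forall fun ⟨γ', r⟩ => ?_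
    by_cases hγ' : B.index P γ' = 0
    · simp [pull_of_inactive hγ']
    by_cases hr : 0 < r
    · have := hs.2 γ' hγ' _ (rayPoint_mem (hz γ' hγ') hr)
      simp only [pull, norm_mul, Complex.norm_real, norm_norm]
      calc _ = ‖kernel B γ γ' s (rayPoint p.1 (γ', r))‖ * (‖rayWeight B P p.1 (γ', r)‖ *
            (‖P.li₀ (X γ' (rayPoint p.1 (γ', r)) p)‖ * ‖h γ' (rayPoint p.1 (γ', r))‖)) := by
            ring
        _ ≤ (C * ‖γ'‖) * (‖rayWeight B P p.1 (γ', r)‖ *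
            (‖P.li₀ (X γ' (rayPoint p.1 (γ', r)) p)‖ * ‖h γ' (rayPoint p.1 (γ', r))‖)) := by
            gcongr
        _ = _ := by ring
    · simp [pull_of_nonpos hr]
  · refine Eventually.of_forall fun ⟨γ', r⟩ => ?_
    by_cases hγ' : B.index P γ' = 0
    · simp only [pull_of_inactive hγ']
      exact continuousAt_const
    by_cases hr : 0 < r
    · have hk : ContinuousAt (fun s => kernel B γ γ' s (rayPoint p.1 (γ', r))) t :=
        ContinuousAt.comp (g := fun x : ℂ × ℂ => kernel B γ γ' x.2 x.1)
          (f := fun s => (rayPoint p.1 (γ', r), s))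
          (analyticAt_kernel hmem hγ' (rayPoint_mem (hz γ' hγ') hr)).continuousAt (by fun_prop)
      exact continuousAt_const.mul ((hk.mul continuousAt_const).mul continuousAt_const)
    · simp only [pull_of_nonpos hr]
      exact continuousAt_const

/-- The terms of the Neumann series may be fed into the linearized TBA operator again. -/
theorem linOpAdmissible_iterate (hgen : IsGeneric B P U) (hX : IsSolution B P U X) (hp : p ∈ U)
    (hconv : IsConvergent B P X U) (v : Point m) (n : ℕ) :
    LinOpAdmissible B P X p ((linOp B P X p)^[n] (source v)) := by
  have hof : ∀ n, RayContinuous B P p.1 ((linOp B P X p)^[n] (source v)) →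
      LinOpAdmissible B P X p ((linOp B P X p)^[n] (source v)) := fun n hc =>
    ⟨hc, sumIntegrable_norm_mul hgen hp
      (fun γ hγ => (rayContinuous_li₀ hgen hX hp γ hγ).mul (hc γ hγ)) (hconv.iter_abs p hp v n)⟩
  induction n with
  | zero => exact hof 0 fun γ _ => continuousOn_source v γ
  | succ n ih =>
    refine hof _ ?_
    rw [Function.iterate_succ_apply']
    exact rayContinuous_linOp hgen hX hp ih

theorem source_dθ (b : Fin m) (γ : Charge m) (t : ℂ) :
    source (dθ b) γ t = 2 * Real.pi * Complex.I * γ b := by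
  simp [source, dθ, lin, Pi.single_apply]

theorem source_dz (b : Fin m) (γ : Charge m) (t : ℂ) :
    source (dz b) γ t = -(1 / t * source (dθ b) γ t) := by
  rw [source_dθ]
  simp [source, dz, lin, Pi.single_apply]
  ring

/-- The terms of the Neumann series for `∂_{z^a} log X` and for `t⁻¹ ∂_{θ^a} log X` add up to terms
of Cauchy products of the series for `∂_{θ^a} ∂_{θ^c} W` and `∂_{θ^b} log X`. For `n = 0` the sum
over `k` is empty, so that the truncated difference `n - 1` does not matter. -/
theorem iterate_source_dz (hgen : IsGeneric B P U) (hX : IsSolution B P U X)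
    (hconv : IsConvergent B P X U) (hp : p ∈ U) (a : Fin m) (n : ℕ) {γ : Charge m} {t : ℂ}
    (ht : (t, p) ∈ dom B P U γ) :
    (linOp B P X p)^[n] (source (dz a)) γ t =
      -(1 / t * (linOp B P X p)^[n] (source (dθ a)) γ t) +
      ∑ b, ∑ c, ∑ k ∈ Finset.range n, (1 / (2 * Real.pi * Complex.I)) ^ 2 * (B.omega b c : ℂ) *
        moment B P X p c ((linOp B P X p)^[k] (source (dθ a))) *
        (linOp B P X p)^[n - 1 - k] (source (dθ b)) γ t := by
  induction n generalizing γ t with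
  | zero => simp [source_dz]
  | succ n ih =>
    have hz := hgen.nondegenerate hp
    set T := linOp B P X p with hT
    set κ : ℂ := (1 / (2 * Real.pi * Complex.I)) ^ 2 with hκ
    set φ : Fin m → ℕ → ℂ := fun c k => moment B P X p c (T^[k] (source (dθ a))) with hφ
    set R : Charge m → ℂ → ℂ := fun γ t => ∑ b, ∑ c, ∑ k ∈ Finset.range n,
      κ * (B.omega b c : ℂ) * φ c k * T^[n - 1 - k] (source (dθ b)) γ t with hR
    have hadm := fun v n => linOpAdmissible_iterate hgen hX hp hconv v n
    have hadm1 : ∀ b c k, LinOpAdmissible B P X p (fun γ t =>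
        κ * (B.omega b c : ℂ) * φ c k * T^[n - 1 - k] (source (dθ b)) γ t) := fun b c k =>
      (hadm (dθ b) (n - 1 - k)).const_mul _
    have hadm2 : ∀ b c, LinOpAdmissible B P X p (fun γ t => ∑ k ∈ Finset.range n,
        κ * (B.omega b c : ℂ) * φ c k * T^[n - 1 - k] (source (dθ b)) γ t) := fun b c =>
      LinOpAdmissible.finset_sum _ fun k _ => hadm1 b c k
    have hadm3 : ∀ b, LinOpAdmissible B P X p (fun γ t => ∑ c, ∑ k ∈ Finset.range n,
        κ * (B.omega b c : ℂ) * φ c k * T^[n - 1 - k] (source (dθ b)) γ t) := fun b =>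
      LinOpAdmissible.finset_sum _ fun c _ => hadm2 b c
    have hadmR : LinOpAdmissible B P X p R := LinOpAdmissible.finset_sum _ fun b _ => hadm3 b
    -- applying `T` to the sum of the terms `k < n` raises the second index of each by one
    have hTR : T R γ t = ∑ b, ∑ c, ∑ k ∈ Finset.range n,
        κ * (B.omega b c : ℂ) * φ c k * T^[n - k] (source (dθ b)) γ t := by
      rw [hR, hT, linOp_finset_sum hgen hX _ (fun b _ => hadm3 b) ht]
      refine Finset.sum_congr rfl fun b _ => ?_
      rw [linOp_finset_sum hgen hX _ (fun c _ => hadm2 b c) ht]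
      refine Finset.sum_congr rfl fun c _ => ?_
      rw [linOp_finset_sum hgen hX _ (fun k _ => hadm1 b c k) ht]
      refine Finset.sum_congr rfl fun k hk => ?_
      have hk' : n - k = (n - 1 - k) + 1 := by
        have := Finset.mem_range.1 hk
        omega
      rw [hk', Function.iterate_succ_apply', ← hT, hT, linOp, linOp, ← sumInt_const_mul]
      congr 1
      funext γ' t'
      ring
    obtain ⟨hci, hcomm⟩ := linOp_one_div_mul hgen hX hp (hadm (dθ a) n) ht
    rw [← hT] at hcomm
    have hstep : T (T^[n] (source (dz a))) γ t =
        -T (fun γ t => 1 / t * T^[n] (source (dθ a)) γ t) γ t + T R γ t := by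
      rw [hT, linOp, linOp, linOp, ← sumInt_neg,
        ← sumInt_add hci.neg (hadmR.kernel_int hgen hX ht)]
      refine sumInt_congr hz fun γ' hγ' t' ht' => ?_
      rw [← hT, ih (hgen.mem_dom p hp γ' hγ' t' ht')]
      ring
    rw [Function.iterate_succ_apply', hstep, hcomm, hTR, Function.iterate_succ_apply']
    simp only [Finset.sum_range_succ, Nat.add_sub_cancel, Nat.sub_self, Function.iterate_zero,
      id_eq, Finset.sum_add_distrib, source_dθ]
    -- the commutator of `T` with `1 / t` is the new term `k = n`
    have hlast : ∑ b, ∑ c, κ * (B.omega b c : ℂ) *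
        moment B P X p c (T^[n] (source (dθ a))) * (2 * Real.pi * Complex.I * γ b) =
        1 / (2 * Real.pi * Complex.I) *
        ∑ b, ∑ c, (γ b : ℂ) * B.omega b c * moment B P X p c (T^[n] (source (dθ a))) := by
      simp only [Finset.mul_sum]
      refine Finset.sum_congr rfl fun b _ => Finset.sum_congr rfl fun c _ => ?_
      have hpi : (2 * Real.pi * Complex.I : ℂ) ≠ 0 := Complex.two_pi_I_ne_zero
      rw [hκ]
      generalize (2 * Real.pi * Complex.I : ℂ) = π' at *
      field_simp
    rw [hlast]
    simp only [hφ]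
    ring

/-- The section condition in terms of logarithmic derivatives. Solving `D = S + T D` by the Neumann
series, it results from Abel's theorem on Cauchy products. -/
theorem dlog_dz_add (hgen : IsGeneric B P U) (hX : IsSolution B P U X)
    (hconv : IsConvergent B P X U) (a : Fin m) {γ : Charge m} {t : ℂ}
    (ht : (t, p) ∈ dom B P U γ) :
    dlog X (dz a) p γ t + 1 / t * dlog X (dθ a) p γ t =
      ∑ b, ∑ c, (1 / (2 * Real.pi * Complex.I)) ^ 2 * (B.omega b c : ℂ) *
        moment B P X p c (dlog X (dθ a) p) * dlog X (dθ b) p γ t := by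
  have hp := (dom_spec ht).2.1
  rw [← Finset.sum_product', Finset.univ_product_univ]
  symm
  refine sum_mul_eq_of_tendsto_cauchyProduct
    (f := fun (i : Fin m × Fin m) n => (1 / (2 * Real.pi * Complex.I)) ^ 2 *
      (B.omega i.1 i.2 : ℂ) * moment B P X p i.2 ((linOp B P X p)^[n] (source (dθ a))))
    (g := fun i n => (linOp B P X p)^[n] (source (dθ i.1)) γ t) (fun i => ?_)
    (fun i => hconv.iter_tendsto γ t p ht (dθ i.1)) ?_
  · simp only [← Finset.mul_sum]
    exact (hconv.iter_integral_tendsto p hp (dθ a) i.2).const_mul _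
  · have h1 := (hconv.iter_tendsto γ t p ht (dz a)).add
      ((hconv.iter_tendsto γ t p ht (dθ a)).const_mul (1 / t))
    -- the terms of order zero cancel; the Cauchy product starts in order one
    refine (h1.comp (tendsto_add_atTop_nat 1)).congr fun N => ?_
    simp only [Function.comp_def]
    rw [Finset.mul_sum, ← Finset.sum_add_distrib, Finset.sum_range_succ']
    have h0 : (linOp B P X p)^[0] (source (dz a)) γ t +
        1 / t * (linOp B P X p)^[0] (source (dθ a)) γ t = 0 := by
      simp [source_dz]
    rw [h0, add_zero]
    refine Finset.sum_congr rfl fun n _ => ?_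
    rw [iterate_source_dz hgen hX hconv hp a (n + 1) ht, neg_add_eq_sub, sub_add_cancel,
      ← Finset.sum_product', Finset.univ_product_univ]
    refine Finset.sum_congr rfl fun i _ => ?_
    rw [Finset.Nat.sum_antidiagonal_eq_sum_range_succ_mk]
    refine Finset.sum_congr rfl fun k _ => ?_
    rw [Nat.add_sub_cancel]

/-! ### The heavenly equation and the Joyce potential -/

theorem pd_pd_dθ_plebanski (hU : IsOpen U) (hgen : IsGeneric B P U) (hX : IsSolution B P U X)
    (hconv : IsConvergent B P X U) (hp : p ∈ U) (v : Point m) (b : Fin m) :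
    pd v (pd (dθ b) (plebanski B P X)) p = moment B P X p b (dlog X v p) := by
  have hi := (linOpAdmissible_dlog hgen hX hconv hp v).coe_int hgen hX hp b
  have heq : ∀ (γ : Charge m) t, 2 * Real.pi * Complex.I *
      ((γ b : ℂ) * P.li₀ (X γ t p) * dlog X v p γ t) =
      P.li₀ (X γ t p) * dlog X v p γ t * source (dθ b) γ t := fun γ t => by
    rw [source_dθ]
    ring
  rw [pd_pd_plebanski hU hgen hX hconv hp v (dθ b) ((hi.const_mul _).congr_fun heq)]
  simp only [← heq]
  rw [sumInt_const_mul, ← mul_assoc, one_div_mul_cancel Complex.two_pi_I_ne_zero, one_mul, moment]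

theorem two_pi_I_sq : (1 / (2 * Real.pi * Complex.I) : ℂ) ^ 2 = -(1 / (2 * Real.pi : ℂ) ^ 2) := by
  rw [div_pow, one_pow, mul_pow _ Complex.I, Complex.I_sq, mul_neg_one, div_neg]

theorem omega_swap_cast (B : BPSData m) (b c : Fin m) : (B.omega c b : ℂ) = -(B.omega b c : ℂ) := by
  have := congrFun (congrFun B.skew b) c
  simp only [Matrix.transpose_apply, Matrix.neg_apply] at this
  rw [this]
  push_cast
  rfl

/-- The section condition; the matrix of the pairing is transposed relative to `dlog_dz_add`, which
absorbs the sign of `(2πi)⁻² = -(2π)⁻²`. -/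
theorem uField_plebanski (hU : IsOpen U) (hgen : IsGeneric B P U) (hX : IsSolution B P U X)
    (hconv : IsConvergent B P X U) {γ : Charge m} {t : ℂ} (ht : (t, p) ∈ dom B P U γ)
    (a : Fin m) : uField B (plebanski B P X) t a (X γ t) p = 0 := by
  have hp := (dom_spec ht).2.1
  have hX0 := hX.ne_zero ht
  have hpd : ∀ v, pd v (X γ t) p = X γ t p * dlog X v p γ t := fun v => by
    rw [dlog, mul_div_cancel₀ _ hX0]
  have hmain := dlog_dz_add hgen hX hconv a ht
  rw [Finset.sum_comm] at hmain
  have hsum : ∑ c, ∑ b, (1 / (2 * Real.pi * Complex.I)) ^ 2 * (B.omega b c : ℂ) *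
      moment B P X p c (dlog X (dθ a) p) * dlog X (dθ b) p γ t =
      1 / (2 * Real.pi : ℂ) ^ 2 * ∑ b, ∑ c, (B.omega b c : ℂ) *
        moment B P X p b (dlog X (dθ a) p) * dlog X (dθ c) p γ t := by
    simp only [Finset.mul_sum]
    refine Finset.sum_congr rfl fun b _ => Finset.sum_congr rfl fun c _ => ?_
    rw [two_pi_I_sq, omega_swap_cast B b c]
    ring
  rw [hsum] at hmain
  simp only [uField, hpd, pd_pd_dθ_plebanski hU hgen hX hconv hp]
  have hfac : ∑ b, ∑ c, (B.omega b c : ℂ) * moment B P X p b (dlog X (dθ a) p) *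
      (X γ t p * dlog X (dθ c) p γ t) = X γ t p * ∑ b, ∑ c, (B.omega b c : ℂ) *
        moment B P X p b (dlog X (dθ a) p) * dlog X (dθ c) p γ t := by
    simp only [Finset.mul_sum]
    refine Finset.sum_congr rfl fun b _ => Finset.sum_congr rfl fun c _ => ?_
    ring
  rw [hfac]
  linear_combination X γ t p * hmain

/-- The heavenly equation. Since `S_{z^b} = -S_{θ^b} / t`, the derivative `∂_{z^b} ∂_{θ^a} W`, taken
in the other order, is the sum-integral of `q_b Li₀(X)` against `-t⁻¹ ∂_{θ^a} log X`; the section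
condition expresses it through moments. -/
theorem pd_dz_sub_pd_dz (hU : IsOpen U) (hgen : IsGeneric B P U) (hX : IsSolution B P U X)
    (hconv : IsConvergent B P X U) (hp : p ∈ U) (a b : Fin m) :
    pd (dz a) (pd (dθ b) (plebanski B P X)) p - pd (dz b) (pd (dθ a) (plebanski B P X)) p =
      1 / (2 * Real.pi : ℂ) ^ 2 * ∑ c, ∑ d, (B.omega c d : ℂ) *
        pd (dθ a) (pd (dθ c) (plebanski B P X)) p *
        pd (dθ b) (pd (dθ d) (plebanski B P X)) p := by
  have hz := hgen.nondegenerate hp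
  have hC2 := contDiffOn_plebanski hU hgen hX hconv
  have hadm := linOpAdmissible_dlog hgen hX hconv hp
  set κ : ℂ := (1 / (2 * Real.pi * Complex.I)) ^ 2 with hκ
  set μ : Fin m → Fin m → ℂ := fun c a => moment B P X p c (dlog X (dθ a) p) with hμ
  set S : Charge m → ℂ → ℂ := fun γ t => ∑ e, ∑ c, κ * (B.omega e c : ℂ) * μ c a *
    dlog X (dθ e) p γ t with hS
  have hadm1 : ∀ e c, LinOpAdmissible B P X p (fun γ t => κ * (B.omega e c : ℂ) * μ c a *
      dlog X (dθ e) p γ t) := fun e c => (hadm (dθ e)).const_mul _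
  have hadm2 : ∀ e, LinOpAdmissible B P X p (fun γ t => ∑ c, κ * (B.omega e c : ℂ) * μ c a *
      dlog X (dθ e) p γ t) := fun e => LinOpAdmissible.finset_sum _ fun c _ => hadm1 e c
  have hadmS : LinOpAdmissible B P X p S := LinOpAdmissible.finset_sum _ fun e _ => hadm2 e
  have hsec : ∀ γ, B.index P γ ≠ 0 → ∀ t ∈ ray γ p.1,
      (γ b : ℂ) * P.li₀ (X γ t p) * S γ t -
        (γ b : ℂ) * P.li₀ (X γ t p) * dlog X (dz a) p γ t =
      (γ b : ℂ) * P.li₀ (X γ t p) * (1 / t * dlog X (dθ a) p γ t) := by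
    intro γ hγ t ht
    have := dlog_dz_add hgen hX hconv a (hgen.mem_dom p hp γ hγ t ht)
    simp only [hS, hμ]
    rw [← this]
    ring
  have hi1 := hadmS.coe_int hgen hX hp b
  have hi2 := (hadm (dz a)).coe_int hgen hX hp b
  -- absolute convergence of the sum-integral with the factor `1 / t` follows from the section
  -- condition
  have hi3 := (hi1.sub hi2).congr hz hsec
  have hval3 := (sumInt_congr hz hsec).symm.trans (sumInt_sub hi1 hi2)
  have heq : ∀ (γ : Charge m) t, -(2 * Real.pi * Complex.I) *
      ((γ b : ℂ) * P.li₀ (X γ t p) * (1 / t * dlog X (dθ a) p γ t)) =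
      P.li₀ (X γ t p) * dlog X (dθ a) p γ t * source (dz b) γ t := fun γ t => by
    rw [source_dz, source_dθ]
    ring
  have hmix : pd (dz b) (pd (dθ a) (plebanski B P X)) p =
      moment B P X p b (dlog X (dz a) p) - moment B P X p b S := by
    rw [pd_comm hU hC2 hp, pd_pd_plebanski hU hgen hX hconv hp (dθ a) (dz b)
      ((hi3.const_mul _).congr_fun heq)]
    simp only [← heq]
    rw [sumInt_const_mul, hval3, ← mul_assoc, mul_neg, one_div_mul_cancel Complex.two_pi_I_ne_zero]
    simp only [moment]
    ring
  have hsymm : ∀ c, μ c b = μ b c := fun c => by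
    simp only [hμ]
    rw [← pd_pd_dθ_plebanski hU hgen hX hconv hp, ← pd_pd_dθ_plebanski hU hgen hX hconv hp,
      pd_comm hU hC2 hp]
  have hmS : moment B P X p b S = ∑ e, ∑ c, κ * (B.omega e c : ℂ) * μ c a * μ b e := by
    rw [hS, moment_finset_sum hgen hX hp b _ fun e _ => hadm2 e]
    refine Finset.sum_congr rfl fun e _ => ?_
    rw [moment_finset_sum hgen hX hp b _ fun c _ => hadm1 e c]
    refine Finset.sum_congr rfl fun c _ => ?_
    exact moment_const_mul _ _ _
  rw [hmix, pd_pd_dθ_plebanski hU hgen hX hconv hp, sub_sub_cancel, hmS, Finset.sum_comm,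
    Finset.mul_sum]
  refine Finset.sum_congr rfl fun c _ => ?_
  rw [Finset.mul_sum]
  refine Finset.sum_congr rfl fun d _ => ?_
  rw [pd_pd_dθ_plebanski hU hgen hX hconv hp, pd_pd_dθ_plebanski hU hgen hX hconv hp, hκ,
    two_pi_I_sq, omega_swap_cast B c d, ← hsymm d]
  simp only [hμ]
  ring

/-- The Joyce potential, from the first derivatives of `W` along the fibre coordinates. -/
theorem joyce_eq (hU : IsOpen U) (hgen : IsGeneric B P U) (hX : IsSolution B P U X)
    (hconv : IsConvergent B P X U) (hp : p ∈ U) :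
    ∑ a, p.1 a * pd (dθ a) (plebanski B P X) p = joyce B P X p := by
  have hi : ∀ a, SumIntegrable B P p.1 (fun γ t => (γ a : ℂ) * P.li₁ (X γ t p)) := fun a =>
    sumIntegrable_coe_mul hgen hp (rayContinuous_li₁ hgen hX hp)
      (sumIntegrable_norm_li₁ hgen hX hconv hp) a
  have hpd : ∀ a, pd (dθ a) (plebanski B P X) p =
      sumInt B P p.1 (fun γ t => (γ a : ℂ) * P.li₁ (X γ t p)) := by
    intro a
    rw [(pd_plebanski hU hgen hX hconv).2 p hp]
    have heq : ∀ (γ : Charge m) t, P.li₁ (X γ t p) * source (dθ a) γ t =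
        2 * Real.pi * Complex.I * ((γ a : ℂ) * P.li₁ (X γ t p)) := fun γ t => by
      rw [source_dθ]
      ring
    simp only [heq]
    rw [sumInt_const_mul, ← mul_assoc, one_div_mul_cancel Complex.two_pi_I_ne_zero, one_mul]
  simp only [hpd, ← sumInt_const_mul]
  rw [← sumInt_finset_sum _ fun a _ => (hi a).const_mul _, sumInt, joyce]
  refine tsum_congr fun γ => ?_
  rw [mul_assoc, rayIntegral, rayIntegral, ← integral_const_mul (lin γ p.1)]
  congr 2
  funext r
  have : ∑ a, p.1 a * ((γ a : ℂ) * P.li₁ (X γ (r * (Complex.I * lin γ p.1)) p)) =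
      lin γ p.1 * P.li₁ (X γ (r * (Complex.I * lin γ p.1)) p) := by
    rw [lin, Finset.sum_mul]
    exact Finset.sum_congr rfl fun a _ => by ring
  simp only [this]
  ring

end Neumann

end ConformalTBA

end

theorem mainTheorem1 {m : ℕ} (B : BPSData m) (P : Presentation)
    (U : Set (Point m)) (hU : IsOpen U) (hgen : IsGeneric B P U)
    (X : Charge m → ℂ → Point m → ℂ)
    (hX : IsSolution B P U X) (hconv : IsConvergent B P X U) :
    ContDiffOn ℂ 2 (plebanski B P X) U ∧
    (∀ (γ : Charge m) (t : ℂ) (p : Point m), (t, p) ∈ dom B P U γ → ∀ a : Fin m,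
      uField B (plebanski B P X) t a (X γ t) p = 0) ∧
    (∀ p ∈ U, ∀ a b : Fin m,
      pd (dz a) (pd (dθ b) (plebanski B P X)) p - pd (dz b) (pd (dθ a) (plebanski B P X)) p =
        1 / (2 * Real.pi : ℂ) ^ 2 * ∑ c, ∑ d, (B.omega c d : ℂ) *
          pd (dθ a) (pd (dθ c) (plebanski B P X)) p *
          pd (dθ b) (pd (dθ d) (plebanski B P X)) p) ∧
    (∀ p ∈ U, ∑ a, p.1 a * pd (dθ a) (plebanski B P X) p = joyce B P X p) :=
  ⟨contDiffOn_plebanski hU hgen hX hconv,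
    fun _ _ _ ht a => uField_plebanski hU hgen hX hconv ht a,
    fun _ hp a b => pd_dz_sub_pd_dz hU hgen hX hconv hp a b,
    fun _ hp => joyce_eq hU hgen hX hconv hp⟩
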